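/- Model. Algorithms are programs for a randomized word RAM: finitely many control states and registers, a read-only random-access input array, a random-access work memory (initially zero), unit-cost arithmetic, bitwise, comparison and memory instructions, and an instruction that draws a uniformly random element of $\{0,\dots,m-1\}$ for a given word $m$. Words have $O(\log N+\log U)$ bits, where $N$ is the length of the input array and $U$ is the largest absolute value of an input word; that is, for some constant $e$ depending only on the program, all integers occurring in a computation have absolute value at most $(N+U+2)^e$. Space is counted in words: the registers plus the shortest initial segment of the work memory that contains all accessed cells; the read-only input is not counted. For $k\ge 1$, the problem $k$-SUM on $n\ge 1$ numbers is: given $k$ lists $S_1,\dots,S_k$ of $n$ integers each and a target integer $t$ (the input array holds $n$, $t$ and the lists), decide whether there are $s_i\in S_i$ ($1\le i\le k$) with $s_1+\dots+s_k=t$. A Las Vegas algorithm for $k$-SUM with time $T(n)$ and space $s(n)$ is a program which, on every such instance, never gives a wrong answer, uses at most $s(n)$ words of space whatever its random choices are, and halts after an expected number of at most $T(n)$ steps, the expectation being over its random choices only. $T(n)=\tilde O(g(n))$ means $T(n)=O(g(n)\log^c n)$ for some constant $c$, as $n\to\infty$. Corollary. Let $k_1\ge 3$ and $k_2\ge 1$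 be integers and let $\alpha$ be a real constant. Suppose that there is a Las Vegas algorithm that solves $k_1$-SUM on $n$ numbers in $\tilde O(n^{\alpha})$ time and $O(n)$ space. Then there is a Las Vegas algorithm that solves $(k_1\cdot k_2)$-SUM on $n$ numbers in $$\tilde O\left(n^{k_1k_2-k_1+1}+n^{k_1k_2-k_1+1+(\alpha-k_2)}\right)$$ time and $O(n)$ space. -/

import Mathlib

open Filter Asymptotics
open scoped ENNReal

/-! ### A randomized word RAM -/

/-- The word operations of the machine, each of unit cost. -/
inductive WordOp where
  | add | sub | mul | div | mod | land | lor | lxor | shl | shr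

/-- Division and remainder are Euclidean; the shifts are multiplication and (floor) division by a
power of two; the bitwise operations act on two's complement representations. -/
def WordOp.eval : WordOp → ℤ → ℤ → ℤ
  | .add, a, b => a + b
  | .sub, a, b => a - b
  | .mul, a, b => a * b
  | .div, a, b => a / b
  | .mod, a, b => a % b
  | .land, a, b => Int.land a b
  | .lor, a, b => Int.lor a b
  | .lxor, a, b => Int.xor a b
  | .shl, a, b => a * 2 ^ b.toNat
  | .shr, a, b => a / 2 ^ b.toNat

/-- Instructions over control states (program lines) `Q` and registers `R`. An instruction that does
not halt names the control state in which the computation goes on. -/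
inductive Instr (Q R : Type) where
  /-- `d := z` for a constant `z` of the program -/
  | const (d : R) (z : ℤ) (next : Q)
  /-- `d := a ∘ b` for a word operation `∘` -/
  | op (o : WordOp) (d a b : R) (next : Q)
  /-- `d := input[a]`; the input is read-only -/
  | input (d a : R) (next : Q)
  /-- `d := memory[a]` -/
  | load (d a : R) (next : Q)
  /-- `memory[a] := s` -/
  | store (a s : R) (next : Q)
  /-- `d :=` a fresh uniformly random element of `{0, …, a - 1}` (`0` if `a ≤ 0`) -/
  | rand (d a : R) (next : Q)
  /-- go to `yes` if `a < b`, and to `no` otherwise -/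
  | jumpLt (a b : R) (yes no : Q)
  /-- stop and answer `ans` -/
  | halt (ans : Bool)

/-- A program of the randomized word RAM: a finite set of control states, finitely many registers,
and one instruction for each control state. -/
structure WordRAM where
  Q : Type
  R : Type
  [finQ : Fintype Q]
  [finR : Fintype R]
  [decR : DecidableEq R]
  start : Q
  code : Q → Instr Q R

attribute [instance] WordRAM.finQ WordRAM.finR WordRAM.decR

namespace WordRAM

/-- A configuration: control state, registers, and the random-access work memory. -/
@[ext] structure Config (M : WordRAM) where
  pc : M.Q
  reg : M.R → ℤ
  mem : ℕ → ℤ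

/-- The uniform distribution on `{0, …, m - 1}`, and the point mass at `0` if `m ≤ 0`. -/
noncomputable def uniformBelow (m : ℤ) : PMF ℤ :=
  if h : 0 < m then PMF.uniformOfFinset (Finset.Ico 0 m) ⟨0, Finset.mem_Ico.2 ⟨le_rfl, h⟩⟩
  else PMF.pure 0

variable (M : WordRAM)

/-- Registers and work memory are zero at the start. -/
def init : M.Config := ⟨M.start, fun _ => 0, fun _ => 0⟩

variable {M}

/-- Set register `d` to `z` and go to `q`. -/
def Config.set (c : M.Config) (d : M.R) (z : ℤ) (q : M.Q) : M.Config :=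
  { c with pc := q, reg := Function.update c.reg d z }

variable (M)

/-- One step on the input array `x`. Cells beyond the end of the input read as `0`, a negative
address means the address `0`, and a halting configuration is kept. -/
noncomputable def step (x : List ℤ) (c : M.Config) : PMF M.Config :=
  match M.code c.pc with
  | .const d z q => PMF.pure (c.set d z q)
  | .op o d a b q => PMF.pure (c.set d (o.eval (c.reg a) (c.reg b)) q)
  | .input d a q => PMF.pure (c.set d (x.getD (c.reg a).toNat 0) q)
  | .load d a q => PMF.pure (c.set d (c.mem (c.reg a).toNat) q)
  | .store a s q =>
      PMF.pure { c with pc := q, mem := Function.update c.mem (c.reg a).toNat (c.reg s) }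
  | .rand d a q => (uniformBelow (c.reg a)).map fun z => c.set d z q
  | .jumpLt a b q₁ q₂ => PMF.pure { c with pc := if c.reg a < c.reg b then q₁ else q₂ }
  | .halt _ => PMF.pure c

/-- The distribution of the configuration after `t` steps on the input `x`. -/
noncomputable def run (x : List ℤ) : ℕ → PMF M.Config
  | 0 => PMF.pure M.init
  | t + 1 => (run x t).bind (M.step x)

/-- The configurations that occur with positive probability on the input `x`. -/
def Reachable (x : List ℤ) (c : M.Config) : Prop := ∃ t, c ∈ (M.run x t).support

/-- The configuration `c` has stopped with the answer `b`. -/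
def Answers (c : M.Config) (b : Bool) : Prop := M.code c.pc = Instr.halt b

/-- The expected number of steps before halting, `∑ₜ P(the machine has not halted after t steps)`;
the probability is over the random choices of the machine only. -/
noncomputable def expectedTime (x : List ℤ) : ℝ≥0∞ :=
  ∑' t, (M.run x t).toOuterMeasure {c | ∀ b, ¬ M.Answers c b}

/-- The instruction that is about to be executed in `c` accesses cell `i` of the work memory. -/
def Accesses (c : M.Config) (i : ℕ) : Prop :=
  match M.code c.pc with
  | .load _ a _ => (c.reg a).toNat = i
  | .store a _ _ => (c.reg a).toNat = i
  | _ => False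

/-- Whatever the random choices, at most `s` words are used on the input `x`: the registers and an
initial segment of the work memory that contains all accessed cells. The read-only input is not
counted. -/
def SpaceAtMost (x : List ℤ) (s : ℕ) : Prop :=
  ∃ m, Fintype.card M.R + m ≤ s ∧ ∀ c, M.Reachable x c → ∀ i, M.Accesses c i → i < m

/-- The largest absolute value of an input word. -/
def magnitude (x : List ℤ) : ℕ := (x.map Int.natAbs).foldr max 0

/-- Whatever the random choices, all words that occur on the input `x` have absolute value at most
`(|x| + magnitude x + 2) ^ e`, which is a word length of `O(log |x| + log (magnitude x))` bits. -/
def WordsFit (x : List ℤ) (e : ℕ) : Prop :=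
  ∀ c, M.Reachable x c →
    (∀ r, (c.reg r).natAbs ≤ (x.length + magnitude x + 2) ^ e) ∧
    (∀ i, (c.mem i).natAbs ≤ (x.length + magnitude x + 2) ^ e)

end WordRAM

/-! ### k-SUM -/

/-- `k` lists of `n` integers each contain one number each, with sum `t`. -/
def KSum {k n : ℕ} (S : Fin k → Fin n → ℤ) (t : ℤ) : Prop :=
  ∃ f : Fin k → Fin n, ∑ i, S i (f i) = t

/-- The input array of an instance: `n`, the target, and the `k` lists one after the other. -/
def kSumInput {k n : ℕ} (S : Fin k → Fin n → ℤ) (t : ℤ) : List ℤ :=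
  (n : ℤ) :: t :: List.ofFn fun p : Fin (k * n) => S p.divNat p.modNat

/-- `M` is a Las Vegas algorithm for `k`-SUM on `n` numbers that takes expected time at most `T n`
and at most `s n` words of space: its answer is always right, and only its running time depends on
its random choices. -/
def IsLasVegasKSum (k : ℕ) (M : WordRAM) (T : ℕ → ℝ) (s : ℕ → ℕ) : Prop :=
  ∃ e : ℕ, ∀ n : ℕ, 1 ≤ n → ∀ (S : Fin k → Fin n → ℤ) (t : ℤ),
    (∀ c b, M.Reachable (kSumInput S t) c → M.Answers c b → (b = true ↔ KSum S t)) ∧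
    M.expectedTime (kSumInput S t) ≤ ENNReal.ofReal (T n) ∧
    M.SpaceAtMost (kSumInput S t) (s n) ∧
    M.WordsFit (kSumInput S t) e

/-- `T = Õ(g)`: big-O up to a factor that is polylogarithmic in `n`. -/
def IsSoftO (T g : ℕ → ℝ) : Prop :=
  ∃ c : ℕ, T =O[atTop] fun n : ℕ => g n * Real.log n ^ c

/-- `k`-SUM has a Las Vegas algorithm with time `Õ(g)` and space `O(n)`. -/
def LinearSpaceLasVegasKSum (k : ℕ) (g : ℕ → ℝ) : Prop :=
  ∃ (M : WordRAM) (T : ℕ → ℝ) (s : ℕ → ℕ), IsLasVegasKSum k M T s ∧ IsSoftO T g ∧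
    (fun n => (s n : ℝ)) =O[atTop] fun n : ℕ => (n : ℝ)

/-! Write `k₁ = κ + 1` and `k₂ = w`. The lists are put into `κ + 1` groups of `w` lists. A group has
`N = n ^ w` sums with one entry per list, so the problem becomes `(κ + 1)`-SUM on sets of `N`
numbers. Each set is ordered, with ties broken by the index, and cut into `m = n ^ (w - 1)` chunks
of `n` consecutive numbers. Given one chunk of each of the first `κ` groups, with least numbers `lo`
and largest numbers `hi`, a number of the last group can complete a solution only if it lies between
`t - ∑ hi` and `t - ∑ lo`. The algorithm runs through all `m ^ κ` tuples of chunks, covers this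
range by successive blocks of `n` numbers of the last group, and calls the given algorithm on each
resulting instance with `κ + 1` lists of `n` numbers.

Number of calls. For a fixed number `y` of the last group, at most `κ m ^ (κ - 1)` tuples satisfy `∑
lo < t - y < ∑ hi` (`levSum_between_le`): chunks of one group overlap at most in endpoints, so apart
from the cases counted by induction one coordinate is determined by the others. Over all `N = m n`
numbers this gives at most `κ n m ^ κ` incidences. For each tuple, every block except the last uses
up `n` of them (`Tried.numAbove_le`); the inequalities are strict because equality would be a
solution, which the call would have found. Hence there are `O(m ^ κ)` calls
(`Inst.levSum_weight_le`).

Space. The sets are never stored. The next chunk is found by one scan over the `N` sums of a group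
that keeps the `n` smallest keys above the maximum of the previous chunk in a tree of maxima
(`Selected.chunk`, `run_select`). This takes `O(n)` words and `O(N log n)` steps. In total the time
is `m ^ κ (n ^ w log n + T n)` up to a constant, and `m ^ κ n ^ w` and `m ^ κ n ^ α` are the two
terms of the claim.

Realization on the machine. A small structured language is compiled to machine code
(`Host.at_codeP`); one of its instructions simulates the given machine step by step
(`Host.goodAt_sim`). Triples `Host.Run` treat correctness, memory safety, word size and expected
time at once. Budgets for the expected time add up along the program, since the bound for a call
holds on each instance, whatever happened before. `run_inner` and `run_nest` carry the loops, and
`exists_isLasVegasKSum` assembles the machine. -/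

set_option linter.unusedSectionVars false
set_option linter.constructorNameAsVariable false

/-! ### Expectations -/

/-- The expectation of `f` under `p`. -/
noncomputable def PMF.expect {α : Type*} (p : PMF α) (f : α → ℝ≥0∞) : ℝ≥0∞ := ∑' a, p a * f a

namespace PMF

variable {α β : Type*}

lemma expect_pure (a : α) (f : α → ℝ≥0∞) : (PMF.pure a).expect f = f a := by
  rw [expect, tsum_eq_single a]
  · simp
  · intro b hb
    simp [PMF.pure_apply, hb]

lemma expect_bind (p : PMF α) (g : α → PMF β) (f : β → ℝ≥0∞) :
    (p.bind g).expect f = p.expect fun a => (g a).expect f := by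
  simp only [expect, PMF.bind_apply]
  simp_rw [← ENNReal.tsum_mul_right, ← ENNReal.tsum_mul_left]
  rw [ENNReal.tsum_comm]
  simp_rw [mul_assoc]

lemma expect_map (p : PMF α) (g : α → β) (f : β → ℝ≥0∞) :
    (p.map g).expect f = p.expect fun a => f (g a) := by
  rw [← PMF.bind_pure_comp, expect_bind]
  simp [expect_pure]

lemma expect_mono (p : PMF α) {f g : α → ℝ≥0∞} (h : ∀ a ∈ p.support, f a ≤ g a) :
    p.expect f ≤ p.expect g := by
  refine ENNReal.tsum_le_tsum fun a => ?_
  by_cases ha : p a = 0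
  · simp [ha]
  · exact mul_le_mul_right (h a ((PMF.mem_support_iff _ _).2 ha)) _

lemma expect_add (p : PMF α) (f g : α → ℝ≥0∞) :
    (p.expect fun a => f a + g a) = p.expect f + p.expect g := by
  simp only [expect, mul_add, ENNReal.tsum_add]

lemma expect_const (p : PMF α) (r : ℝ≥0∞) : (p.expect fun _ => r) = r := by
  simp [expect, ENNReal.tsum_mul_right, p.tsum_coe]

lemma expect_const_mul (p : PMF α) (r : ℝ≥0∞) (f : α → ℝ≥0∞) :
    (p.expect fun a => r * f a) = r * p.expect f := by
  simp only [expect, ← ENNReal.tsum_mul_left]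
  exact tsum_congr fun a => by ring

end PMF

/-! ### Runs from an arbitrary configuration -/

namespace WordRAM

variable (M : WordRAM) (x : List ℤ)

/-- The distribution after `t` steps from `c`. -/
noncomputable def runFrom : ℕ → M.Config → PMF M.Config
  | 0, c => PMF.pure c
  | t + 1, c => (M.step x c).bind (runFrom t)

lemma runFrom_succ' (t : ℕ) (c : M.Config) :
    M.runFrom x (t + 1) c = (M.runFrom x t c).bind (M.step x) := by
  induction t generalizing c with
  | zero => simp [runFrom]
  | succ t ih =>
    rw [runFrom]
    conv_lhs => enter [2, c']; rw [ih c']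
    rw [← PMF.bind_bind]
    rfl

lemma run_eq_runFrom (t : ℕ) : M.run x t = M.runFrom x t M.init := by
  induction t with
  | zero => rfl
  | succ t ih => rw [runFrom_succ', run, ih]

/-- The configuration has stopped. -/
def Halted (c : M.Config) : Prop := ∃ b, M.Answers c b

lemma step_halted {c : M.Config} (h : M.Halted c) : M.step x c = PMF.pure c := by
  obtain ⟨b, hb⟩ := h
  unfold step
  rw [hb]

/-- The probability that the run from `c` has not stopped after `t` steps. -/
noncomputable def aliveProb (t : ℕ) (c : M.Config) : ℝ≥0∞ :=
  (M.runFrom x t c).toOuterMeasure {c | ∀ b, ¬ M.Answers c b}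

lemma aliveProb_zero {c : M.Config} (h : ¬ M.Halted c) : M.aliveProb x 0 c = 1 := by
  have : c ∈ {c | ∀ b, ¬ M.Answers c b} := fun b hb => h ⟨b, hb⟩
  rw [aliveProb, runFrom, PMF.toOuterMeasure_pure_apply, if_pos this]

lemma aliveProb_succ (t : ℕ) (c : M.Config) :
    M.aliveProb x (t + 1) c = (M.step x c).expect (M.aliveProb x t) := by
  simp [aliveProb, runFrom, PMF.toOuterMeasure_bind_apply, PMF.expect]

lemma aliveProb_halted (t : ℕ) {c : M.Config} (h : M.Halted c) : M.aliveProb x t c = 0 := by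
  induction t with
  | zero =>
    have : c ∉ {c | ∀ b, ¬ M.Answers c b} := fun h' => h.elim fun b hb => h' b hb
    rw [aliveProb, runFrom, PMF.toOuterMeasure_pure_apply, if_neg this]
  | succ t ih => rw [aliveProb_succ, step_halted M x h, PMF.expect_pure, ih]

/-- The expected number of steps before halting from `c`. -/
noncomputable def remainingTime (c : M.Config) : ℝ≥0∞ := ∑' t, M.aliveProb x t c

lemma remainingTime_init : M.remainingTime x M.init = M.expectedTime x := by
  simp [remainingTime, expectedTime, aliveProb, run_eq_runFrom]

lemma remainingTime_eq {c : M.Config} (h : ¬ M.Halted c) :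
    M.remainingTime x c = 1 + (M.step x c).expect (M.remainingTime x) := by
  rw [remainingTime, tsum_eq_zero_add' ENNReal.summable, aliveProb_zero M x h]
  simp only [aliveProb_succ, remainingTime, PMF.expect]
  rw [ENNReal.tsum_comm]
  simp [ENNReal.tsum_mul_left]

/-- The expected number of steps, counting only the first `T` of them. -/
noncomputable def timeUpTo (T : ℕ) (c : M.Config) : ℝ≥0∞ :=
  ∑ t ∈ Finset.range T, M.aliveProb x t c

lemma timeUpTo_halted (T : ℕ) {c : M.Config} (h : M.Halted c) : M.timeUpTo x T c = 0 := by
  simp [timeUpTo, aliveProb_halted M x _ h]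

lemma timeUpTo_succ (T : ℕ) {c : M.Config} (h : ¬ M.Halted c) :
    M.timeUpTo x (T + 1) c = 1 + (M.step x c).expect (M.timeUpTo x T) := by
  rw [timeUpTo, Finset.sum_range_succ', aliveProb_zero M x h, add_comm]
  congr 1
  simp only [aliveProb_succ, timeUpTo, PMF.expect, Finset.mul_sum]
  rw [Summable.tsum_finsetSum fun _ _ => ENNReal.summable]

lemma timeUpTo_mono {T T' : ℕ} (h : T ≤ T') (c : M.Config) :
    M.timeUpTo x T c ≤ M.timeUpTo x T' c :=
  Finset.sum_le_sum_of_subset (Finset.range_mono h)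

/-! ### Safe runs within a time budget -/

variable (Safe : M.Config → Prop)

/-- During the first `T` steps from `c` all configurations are safe, and their expected number is at
most `r`. -/
def Good (T : ℕ) (c : M.Config) (r : ℝ≥0∞) : Prop :=
  (∀ t < T, ∀ c' ∈ (M.runFrom x t c).support, Safe c') ∧ M.timeUpTo x T c ≤ r

variable {M x Safe}

lemma Good.mono {T : ℕ} {c : M.Config} {r r' : ℝ≥0∞} (h : M.Good x Safe T c r) (hr : r ≤ r') :
    M.Good x Safe T c r' := ⟨h.1, h.2.trans hr⟩

lemma Good.anti {T T' : ℕ} {c : M.Config} {r : ℝ≥0∞} (h : M.Good x Safe T' c r) (hT : T ≤ T') :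
    M.Good x Safe T c r :=
  ⟨fun t ht => h.1 t (ht.trans_le hT), (M.timeUpTo_mono x hT c).trans h.2⟩

lemma good_zero (c : M.Config) (r : ℝ≥0∞) : M.Good x Safe 0 c r := by
  simp [Good, timeUpTo]

lemma good_halted {T : ℕ} {c : M.Config} (r : ℝ≥0∞) (hc : Safe c) (h : M.Halted c) :
    M.Good x Safe T c r := by
  refine ⟨fun t _ => ?_, by simp [timeUpTo_halted M x T h]⟩
  have : M.runFrom x t c = PMF.pure c := by
    induction t with
    | zero => rfl
    | succ t ih => rw [runFrom, step_halted M x h, PMF.pure_bind, ih (by omega)]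
  intro c' hc'
  rw [this] at hc'
  simp at hc'
  exact hc' ▸ hc

/-- The budget `f` may depend on the outcome of a random draw, and only its average is charged. The
simulation of random instructions relies on this form. -/
lemma good_step {T : ℕ} {c : M.Config} {f : M.Config → ℝ≥0∞} (hc : Safe c) (h : ¬ M.Halted c)
    (hs : ∀ c' ∈ (M.step x c).support, M.Good x Safe T c' (f c')) :
    M.Good x Safe (T + 1) c (1 + (M.step x c).expect f) := by
  refine ⟨?_, ?_⟩
  · rintro (_ | t) ht c' hc'
    · simp [runFrom] at hc'
      exact hc' ▸ hc
    · rw [runFrom, PMF.mem_support_bind_iff] at hc'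
      obtain ⟨c₁, h₁, h₂⟩ := hc'
      exact (hs c₁ h₁).1 t (by omega) c' h₂
  · rw [timeUpTo_succ M x T h]
    gcongr
    exact PMF.expect_mono _ fun c' hc' => (hs c' hc').2

lemma good_step_pure {T : ℕ} {c c' : M.Config} {r : ℝ≥0∞} (hc : Safe c) (h : ¬ M.Halted c)
    (hs : M.step x c = PMF.pure c') (hg : M.Good x Safe T c' r) :
    M.Good x Safe (T + 1) c (1 + r) := by
  have := good_step (T := T) (f := fun _ => r) hc h (x := x) (by
    intro c₁ h₁
    rw [hs] at h₁
    simp at h₁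
    exact h₁ ▸ hg)
  rwa [PMF.expect_const] at this

/-- A safe start state with a budget that works for every time horizon. -/
lemma good_init {r : ℝ≥0∞} (h : ∀ T, M.Good x Safe T M.init r) :
    (∀ c, M.Reachable x c → Safe c) ∧ M.expectedTime x ≤ r := by
  refine ⟨fun c ⟨t, ht⟩ => ?_, ?_⟩
  · rw [run_eq_runFrom] at ht
    exact (h (t + 1)).1 t (by omega) c ht
  · rw [← remainingTime_init, remainingTime, ENNReal.tsum_eq_iSup_nat]
    exact iSup_le fun T => (h T).2

lemma Reachable.step {c c' : M.Config} (h : M.Reachable x c) (h' : c' ∈ (M.step x c).support) :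
    M.Reachable x c' := by
  obtain ⟨t, ht⟩ := h
  exact ⟨t + 1, by rw [run, PMF.mem_support_bind_iff]; exact ⟨c, ht, h'⟩⟩

lemma reachable_init : M.Reachable x M.init := ⟨0, by simp [run]⟩

end WordRAM

/-! ### A structured language for the word RAM -/

/-- The arithmetic operations of expressions. -/
inductive Arith where
  | add | sub | mul | div | mod

/-- The word operation. -/
def Arith.toOp : Arith → WordOp
  | .add => .add
  | .sub => .sub
  | .mul => .mul
  | .div => .div
  | .mod => .mod

/-- Expressions over the variables `W`, the input and the work memory. -/
inductive Expr (W : Type) where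
  | var (w : W)
  | lit (z : ℤ)
  | op (o : Arith) (a b : Expr W)
  | input (a : Expr W)
  | load (a : Expr W)

namespace Expr

variable {W : Type}

instance : Add (Expr W) := ⟨.op .add⟩
instance : Sub (Expr W) := ⟨.op .sub⟩
instance : Mul (Expr W) := ⟨.op .mul⟩
instance : Div (Expr W) := ⟨.op .div⟩
instance : Mod (Expr W) := ⟨.op .mod⟩

/-- The value of an expression. -/
def eval (x : List ℤ) (ρ : W → ℤ) (μ : ℕ → ℤ) : Expr W → ℤ
  | .var w => ρ w
  | .lit z => z
  | .op o a b => o.toOp.eval (a.eval x ρ μ) (b.eval x ρ μ)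
  | .input a => x.getD (a.eval x ρ μ).toNat 0
  | .load a => μ (a.eval x ρ μ).toNat

section simp
variable (x : List ℤ) (ρ : W → ℤ) (μ : ℕ → ℤ) (a b : Expr W)
@[simp] lemma eval_var (w : W) : (var w).eval x ρ μ = ρ w := rfl
@[simp] lemma eval_lit (z : ℤ) : (lit z : Expr W).eval x ρ μ = z := rfl
@[simp] lemma eval_add : (a + b).eval x ρ μ = a.eval x ρ μ + b.eval x ρ μ := rfl
@[simp] lemma eval_sub : (a - b).eval x ρ μ = a.eval x ρ μ - b.eval x ρ μ := rfl
@[simp] lemma eval_mul : (a * b).eval x ρ μ = a.eval x ρ μ * b.eval x ρ μ := rfl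
@[simp] lemma eval_div : (a / b).eval x ρ μ = a.eval x ρ μ / b.eval x ρ μ := rfl
@[simp] lemma eval_mod : (a % b).eval x ρ μ = a.eval x ρ μ % b.eval x ρ μ := rfl
@[simp] lemma eval_input : (input a).eval x ρ μ = x.getD (a.eval x ρ μ).toNat 0 := rfl
@[simp] lemma eval_load : (load a).eval x ρ μ = μ (a.eval x ρ μ).toNat := rfl
end simp

/-- All memory accesses of the evaluation are to cells below `ms`. -/
def Safe (x : List ℤ) (ρ : W → ℤ) (μ : ℕ → ℤ) (ms : ℕ) : Expr W → Prop
  | .var _ => True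
  | .lit _ => True
  | .op _ a b => a.Safe x ρ μ ms ∧ b.Safe x ρ μ ms
  | .input a => a.Safe x ρ μ ms
  | .load a => a.Safe x ρ μ ms ∧ (a.eval x ρ μ).toNat < ms

section simp
variable (x : List ℤ) (ρ : W → ℤ) (μ : ℕ → ℤ) (ms : ℕ) (a b : Expr W)
@[simp] lemma safe_var (w : W) : (var w).Safe x ρ μ ms := trivial
@[simp] lemma safe_lit (z : ℤ) : (lit z : Expr W).Safe x ρ μ ms := trivial
@[simp] lemma safe_add : (a + b).Safe x ρ μ ms ↔ a.Safe x ρ μ ms ∧ b.Safe x ρ μ ms := Iff.rfl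
@[simp] lemma safe_sub : (a - b).Safe x ρ μ ms ↔ a.Safe x ρ μ ms ∧ b.Safe x ρ μ ms := Iff.rfl
@[simp] lemma safe_mul : (a * b).Safe x ρ μ ms ↔ a.Safe x ρ μ ms ∧ b.Safe x ρ μ ms := Iff.rfl
@[simp] lemma safe_div : (a / b).Safe x ρ μ ms ↔ a.Safe x ρ μ ms ∧ b.Safe x ρ μ ms := Iff.rfl
@[simp] lemma safe_mod : (a % b).Safe x ρ μ ms ↔ a.Safe x ρ μ ms ∧ b.Safe x ρ μ ms := Iff.rfl
@[simp] lemma safe_input : (input a).Safe x ρ μ ms ↔ a.Safe x ρ μ ms := Iff.rfl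
@[simp] lemma safe_load : (load a).Safe x ρ μ ms ↔
    a.Safe x ρ μ ms ∧ (a.eval x ρ μ).toNat < ms := Iff.rfl
end simp

/-- The number of temporary registers beyond the first that the evaluation needs. -/
def depth : Expr W → ℕ
  | .var _ => 0
  | .lit _ => 0
  | .op _ a b => max a.depth (b.depth + 1)
  | .input a => a.depth
  | .load a => a.depth

/-- The number of leaves. -/
def size : Expr W → ℕ
  | .var _ => 1
  | .lit _ => 1
  | .op _ a b => a.size + b.size
  | .input a => a.size
  | .load a => a.size

/-- The largest absolute value of a constant. -/
def maxLit : Expr W → ℕ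
  | .var _ => 0
  | .lit z => z.natAbs
  | .op _ a b => max a.maxLit b.maxLit
  | .input a => a.maxLit
  | .load a => a.maxLit

/-- The number of steps of the evaluation. -/
def cost : Expr W → ℕ
  | .var _ => 1
  | .lit _ => 1
  | .op _ a b => a.cost + b.cost + 1
  | .input a => a.cost + 1
  | .load a => a.cost + 1

/-- The expression can be evaluated with `D + 1` temporary registers, has at most `s` leaves, and
constants of absolute value at most `Y`. -/
def Ok (D s Y : ℕ) (e : Expr W) : Prop := e.depth + 1 ≤ D ∧ e.size ≤ s ∧ e.maxLit ≤ Y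

lemma Ok.mono {D s Y D' s' Y' : ℕ} {e : Expr W} (h : e.Ok D s Y) (hD : D ≤ D') (hs : s ≤ s')
    (hY : Y ≤ Y') : e.Ok D' s' Y' := ⟨h.1.trans hD, h.2.1.trans hs, h.2.2.trans hY⟩

lemma one_le_size (e : Expr W) : 1 ≤ e.size := by
  induction e <;> simp [size] <;> omega

/-- Both powers are at least `2`, so their sum is at most their product, and all five operations are
covered by the bound for multiplication. Remainders modulo `0` return the dividend. -/
lemma natAbs_eval_arith_le {Y s s' : ℕ} (hY : 2 ≤ Y) (hs : 1 ≤ s) (hs' : 1 ≤ s') (o : Arith)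
    {a b : ℤ} (ha : a.natAbs ≤ Y ^ s) (hb : b.natAbs ≤ Y ^ s') :
    (o.toOp.eval a b).natAbs ≤ Y ^ (s + s') := by
  have h1 : 2 ≤ Y ^ s := hY.trans (Nat.le_self_pow (by omega) _)
  have h2 : 2 ≤ Y ^ s' := hY.trans (Nat.le_self_pow (by omega) _)
  have hadd : Y ^ s + Y ^ s' ≤ Y ^ (s + s') := by rw [pow_add]; nlinarith
  cases o <;> simp only [Arith.toOp, WordOp.eval]
  · exact (Int.natAbs_add_le a b).trans (by omega)
  · exact (Int.natAbs_sub_le a b).trans (by omega)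
  · rw [Int.natAbs_mul, pow_add]; exact Nat.mul_le_mul ha hb
  · exact (Int.natAbs_ediv_le_natAbs a b).trans (by omega)
  · by_cases h0 : b = 0
    · subst h0; simpa using (by omega : a.natAbs ≤ Y ^ (s + s'))
    · have := Int.emod_nonneg a h0
      have := Int.emod_lt a h0
      omega

/-- Words in the evaluation of an expression are polynomially bounded. -/
lemma natAbs_eval_le {Y : ℕ} (hY : 2 ≤ Y) {x : List ℤ} {ρ : W → ℤ} {μ : ℕ → ℤ}
    (hx : ∀ i, (x.getD i 0).natAbs ≤ Y) (hρ : ∀ w, (ρ w).natAbs ≤ Y) (hμ : ∀ i, (μ i).natAbs ≤ Y)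
    (e : Expr W) (he : e.maxLit ≤ Y) : (e.eval x ρ μ).natAbs ≤ Y ^ e.size := by
  induction e with
  | var w => simpa [size] using hρ w
  | lit z => simpa [size, maxLit] using he
  | op o a b iha ihb =>
    simp only [maxLit, max_le_iff] at he
    exact natAbs_eval_arith_le hY a.one_le_size b.one_le_size o (iha he.1) (ihb he.2)
  | input a => exact (hx _).trans (Nat.le_self_pow (by have := a.one_le_size; simp [size]; omega) _)
  | load a => exact (hμ _).trans (Nat.le_self_pow (by have := a.one_le_size; simp [size]; omega) _)

end Expr

/-- Programs over the variables `W`. The instruction `call` runs a given machine on an instance in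
the work memory. -/
inductive Prog (W : Type) where
  | assign (d : W) (e : Expr W)
  | store (a e : Expr W)
  | seq (p q : Prog W)
  | ifLt (a b : Expr W) (p q : Prog W)
  | whileLt (a b : Expr W) (p : Prog W)
  | skip
  | halt (b : Bool)
  | call

infixr:40 " ;; " => Prog.seq

/-- A machine that is called as a subroutine, the variables for its registers and for the layout of
its input (`[0, len)`) and memory (from `base` on), and the number of temporary registers. -/
structure Host (W : Type) where
  M : WordRAM
  reg : M.R → W
  inj : Function.Injective reg
  base : W
  len : W
  D : ℕ

namespace Host

variable {W : Type} (H : Host W)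

/-- The registers: the variables, a register that is always zero, and temporary registers. -/
abbrev R : Type := W ⊕ Option (Fin (H.D + 1))

/-- A temporary register. -/
def tmp (k : ℕ) : H.R := .inr (some (Fin.ofNat (H.D + 1) k))

/-- The register that is always zero. -/
def zero : H.R := .inr none

lemma tmp_ne {j k : ℕ} (hj : j < k) (hk : k ≤ H.D) : H.tmp j ≠ H.tmp k := by
  simp only [tmp, ne_eq, Sum.inr.injEq, Option.some.injEq, Fin.ext_iff, Fin.ofNat]
  rw [Nat.mod_eq_of_lt (by omega), Nat.mod_eq_of_lt (by omega)]
  omega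

variable {Q : Type}

/-- The code of the called machine: up to four instructions for each of its control states. -/
def callInstr (emb : H.M.Q → Fin 4 → Q) (exit : Q) (s : H.M.Q) (i : Fin 4) : Instr Q H.R :=
  let r : H.M.R → H.R := fun a => .inl (H.reg a)
  match H.M.code s, i with
  | .const d z s', _ => .const (r d) z (emb s' 0)
  | .op o d a b s', _ => .op o (r d) (r a) (r b) (emb s' 0)
  | .rand d a s', _ => .rand (r d) (r a) (emb s' 0)
  | .jumpLt a b s₁ s₂, _ => .jumpLt (r a) (r b) (emb s₁ 0) (emb s₂ 0)
  -- A positive answer of the subroutine settles the whole problem, so only negative answers return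
  -- to the host.
  | .halt true, _ => .halt true
  | .halt false, _ => .jumpLt H.zero H.zero exit exit
  -- The instance occupies the cells from `0` on, followed by other data, so reads beyond its end
  -- have to be replaced by `0`. A negative address passes the test, and the load then treats it as
  -- `0`, as it should.
  | .input _ a _, 0 => .jumpLt (r a) (.inl H.len) (emb s 1) (emb s 2)
  | .input d a s', 1 => .load (r d) (r a) (emb s' 0)
  | .input d _ s', _ => .const (r d) 0 (emb s' 0)
  -- A negative address means cell `0` of the called machine, that is, cell `base` of the host. It
  -- is recognized by the sum being smaller than `base`.
  | .load _ a _, 0 => .op .add (H.tmp 0) (.inl H.base) (r a) (emb s 1)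
  | .load _ _ _, 1 => .jumpLt (H.tmp 0) (.inl H.base) (emb s 2) (emb s 3)
  | .load d _ s', 2 => .load (r d) (.inl H.base) (emb s' 0)
  | .load d _ s', _ => .load (r d) (H.tmp 0) (emb s' 0)
  | .store a _ _, 0 => .op .add (H.tmp 0) (.inl H.base) (r a) (emb s 1)
  | .store _ _ _, 1 => .jumpLt (H.tmp 0) (.inl H.base) (emb s 2) (emb s 3)
  | .store _ v s', 2 => .store (.inl H.base) (r v) (emb s' 0)
  | .store _ v s', _ => .store (H.tmp 0) (r v) (emb s' 0)

/-- `code` evaluates `e` into the temporary register `k` between the control states `q`, `q'`. -/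
def AtE (code : Q → Instr Q H.R) : Expr W → ℕ → Q → Q → Prop
  | .var w, k, q, q' => code q = .op .add (H.tmp k) (.inl w) H.zero q'
  | .lit z, k, q, q' => code q = .const (H.tmp k) z q'
  | .op o a b, k, q, q' => ∃ q₁ q₂, AtE code a k q q₁ ∧ AtE code b (k + 1) q₁ q₂ ∧
      code q₂ = .op o.toOp (H.tmp k) (H.tmp k) (H.tmp (k + 1)) q'
  | .input a, k, q, q' => ∃ q₁, AtE code a k q q₁ ∧ code q₁ = .input (H.tmp k) (H.tmp k) q'
  | .load a, k, q, q' => ∃ q₁, AtE code a k q q₁ ∧ code q₁ = .load (H.tmp k) (H.tmp k) q'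

/-- `code` executes `p` between the control states `q` and `q'`. -/
def At (code : Q → Instr Q H.R) (s Y : ℕ) : Prog W → Q → Q → Prop
  | .assign d e, q, q' => e.Ok H.D s Y ∧ ∃ q₁, H.AtE code e 0 q q₁ ∧
      code q₁ = .op .add (.inl d) (H.tmp 0) H.zero q'
  | .store a e, q, q' => a.Ok H.D s Y ∧ e.Ok H.D s Y ∧ ∃ q₁ q₂, H.AtE code a 0 q q₁ ∧
      H.AtE code e 1 q₁ q₂ ∧ code q₂ = .store (H.tmp 0) (H.tmp 1) q'
  | .seq p p', q, q' => ∃ q₁, At code s Y p q q₁ ∧ At code s Y p' q₁ q'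
  | .ifLt a b p p', q, q' => a.Ok H.D s Y ∧ b.Ok H.D s Y ∧ ∃ q₁ q₂ q₃ q₄, H.AtE code a 0 q q₁ ∧
      H.AtE code b 1 q₁ q₂ ∧ code q₂ = .jumpLt (H.tmp 0) (H.tmp 1) q₃ q₄ ∧
      At code s Y p q₃ q' ∧ At code s Y p' q₄ q'
  | .whileLt a b p, q, q' => a.Ok H.D s Y ∧ b.Ok H.D s Y ∧ ∃ q₁ q₂ q₃, H.AtE code a 0 q q₁ ∧
      H.AtE code b 1 q₁ q₂ ∧ code q₂ = .jumpLt (H.tmp 0) (H.tmp 1) q₃ q' ∧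
      At code s Y p q₃ q
  | .skip, q, q' => code q = .jumpLt H.zero H.zero q' q'
  | .halt b, q, _ => code q = .halt b
  | .call, q, q' => ∃ emb : H.M.Q → Fin 4 → Q, q = emb H.M.start 0 ∧
      ∀ s i, code (emb s i) = H.callInstr emb q' s i

/-! ### Compilation -/

/-- The control states of the code of an expression. -/
def PosE : Expr W → Type
  | .var _ => Unit
  | .lit _ => Unit
  | .op _ a b => (PosE a ⊕ PosE b) ⊕ Unit
  | .input a => PosE a ⊕ Unit
  | .load a => PosE a ⊕ Unit

/-- The first control state. -/
def entryE : (e : Expr W) → PosE e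
  | .var _ => ()
  | .lit _ => ()
  | .op _ a _ => Sum.inl (Sum.inl (entryE a))
  | .input a => Sum.inl (entryE a)
  | .load a => Sum.inl (entryE a)

instance fintypePosE : (e : Expr W) → Fintype (PosE e)
  | .var _ => inferInstanceAs (Fintype Unit)
  | .lit _ => inferInstanceAs (Fintype Unit)
  | .op _ a b =>
    haveI := fintypePosE a
    haveI := fintypePosE b
    inferInstanceAs (Fintype ((PosE a ⊕ PosE b) ⊕ Unit))
  | .input a => haveI := fintypePosE a; inferInstanceAs (Fintype (PosE a ⊕ Unit))
  | .load a => haveI := fintypePosE a; inferInstanceAs (Fintype (PosE a ⊕ Unit))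

/-- The code of an expression, with its control states embedded in `Q`. -/
def codeE : (e : Expr W) → ℕ → (PosE e → Q) → Q → PosE e → Instr Q H.R
  | .var w, k, _, exit => fun _ => .op .add (H.tmp k) (.inl w) H.zero exit
  | .lit z, k, _, exit => fun _ => .const (H.tmp k) z exit
  | .op o a b, k, emb, exit =>
    Sum.elim (Sum.elim
      (codeE a k (fun p => emb (Sum.inl (Sum.inl p))) (emb (Sum.inl (Sum.inr (entryE b)))))
      (codeE b (k + 1) (fun p => emb (Sum.inl (Sum.inr p))) (emb (Sum.inr ()))))
      (fun _ => .op o.toOp (H.tmp k) (H.tmp k) (H.tmp (k + 1)) exit)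
  | .input a, k, emb, exit =>
    Sum.elim (codeE a k (fun p => emb (Sum.inl p)) (emb (Sum.inr ())))
      (fun _ => .input (H.tmp k) (H.tmp k) exit)
  | .load a, k, emb, exit =>
    Sum.elim (codeE a k (fun p => emb (Sum.inl p)) (emb (Sum.inr ())))
      (fun _ => .load (H.tmp k) (H.tmp k) exit)

lemma atE_codeE (code : Q → Instr Q H.R) (e : Expr W) (k : ℕ) (emb : PosE e → Q) (exit : Q)
    (h : ∀ p, code (emb p) = H.codeE e k emb exit p) : H.AtE code e k (emb (entryE e)) exit := by
  induction e generalizing k exit with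
  | var w => exact h ()
  | lit z => exact h ()
  | op o a b iha ihb =>
    exact ⟨_, _, iha k _ _ fun p => h (Sum.inl (Sum.inl p)),
      ihb (k + 1) _ _ fun p => h (Sum.inl (Sum.inr p)), h (Sum.inr ())⟩
  | input a ih => exact ⟨_, ih k _ _ fun p => h (Sum.inl p), h (Sum.inr ())⟩
  | load a ih => exact ⟨_, ih k _ _ fun p => h (Sum.inl p), h (Sum.inr ())⟩

/-- The control states of the code of a program. -/
def Pos : Prog W → Type
  | .assign _ e => PosE e ⊕ Unit
  | .store a e => (PosE a ⊕ PosE e) ⊕ Unit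
  | .seq p q => Pos p ⊕ Pos q
  | .ifLt a b p q => ((PosE a ⊕ PosE b) ⊕ Unit) ⊕ (Pos p ⊕ Pos q)
  | .whileLt a b p => ((PosE a ⊕ PosE b) ⊕ Unit) ⊕ Pos p
  | .skip => Unit
  | .halt _ => Unit
  | .call => H.M.Q × Fin 4

/-- The first control state. -/
def entry : (p : Prog W) → H.Pos p
  | .assign _ e => Sum.inl (entryE e)
  | .store a _ => Sum.inl (Sum.inl (entryE a))
  | .seq p _ => Sum.inl (entry p)
  | .ifLt a _ _ _ => Sum.inl (Sum.inl (Sum.inl (entryE a)))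
  | .whileLt a _ _ => Sum.inl (Sum.inl (Sum.inl (entryE a)))
  | .skip => ()
  | .halt _ => ()
  | .call => (H.M.start, (0 : Fin 4))

instance fintypePos : (p : Prog W) → Fintype (H.Pos p)
  | .assign _ e => inferInstanceAs (Fintype (PosE e ⊕ Unit))
  | .store a e => inferInstanceAs (Fintype ((PosE a ⊕ PosE e) ⊕ Unit))
  | .seq p q =>
    haveI := fintypePos p
    haveI := fintypePos q
    inferInstanceAs (Fintype (H.Pos p ⊕ H.Pos q))
  | .ifLt a b p q =>
    haveI := fintypePos p
    haveI := fintypePos q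
    inferInstanceAs (Fintype (((PosE a ⊕ PosE b) ⊕ Unit) ⊕ (H.Pos p ⊕ H.Pos q)))
  | .whileLt a b p =>
    haveI := fintypePos p
    inferInstanceAs (Fintype (((PosE a ⊕ PosE b) ⊕ Unit) ⊕ H.Pos p))
  | .skip => inferInstanceAs (Fintype Unit)
  | .halt _ => inferInstanceAs (Fintype Unit)
  | .call => inferInstanceAs (Fintype (H.M.Q × Fin 4))

/-- The code of a program, with its control states embedded in `Q`. -/
def codeP : (p : Prog W) → (H.Pos p → Q) → Q → H.Pos p → Instr Q H.R
  | .assign d e, emb, exit =>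
    Sum.elim (H.codeE e 0 (fun p => emb (Sum.inl p)) (emb (Sum.inr ())))
      (fun _ => .op .add (.inl d) (H.tmp 0) H.zero exit)
  | .store a e, emb, exit =>
    Sum.elim (Sum.elim
      (H.codeE a 0 (fun p => emb (Sum.inl (Sum.inl p))) (emb (Sum.inl (Sum.inr (entryE e)))))
      (H.codeE e 1 (fun p => emb (Sum.inl (Sum.inr p))) (emb (Sum.inr ()))))
      (fun _ => .store (H.tmp 0) (H.tmp 1) exit)
  | .seq p q, emb, exit =>
    Sum.elim (codeP p (fun r => emb (Sum.inl r)) (emb (Sum.inr (H.entry q))))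
      (codeP q (fun r => emb (Sum.inr r)) exit)
  | .ifLt a b p q, emb, exit =>
    Sum.elim (Sum.elim (Sum.elim
      (H.codeE a 0 (fun p => emb (Sum.inl (Sum.inl (Sum.inl p))))
        (emb (Sum.inl (Sum.inl (Sum.inr (entryE b))))))
      (H.codeE b 1 (fun p => emb (Sum.inl (Sum.inl (Sum.inr p)))) (emb (Sum.inl (Sum.inr ())))))
      (fun _ => .jumpLt (H.tmp 0) (H.tmp 1) (emb (Sum.inr (Sum.inl (H.entry p))))
        (emb (Sum.inr (Sum.inr (H.entry q))))))
      (Sum.elim (codeP p (fun r => emb (Sum.inr (Sum.inl r))) exit)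
        (codeP q (fun r => emb (Sum.inr (Sum.inr r))) exit))
  | .whileLt a b p, emb, exit =>
    Sum.elim (Sum.elim (Sum.elim
      (H.codeE a 0 (fun p => emb (Sum.inl (Sum.inl (Sum.inl p))))
        (emb (Sum.inl (Sum.inl (Sum.inr (entryE b))))))
      (H.codeE b 1 (fun p => emb (Sum.inl (Sum.inl (Sum.inr p)))) (emb (Sum.inl (Sum.inr ())))))
      (fun _ => .jumpLt (H.tmp 0) (H.tmp 1) (emb (Sum.inr (H.entry p))) exit))
      (codeP p (fun r => emb (Sum.inr r)) (emb (Sum.inl (Sum.inl (Sum.inl (entryE a))))))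
  | .skip, _, exit => fun _ => .jumpLt H.zero H.zero exit exit
  | .halt b, _, _ => fun _ => .halt b
  | .call, emb, exit => fun p => H.callInstr (fun s i => emb (s, i)) exit p.1 p.2

end Host

/-- All expressions of the program fit the bounds. -/
def Prog.Ok {W : Type} (D s Y : ℕ) : Prog W → Prop
  | .assign _ e => e.Ok D s Y
  | .store a e => a.Ok D s Y ∧ e.Ok D s Y
  | .seq p q => p.Ok D s Y ∧ q.Ok D s Y
  | .ifLt a b p q => (a.Ok D s Y ∧ b.Ok D s Y) ∧ p.Ok D s Y ∧ q.Ok D s Y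
  | .whileLt a b p => (a.Ok D s Y ∧ b.Ok D s Y) ∧ p.Ok D s Y
  | _ => True

namespace Prog

variable {W : Type}

lemma Ok.mono {D s Y D' s' Y' : ℕ} {p : Prog W} (h : p.Ok D s Y) (hD : D ≤ D') (hs : s ≤ s')
    (hY : Y ≤ Y') : p.Ok D' s' Y' := by
  induction p with
  | assign d e => exact Expr.Ok.mono h hD hs hY
  | store a e => exact ⟨h.1.mono hD hs hY, h.2.mono hD hs hY⟩
  | seq p q ihp ihq => exact ⟨ihp h.1, ihq h.2⟩
  | ifLt a b p q ihp ihq =>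
    exact ⟨⟨h.1.1.mono hD hs hY, h.1.2.mono hD hs hY⟩, ihp h.2.1, ihq h.2.2⟩
  | whileLt a b p ih => exact ⟨⟨h.1.1.mono hD hs hY, h.1.2.mono hD hs hY⟩, ih h.2⟩
  | _ => trivial

/-- A program is a finite text, so one constant bounds its expressions for all inputs. This constant
becomes the number of temporary registers and enters the exponent of the word bound. -/
lemma exists_ok (p : Prog W) : ∃ K, p.Ok K K K := by
  have he : ∀ e : Expr W, ∃ K, e.Ok K K K := fun e =>
    ⟨e.depth + 1 + e.size + e.maxLit, by refine ⟨?_, ?_, ?_⟩ <;> omega⟩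
  have h2 : ∀ a b : Expr W, ∃ K, a.Ok K K K ∧ b.Ok K K K := fun a b => by
    obtain ⟨K, hK⟩ := he a
    obtain ⟨L, hL⟩ := he b
    have h₁ := le_max_left K L
    have h₂ := le_max_right K L
    exact ⟨max K L, hK.mono h₁ h₁ h₁, hL.mono h₂ h₂ h₂⟩
  induction p with
  | assign d e => exact he e
  | store a e => exact h2 a e
  | seq p q ihp ihq =>
    obtain ⟨K, hK⟩ := ihp
    obtain ⟨L, hL⟩ := ihq
    have h₁ := le_max_left K L
    have h₂ := le_max_right K L
    exact ⟨max K L, hK.mono h₁ h₁ h₁, hL.mono h₂ h₂ h₂⟩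
  | ifLt a b p q ihp ihq =>
    obtain ⟨K, hK⟩ := ihp
    obtain ⟨L, hL⟩ := ihq
    obtain ⟨J, hJ⟩ := h2 a b
    have h₁ : K ≤ K + L + J := by omega
    have h₂ : L ≤ K + L + J := by omega
    have h₃ : J ≤ K + L + J := by omega
    exact ⟨K + L + J, ⟨hJ.1.mono h₃ h₃ h₃, hJ.2.mono h₃ h₃ h₃⟩, hK.mono h₁ h₁ h₁, hL.mono h₂ h₂ h₂⟩
  | whileLt a b p ih =>
    obtain ⟨K, hK⟩ := ih
    obtain ⟨J, hJ⟩ := h2 a b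
    have h₁ := le_max_left K J
    have h₂ := le_max_right K J
    exact ⟨max K J, ⟨hJ.1.mono h₂ h₂ h₂, hJ.2.mono h₂ h₂ h₂⟩, hK.mono h₁ h₁ h₁⟩
  | _ => exact ⟨0, trivial⟩

/-- A bound on the number of steps of a program when loops have one round and calls take one step. -/
def len : Prog W → ℕ
  | .assign _ e => e.cost + 1
  | .store a e => a.cost + e.cost + 1
  | .seq p q => p.len + q.len
  | .ifLt a b p q => a.cost + b.cost + 1 + p.len + q.len
  | .whileLt a b p => a.cost + b.cost + 1 + p.len
  | .skip => 1
  | .halt _ => 0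
  | .call => 1

end Prog

/-- After this lemma only the relation `At` is used, and the control states produced by the compiler
need not be mentioned again. -/
lemma Host.at_codeP {W Q : Type} (H : Host W) (code : Q → Instr Q H.R) {s Y : ℕ} (p : Prog W)
    (hp : p.Ok H.D s Y) (emb : H.Pos p → Q) (exit : Q)
    (h : ∀ r, code (emb r) = H.codeP p emb exit r) :
    H.At code s Y p (emb (H.entry p)) exit := by
  induction p generalizing exit with
  | assign d e =>
    exact ⟨hp, _, H.atE_codeE code e 0 _ _ fun r => h (Sum.inl r), h (Sum.inr ())⟩
  | store a e =>
    exact ⟨hp.1, hp.2, _, _, H.atE_codeE code a 0 _ _ fun r => h (Sum.inl (Sum.inl r)),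
      H.atE_codeE code e 1 _ _ fun r => h (Sum.inl (Sum.inr r)), h (Sum.inr ())⟩
  | seq p q ihp ihq =>
    exact ⟨_, ihp hp.1 _ _ fun r => h (Sum.inl r), ihq hp.2 _ _ fun r => h (Sum.inr r)⟩
  | ifLt a b p q ihp ihq =>
    exact ⟨hp.1.1, hp.1.2, _, _, _, _,
      H.atE_codeE code a 0 _ _ fun r => h (Sum.inl (Sum.inl (Sum.inl r))),
      H.atE_codeE code b 1 _ _ fun r => h (Sum.inl (Sum.inl (Sum.inr r))),
      h (Sum.inl (Sum.inr ())), ihp hp.2.1 _ _ fun r => h (Sum.inr (Sum.inl r)),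
      ihq hp.2.2 _ _ fun r => h (Sum.inr (Sum.inr r))⟩
  | whileLt a b p ih =>
    exact ⟨hp.1.1, hp.1.2, _, _, _,
      H.atE_codeE code a 0 _ _ fun r => h (Sum.inl (Sum.inl (Sum.inl r))),
      H.atE_codeE code b 1 _ _ fun r => h (Sum.inl (Sum.inl (Sum.inr r))),
      h (Sum.inl (Sum.inr ())), ih hp.2 _ _ fun r => h (Sum.inr r)⟩
  | skip => exact h ()
  | halt b => exact h ()
  | call => exact ⟨fun s i => emb (s, i), rfl, fun s i => h (s, i)⟩

/-! ### Execution of structured programs -/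

/-- What is fixed during an execution: the input, the truth of the property that is decided, the
number of memory cells that may be accessed, a bound `Y` on the words in variables and memory, and
an exponent `s` for the size of intermediate results. -/
structure Job where
  x : List ℤ
  yes : Prop
  ms : ℕ
  Y : ℕ
  s : ℕ
  two_le : 2 ≤ Y
  input_le : ∀ i, (x.getD i 0).natAbs ≤ Y


namespace Host

variable {W : Type} [Fintype W] [DecidableEq W] (H : Host W)
variable {Q : Type} [Fintype Q] (start : Q) (code : Q → Instr Q H.R)

/-- The machine with the given code. -/
abbrev mach : WordRAM where
  Q := Q
  R := H.R
  start := start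
  code := code

variable (Γ : Job)

/-- Words are within the bounds. -/
structure Bd (reg : H.R → ℤ) (mem : ℕ → ℤ) : Prop where
  var : ∀ w, (reg (.inl w)).natAbs ≤ Γ.Y
  tmp : ∀ k, (reg (.inr (some k))).natAbs ≤ Γ.Y ^ Γ.s
  zero : reg (.inr none) = 0
  mem : ∀ i, (mem i).natAbs ≤ Γ.Y

/-- Answers are right, memory accesses are below the limit, words are within the bounds. -/
def SafeCfg (c : (H.mach start code).Config) : Prop :=
  (∀ b, (H.mach start code).Answers c b → (b = true ↔ Γ.yes)) ∧
    (∀ i, (H.mach start code).Accesses c i → i < Γ.ms) ∧ H.Bd Γ c.reg c.mem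

/-- The run from the given control state, registers and memory is good. -/
def GoodAt (T : ℕ) (q : Q) (reg : H.R → ℤ) (mem : ℕ → ℤ) (r : ℝ≥0∞) : Prop :=
  (H.mach start code).Good Γ.x (H.SafeCfg start code Γ) T ⟨q, reg, mem⟩ r

/-- The run from `q` gets to `q'` within expected time `C` and satisfies `Φ` there, or halts. -/
def Reach (q : Q) (reg : H.R → ℤ) (mem : ℕ → ℤ) (C : ℝ≥0∞) (q' : Q)
    (Φ : (H.R → ℤ) → (ℕ → ℤ) → Prop) : Prop :=
  ∀ T r, (∀ reg' mem', H.Bd Γ reg' mem' → Φ reg' mem' → H.GoodAt start code Γ T q' reg' mem' r) →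
    H.Bd Γ reg mem → H.GoodAt start code Γ T q reg mem (C + r)

variable {start code Γ} {H}

lemma goodAt_of_step {T : ℕ} {q q' : Q} {reg reg' : H.R → ℤ} {mem mem' : ℕ → ℤ} {r : ℝ≥0∞}
    (hbd : H.Bd Γ reg mem) (hh : ∀ b, code q ≠ .halt b)
    (ha : ∀ i, (H.mach start code).Accesses ⟨q, reg, mem⟩ i → i < Γ.ms)
    (hs : (H.mach start code).step Γ.x ⟨q, reg, mem⟩ = PMF.pure ⟨q', reg', mem'⟩)
    (hg : H.GoodAt start code Γ T q' reg' mem' r) :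
    H.GoodAt start code Γ (T + 1) q reg mem (1 + r) :=
  WordRAM.good_step_pure ⟨fun b hb => absurd hb (hh b), ha, hbd⟩
    (fun ⟨b, hb⟩ => hh b hb) hs hg

lemma GoodAt.mono {T : ℕ} {q : Q} {reg : H.R → ℤ} {mem : ℕ → ℤ} {r r' : ℝ≥0∞}
    (h : H.GoodAt start code Γ T q reg mem r) (hr : r ≤ r') : H.GoodAt start code Γ T q reg mem r' :=
  WordRAM.Good.mono h hr

lemma GoodAt.anti {T T' : ℕ} {q : Q} {reg : H.R → ℤ} {mem : ℕ → ℤ} {r : ℝ≥0∞}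
    (h : H.GoodAt start code Γ T' q reg mem r) (hT : T ≤ T') : H.GoodAt start code Γ T q reg mem r :=
  WordRAM.Good.anti h hT

lemma goodAt_halt {T : ℕ} {q : Q} {reg : H.R → ℤ} {mem : ℕ → ℤ} (r : ℝ≥0∞) (b : Bool)
    (hbd : H.Bd Γ reg mem) (hc : code q = .halt b) (hb : b = true ↔ Γ.yes) :
    H.GoodAt start code Γ T q reg mem r := by
  refine WordRAM.good_halted r ⟨fun b' hb' => ?_, fun i hi => ?_, hbd⟩ ⟨b, hc⟩
  · have : Instr.halt b = Instr.halt b' := hc.symm.trans hb'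
    cases this
    exact hb
  · simp [WordRAM.Accesses, hc] at hi

lemma reach_step {q q' : Q} {reg reg' : H.R → ℤ} {mem mem' : ℕ → ℤ}
    {Φ : (H.R → ℤ) → (ℕ → ℤ) → Prop} (hh : ∀ b, code q ≠ .halt b)
    (ha : ∀ i, (H.mach start code).Accesses ⟨q, reg, mem⟩ i → i < Γ.ms)
    (hs : (H.mach start code).step Γ.x ⟨q, reg, mem⟩ = PMF.pure ⟨q', reg', mem'⟩)
    (hbd : H.Bd Γ reg mem → H.Bd Γ reg' mem') (hΦ : H.Bd Γ reg mem → Φ reg' mem') :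
    H.Reach start code Γ q reg mem 1 q' Φ := fun _ _ hg hb =>
  (goodAt_of_step hb hh ha hs (hg _ _ (hbd hb) (hΦ hb))).anti (Nat.le_succ _)

/-- Since `Reach` quantifies over the budget `r` that is left at the end, costs add without any
conditioning on random choices made earlier. -/
lemma Reach.trans {q q' q'' : Q} {reg : H.R → ℤ} {mem : ℕ → ℤ} {C C' : ℝ≥0∞}
    {Φ Ψ : (H.R → ℤ) → (ℕ → ℤ) → Prop} (h : H.Reach start code Γ q reg mem C q' Φ)
    (h' : ∀ reg' mem', Φ reg' mem' → H.Reach start code Γ q' reg' mem' C' q'' Ψ) :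
    H.Reach start code Γ q reg mem (C + C') q'' Ψ := fun T r hg hb => by
  rw [add_assoc]
  exact h T _ (fun reg' mem' hb' hΦ => h' reg' mem' hΦ T r hg hb') hb

lemma Reach.weaken {q q' : Q} {reg : H.R → ℤ} {mem : ℕ → ℤ} {C C' : ℝ≥0∞}
    {Φ Ψ : (H.R → ℤ) → (ℕ → ℤ) → Prop} (h : H.Reach start code Γ q reg mem C q' Φ) (hC : C ≤ C')
    (hΦ : ∀ reg' mem', Φ reg' mem' → Ψ reg' mem') :
    H.Reach start code Γ q reg mem C' q' Ψ := fun T r hg hb =>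
  (h T r (fun reg' mem' hb' h' => hg reg' mem' hb' (hΦ _ _ h')) hb).mono (by gcongr)

lemma Reach.of_bd {q q' : Q} {reg : H.R → ℤ} {mem : ℕ → ℤ} {C : ℝ≥0∞}
    {Φ : (H.R → ℤ) → (ℕ → ℤ) → Prop}
    (h : H.Bd Γ reg mem → H.Reach start code Γ q reg mem C q' Φ) :
    H.Reach start code Γ q reg mem C q' Φ := fun T r hg hb => h hb T r hg hb

lemma Bd.update_var {reg : H.R → ℤ} {mem : ℕ → ℤ} (h : H.Bd Γ reg mem) (w : W) {z : ℤ}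
    (hz : z.natAbs ≤ Γ.Y) : H.Bd Γ (Function.update reg (.inl w) z) mem where
  var w' := by
    by_cases hw : w' = w
    · subst hw; simpa using hz
    · simpa [hw] using h.var w'
  tmp k := by simpa using h.tmp k
  zero := by simpa using h.zero
  mem := h.mem

lemma Bd.update_tmp {reg : H.R → ℤ} {mem : ℕ → ℤ} (h : H.Bd Γ reg mem) (k : ℕ) {z : ℤ}
    (hz : z.natAbs ≤ Γ.Y ^ Γ.s) : H.Bd Γ (Function.update reg (H.tmp k) z) mem where
  var w' := by simpa [Host.tmp] using h.var w'
  tmp j := by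
    by_cases hj : (Sum.inr (some j) : H.R) = H.tmp k
    · rw [hj]; simpa using hz
    · rw [Function.update_of_ne hj]; exact h.tmp j
  zero := by simpa [Host.tmp] using h.zero
  mem := h.mem

lemma Bd.update_mem {reg : H.R → ℤ} {mem : ℕ → ℤ} (h : H.Bd Γ reg mem) (i : ℕ) {z : ℤ}
    (hz : z.natAbs ≤ Γ.Y) : H.Bd Γ reg (Function.update mem i z) where
  var := h.var
  tmp := h.tmp
  zero := h.zero
  mem j := by
    by_cases hj : j = i
    · subst hj; simpa using hz
    · simpa [hj] using h.mem j

lemma reach_const_tmp {q q' : Q} {reg : H.R → ℤ} {mem : ℕ → ℤ} {k : ℕ} {z : ℤ}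
    (hc : code q = .const (H.tmp k) z q') (hz : z.natAbs ≤ Γ.Y ^ Γ.s) :
    H.Reach start code Γ q reg mem 1 q' fun reg' mem' =>
      reg' = Function.update reg (H.tmp k) z ∧ mem' = mem :=
  reach_step (by simp [hc]) (by simp [WordRAM.Accesses, hc])
    (by simp [WordRAM.step, hc, WordRAM.Config.set]) (fun h => h.update_tmp k hz)
    fun _ => ⟨rfl, rfl⟩

lemma reach_op_tmp {q q' : Q} {reg : H.R → ℤ} {mem : ℕ → ℤ} {k : ℕ} {o : WordOp} {a b : H.R}
    (hc : code q = .op o (H.tmp k) a b q')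
    (hz : H.Bd Γ reg mem → (o.eval (reg a) (reg b)).natAbs ≤ Γ.Y ^ Γ.s) :
    H.Reach start code Γ q reg mem 1 q' fun reg' mem' =>
      reg' = Function.update reg (H.tmp k) (o.eval (reg a) (reg b)) ∧ mem' = mem :=
  reach_step (by simp [hc]) (by simp [WordRAM.Accesses, hc])
    (by simp [WordRAM.step, hc, WordRAM.Config.set]) (fun h => h.update_tmp k (hz h))
    fun _ => ⟨rfl, rfl⟩

lemma reach_op_var {q q' : Q} {reg : H.R → ℤ} {mem : ℕ → ℤ} {w : W} {o : WordOp} {a b : H.R}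
    (hc : code q = .op o (.inl w) a b q')
    (hz : H.Bd Γ reg mem → (o.eval (reg a) (reg b)).natAbs ≤ Γ.Y) :
    H.Reach start code Γ q reg mem 1 q' fun reg' mem' =>
      reg' = Function.update reg (.inl w) (o.eval (reg a) (reg b)) ∧ mem' = mem :=
  reach_step (by simp [hc]) (by simp [WordRAM.Accesses, hc])
    (by simp [WordRAM.step, hc, WordRAM.Config.set]) (fun h => h.update_var w (hz h))
    fun _ => ⟨rfl, rfl⟩

lemma reach_input_tmp {q q' : Q} {reg : H.R → ℤ} {mem : ℕ → ℤ} {k : ℕ} {a : H.R}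
    (hc : code q = .input (H.tmp k) a q') (hs : 1 ≤ Γ.s) :
    H.Reach start code Γ q reg mem 1 q' fun reg' mem' =>
      reg' = Function.update reg (H.tmp k) (Γ.x.getD (reg a).toNat 0) ∧ mem' = mem :=
  reach_step (by simp [hc]) (by simp [WordRAM.Accesses, hc])
    (by simp only [WordRAM.step, hc, WordRAM.Config.set])
    (fun h => h.update_tmp k ((Γ.input_le _).trans (Nat.le_self_pow (by omega) _)))
    fun _ => ⟨rfl, rfl⟩

lemma reach_load_tmp {q q' : Q} {reg : H.R → ℤ} {mem : ℕ → ℤ} {k : ℕ} {a : H.R}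
    (hc : code q = .load (H.tmp k) a q') (hs : 1 ≤ Γ.s) (ha : (reg a).toNat < Γ.ms) :
    H.Reach start code Γ q reg mem 1 q' fun reg' mem' =>
      reg' = Function.update reg (H.tmp k) (mem (reg a).toNat) ∧ mem' = mem :=
  reach_step (by simp [hc]) (by simpa [WordRAM.Accesses, hc] using ha)
    (by simp only [WordRAM.step, hc, WordRAM.Config.set])
    (fun h => h.update_tmp k ((h.mem _).trans (Nat.le_self_pow (by omega) _)))
    fun _ => ⟨rfl, rfl⟩

lemma reach_load_var {q q' : Q} {reg : H.R → ℤ} {mem : ℕ → ℤ} {w : W} {a : H.R}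
    (hc : code q = .load (.inl w) a q') (ha : (reg a).toNat < Γ.ms) :
    H.Reach start code Γ q reg mem 1 q' fun reg' mem' =>
      reg' = Function.update reg (.inl w) (mem (reg a).toNat) ∧ mem' = mem :=
  reach_step (by simp [hc]) (by simpa [WordRAM.Accesses, hc] using ha)
    (by simp only [WordRAM.step, hc, WordRAM.Config.set])
    (fun h => h.update_var w (h.mem _)) fun _ => ⟨rfl, rfl⟩

lemma reach_const_var {q q' : Q} {reg : H.R → ℤ} {mem : ℕ → ℤ} {w : W} {z : ℤ}
    (hc : code q = .const (.inl w) z q') (hz : z.natAbs ≤ Γ.Y) :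
    H.Reach start code Γ q reg mem 1 q' fun reg' mem' =>
      reg' = Function.update reg (.inl w) z ∧ mem' = mem :=
  reach_step (by simp [hc]) (by simp [WordRAM.Accesses, hc])
    (by simp [WordRAM.step, hc, WordRAM.Config.set]) (fun h => h.update_var w hz)
    fun _ => ⟨rfl, rfl⟩

lemma reach_store {q q' : Q} {reg : H.R → ℤ} {mem : ℕ → ℤ} {a v : H.R}
    (hc : code q = .store a v q') (ha : (reg a).toNat < Γ.ms) (hv : (reg v).natAbs ≤ Γ.Y) :
    H.Reach start code Γ q reg mem 1 q' fun reg' mem' =>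
      reg' = reg ∧ mem' = Function.update mem (reg a).toNat (reg v) :=
  reach_step (by simp [hc]) (by simpa [WordRAM.Accesses, hc] using ha)
    (by simp only [WordRAM.step, hc])
    (fun h => h.update_mem _ hv) fun _ => ⟨rfl, rfl⟩

lemma reach_jump {q q₁ q₂ q' : Q} {reg : H.R → ℤ} {mem : ℕ → ℤ} {a b : H.R}
    (hc : code q = .jumpLt a b q₁ q₂) (hq : q' = if reg a < reg b then q₁ else q₂) :
    H.Reach start code Γ q reg mem 1 q' fun reg' mem' => reg' = reg ∧ mem' = mem :=
  reach_step (by simp [hc]) (by simp [WordRAM.Accesses, hc])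
    (by simp only [WordRAM.step, hc, hq]) id fun _ => ⟨rfl, rfl⟩

/-- Evaluation of an expression. -/
lemma reach_expr {e : Expr W} {k : ℕ} {q q' : Q} (hat : H.AtE code e k q q')
    {reg : H.R → ℤ} {mem : ℕ → ℤ} {ρ : W → ℤ} (hρ : ∀ w, reg (.inl w) = ρ w)
    (hk : k + e.depth ≤ H.D) (hs : e.size ≤ Γ.s) (hl : e.maxLit ≤ Γ.Y)
    (hsafe : e.Safe Γ.x ρ mem Γ.ms) :
    H.Reach start code Γ q reg mem e.cost q' fun reg' mem' =>
      mem' = mem ∧ reg' (H.tmp k) = e.eval Γ.x ρ mem ∧ (∀ w, reg' (.inl w) = ρ w) ∧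
        ∀ j < k, reg' (H.tmp j) = reg (H.tmp j) := by
  have key : ∀ (e : Expr W), e.size ≤ Γ.s → e.maxLit ≤ Γ.Y → ∀ {reg : H.R → ℤ} {mem : ℕ → ℤ},
      H.Bd Γ reg mem → (∀ w, reg (.inl w) = ρ w) → (e.eval Γ.x ρ mem).natAbs ≤ Γ.Y ^ Γ.s := by
    intro e hs hl reg mem hbd hρ
    refine (e.natAbs_eval_le Γ.two_le Γ.input_le (fun w => ?_) hbd.mem hl).trans
      (Nat.pow_le_pow_right (by have := Γ.two_le; omega) hs)
    rw [← hρ w]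
    exact hbd.var w
  have hs1 : 1 ≤ Γ.s := e.one_le_size.trans hs
  induction e generalizing k q q' reg with
  | var w =>
    refine Reach.of_bd fun hbd => ?_
    have hval : WordOp.add.eval (reg (.inl w)) (reg H.zero) = ρ w := by
      simp [WordOp.eval, Host.zero, hbd.zero, hρ]
    refine (reach_op_tmp hat fun _ => ?_).weaken (by simp [Expr.cost]) ?_
    · rw [hval]; exact key _ hs hl hbd hρ
    · rintro _ _ ⟨rfl, rfl⟩
      refine ⟨rfl, by rw [hval]; simp, fun w => by simp [Host.tmp, hρ], fun j hj => ?_⟩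
      rw [Function.update_of_ne (H.tmp_ne hj (by omega))]
  | lit z =>
    refine (reach_const_tmp hat ?_).weaken (by simp [Expr.cost]) ?_
    · exact (show z.natAbs ≤ Γ.Y from hl).trans (Nat.le_self_pow (by omega) _)
    · rintro _ _ ⟨rfl, rfl⟩
      refine ⟨rfl, by simp, fun w => by simp [Host.tmp, hρ], fun j hj => ?_⟩
      rw [Function.update_of_ne (H.tmp_ne hj (by omega))]
  | op o a b iha ihb =>
    obtain ⟨q₁, q₂, h₁, h₂, h₃⟩ := hat
    simp only [Expr.depth] at hk
    have hs' := hs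
    have hl' := hl
    simp only [Expr.size] at hs'
    simp only [Expr.maxLit, max_le_iff] at hl'
    have hk1 : k + a.depth ≤ H.D := by omega
    have hk2 : k + 1 + b.depth ≤ H.D := by omega
    refine Reach.weaken ((iha h₁ hρ hk1 (by omega) hl'.1 hsafe.1).trans
      (C' := b.cost + 1) (Ψ := fun reg' mem' =>
      mem' = mem ∧ reg' (H.tmp k) = (Expr.op o a b).eval Γ.x ρ mem ∧ (∀ w, reg' (.inl w) = ρ w) ∧
        ∀ j < k, reg' (H.tmp j) = reg (H.tmp j)) ?_)
      (by simp [Expr.cost, add_assoc]) (fun _ _ h => h)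
    rintro reg₁ mem₁ ⟨rfl, hv1, hρ1, hf1⟩
    refine (ihb h₂ hρ1 hk2 (by omega) hl'.2 hsafe.2).trans ?_
    rintro reg₂ mem₂ ⟨rfl, hv2, hρ2, hf2⟩
    have hval : o.toOp.eval (reg₂ (H.tmp k)) (reg₂ (H.tmp (k + 1))) =
        (Expr.op o a b).eval Γ.x ρ mem₂ := by rw [hv2, hf2 k (by omega), hv1]; rfl
    refine (reach_op_tmp h₃ fun hbd => ?_).weaken le_rfl ?_
    · rw [hval]; exact key _ hs hl hbd hρ2
    · rintro _ _ ⟨rfl, rfl⟩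
      refine ⟨rfl, by rw [hval]; simp, fun w => by simp [Host.tmp, hρ2], fun j hj => ?_⟩
      rw [Function.update_of_ne (H.tmp_ne hj (by omega)), hf2 j (by omega), hf1 j hj]
  | input a ih =>
    obtain ⟨q₁, h₁, h₂⟩ := hat
    refine Reach.weaken ((ih h₁ hρ hk hs hl hsafe).trans (C' := 1) (Ψ := fun reg' mem' =>
      mem' = mem ∧ reg' (H.tmp k) = (Expr.input a).eval Γ.x ρ mem ∧ (∀ w, reg' (.inl w) = ρ w) ∧
        ∀ j < k, reg' (H.tmp j) = reg (H.tmp j)) ?_)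
      (by simp [Expr.cost]) (fun _ _ h => h)
    rintro reg₁ mem₁ ⟨rfl, hv1, hρ1, hf1⟩
    refine (reach_input_tmp h₂ hs1).weaken le_rfl ?_
    rintro _ _ ⟨rfl, rfl⟩
    refine ⟨rfl, by simp [hv1], fun w => by simp [Host.tmp, hρ1], fun j hj => ?_⟩
    rw [Function.update_of_ne (H.tmp_ne hj (by omega)), hf1 j hj]
  | load a ih =>
    obtain ⟨q₁, h₁, h₂⟩ := hat
    refine Reach.weaken ((ih h₁ hρ hk hs hl hsafe.1).trans (C' := 1) (Ψ := fun reg' mem' =>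
      mem' = mem ∧ reg' (H.tmp k) = (Expr.load a).eval Γ.x ρ mem ∧ (∀ w, reg' (.inl w) = ρ w) ∧
        ∀ j < k, reg' (H.tmp j) = reg (H.tmp j)) ?_)
      (by simp [Expr.cost]) (fun _ _ h => h)
    rintro reg₁ mem₁ ⟨rfl, hv1, hρ1, hf1⟩
    refine (reach_load_tmp h₂ hs1 (by rw [hv1]; exact hsafe.2)).weaken le_rfl ?_
    rintro _ _ ⟨rfl, rfl⟩
    refine ⟨rfl, by simp [hv1], fun w => by simp [Host.tmp, hρ1], fun j hj => ?_⟩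
    rw [Function.update_of_ne (H.tmp_ne hj (by omega)), hf1 j hj]

/-! ### Triples for programs -/

variable (H Γ) (start code)

/-- From variables `ρ` and memory `μ`, the program `p` safely gets to its end within expected time
`C` and satisfies `Ψ` there, or halts with the right answer. -/
def Run (p : Prog W) (ρ : W → ℤ) (μ : ℕ → ℤ) (C : ℝ≥0∞) (Ψ : (W → ℤ) → (ℕ → ℤ) → Prop) : Prop :=
  ∀ q q', H.At code Γ.s Γ.Y p q q' → ∀ reg : H.R → ℤ, (∀ w, reg (.inl w) = ρ w) →
    H.Reach start code Γ q reg μ C q' fun reg' μ' => Ψ (fun w => reg' (.inl w)) μ'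

variable {H Γ} {start code}

lemma Run.weaken {p : Prog W} {ρ : W → ℤ} {μ : ℕ → ℤ} {C C' : ℝ≥0∞}
    {Φ Ψ : (W → ℤ) → (ℕ → ℤ) → Prop} (h : H.Run start code Γ p ρ μ C Φ) (hC : C ≤ C')
    (hΦ : ∀ ρ' μ', Φ ρ' μ' → Ψ ρ' μ') : H.Run start code Γ p ρ μ C' Ψ :=
  fun q q' hat reg hreg => (h q q' hat reg hreg).weaken hC fun _ _ => hΦ _ _

lemma Run.of_bd {p : Prog W} {ρ : W → ℤ} {μ : ℕ → ℤ} {C : ℝ≥0∞}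
    {Φ : (W → ℤ) → (ℕ → ℤ) → Prop}
    (h : (∀ w, (ρ w).natAbs ≤ Γ.Y) → (∀ i, (μ i).natAbs ≤ Γ.Y) → H.Run start code Γ p ρ μ C Φ) :
    H.Run start code Γ p ρ μ C Φ :=
  fun q q' hat reg hreg => Reach.of_bd fun hbd =>
    h (fun w => hreg w ▸ hbd.var w) hbd.mem q q' hat reg hreg

lemma Run.seq {p p' : Prog W} {ρ : W → ℤ} {μ : ℕ → ℤ} {C C' : ℝ≥0∞}
    {Φ Ψ : (W → ℤ) → (ℕ → ℤ) → Prop} (h : H.Run start code Γ p ρ μ C Φ)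
    (h' : ∀ ρ' μ', Φ ρ' μ' → H.Run start code Γ p' ρ' μ' C' Ψ) :
    H.Run start code Γ (p ;; p') ρ μ (C + C') Ψ := by
  rintro q q' ⟨q₁, h₁, h₂⟩ reg hreg
  exact (h q q₁ h₁ reg hreg).trans fun reg' μ' hΦ => h' _ _ hΦ q₁ q' h₂ reg' fun _ => rfl

lemma run_assign {d : W} {e : Expr W} {ρ : W → ℤ} {μ : ℕ → ℤ}
    {Ψ : (W → ℤ) → (ℕ → ℤ) → Prop} (hs : e.Safe Γ.x ρ μ Γ.ms)
    (hv : (e.eval Γ.x ρ μ).natAbs ≤ Γ.Y) (hΨ : Ψ (Function.update ρ d (e.eval Γ.x ρ μ)) μ) :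
    H.Run start code Γ (.assign d e) ρ μ (Prog.assign d e).len Ψ := by
  rintro q q' ⟨hok, q₁, h₁, h₂⟩ reg hreg
  refine Reach.weaken ((reach_expr h₁ hreg (by have := hok.1; omega) hok.2.1 hok.2.2 hs).trans
    (C' := 1) (Ψ := fun reg' μ' => Ψ (fun w => reg' (.inl w)) μ') ?_) (by simp [Prog.len])
    (fun _ _ h => h)
  rintro reg₁ mem₁ ⟨rfl, hv1, hρ1, -⟩
  refine Reach.of_bd fun hbd => ?_
  have hval : WordOp.add.eval (reg₁ (H.tmp 0)) (reg₁ H.zero) = e.eval Γ.x ρ mem₁ := by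
    simp [WordOp.eval, Host.zero, hbd.zero, hv1]
  refine (reach_op_var h₂ fun _ => by rwa [hval]).weaken le_rfl ?_
  rintro _ _ ⟨rfl, rfl⟩
  rw [hval]
  convert hΨ using 1
  funext w
  by_cases hw : w = d
  · subst hw; simp
  · simp [hw, hρ1]

lemma run_store {a e : Expr W} {ρ : W → ℤ} {μ : ℕ → ℤ}
    {Ψ : (W → ℤ) → (ℕ → ℤ) → Prop} (hsa : a.Safe Γ.x ρ μ Γ.ms) (hse : e.Safe Γ.x ρ μ Γ.ms)
    (ha : (a.eval Γ.x ρ μ).toNat < Γ.ms) (hv : (e.eval Γ.x ρ μ).natAbs ≤ Γ.Y)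
    (hΨ : Ψ ρ (Function.update μ (a.eval Γ.x ρ μ).toNat (e.eval Γ.x ρ μ))) :
    H.Run start code Γ (.store a e) ρ μ (Prog.store a e).len Ψ := by
  rintro q q' ⟨hoka, hoke, q₁, q₂, h₁, h₂, h₃⟩ reg hreg
  have h0 := hoka.1
  have h1 := hoke.1
  refine Reach.weaken ((reach_expr h₁ hreg (by omega) hoka.2.1 hoka.2.2 hsa).trans
    (C' := e.cost + 1) (Ψ := fun reg' μ' => Ψ (fun w => reg' (.inl w)) μ') ?_)
    (by simp [Prog.len, add_assoc]) (fun _ _ h => h)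
  rintro reg₁ mem₁ ⟨rfl, hv1, hρ1, -⟩
  refine (reach_expr h₂ hρ1 (by omega) hoke.2.1 hoke.2.2 hse).trans ?_
  rintro reg₂ mem₂ ⟨rfl, hv2, hρ2, hf2⟩
  have hv1' : reg₂ (H.tmp 0) = a.eval Γ.x ρ mem₂ := by rw [hf2 0 (by omega), hv1]
  refine (reach_store h₃ (by rwa [hv1']) (by rwa [hv2])).weaken le_rfl ?_
  rintro _ _ ⟨rfl, rfl⟩
  rw [hv1', hv2]
  convert hΨ using 1
  exact funext hρ2

lemma reach_guard {a b : Expr W} {q q₁ q₂ q₃ q₄ q' : Q} (hoka : a.Ok H.D Γ.s Γ.Y)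
    (hokb : b.Ok H.D Γ.s Γ.Y) (h₁ : H.AtE code a 0 q q₁) (h₂ : H.AtE code b 1 q₁ q₂)
    (h₃ : code q₂ = .jumpLt (H.tmp 0) (H.tmp 1) q₃ q₄) {ρ : W → ℤ} {μ : ℕ → ℤ}
    (hsa : a.Safe Γ.x ρ μ Γ.ms) (hsb : b.Safe Γ.x ρ μ Γ.ms)
    (hq' : q' = if a.eval Γ.x ρ μ < b.eval Γ.x ρ μ then q₃ else q₄)
    {reg : H.R → ℤ} (hreg : ∀ w, reg (.inl w) = ρ w) :
    H.Reach start code Γ q reg μ (a.cost + b.cost + 1 : ℕ) q' fun reg' μ' =>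
      (∀ w, reg' (.inl w) = ρ w) ∧ μ' = μ := by
  have h0 := hoka.1
  have h1 := hokb.1
  refine Reach.weaken ((reach_expr h₁ hreg (by omega) hoka.2.1 hoka.2.2 hsa).trans
    (C' := b.cost + 1) (Ψ := fun reg' μ' => (∀ w, reg' (.inl w) = ρ w) ∧ μ' = μ) ?_)
    (by simp [add_assoc]) (fun _ _ h => h)
  rintro reg₁ mem₁ ⟨rfl, hv1, hρ1, -⟩
  refine (reach_expr h₂ hρ1 (by omega) hokb.2.1 hokb.2.2 hsb).trans ?_
  rintro reg₂ mem₂ ⟨rfl, hv2, hρ2, hf2⟩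
  have hv1' : reg₂ (H.tmp 0) = a.eval Γ.x ρ mem₂ := by rw [hf2 0 (by omega), hv1]
  refine (reach_jump h₃ (by rw [hv1', hv2, hq'])).weaken le_rfl ?_
  rintro _ _ ⟨rfl, rfl⟩
  exact ⟨hρ2, rfl⟩

lemma run_ifLt {a b : Expr W} {p p' : Prog W} {ρ : W → ℤ} {μ : ℕ → ℤ} {C : ℝ≥0∞}
    {Ψ : (W → ℤ) → (ℕ → ℤ) → Prop}
    (hsa : a.Safe Γ.x ρ μ Γ.ms) (hsb : b.Safe Γ.x ρ μ Γ.ms)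
    (h : a.eval Γ.x ρ μ < b.eval Γ.x ρ μ → H.Run start code Γ p ρ μ C Ψ)
    (h' : ¬ a.eval Γ.x ρ μ < b.eval Γ.x ρ μ → H.Run start code Γ p' ρ μ C Ψ) :
    H.Run start code Γ (.ifLt a b p p') ρ μ ((a.cost + b.cost + 1 : ℕ) + C) Ψ := by
  rintro q q' ⟨hoka, hokb, q₁, q₂, q₃, q₄, h₁, h₂, h₃, hp, hp'⟩ reg hreg
  refine (reach_guard hoka hokb h₁ h₂ h₃ hsa hsb rfl hreg).trans ?_
  rintro reg₁ _ ⟨hreg₁, rfl⟩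
  split_ifs with hlt
  · exact h hlt _ _ hp reg₁ hreg₁
  · exact h' hlt _ _ hp' reg₁ hreg₁

/-- The index `i` is the abstract state of the loop and `cost i` a potential that pays for all that
remains. The induction is on the time horizon, not on the number of rounds, so no separate
termination argument is needed. -/
lemma run_whileLt {ι : Type*} {a b : Expr W} {p : Prog W} (I : ι → (W → ℤ) → (ℕ → ℤ) → Prop)
    (cost : ι → ℝ≥0∞) {Ψ : (W → ℤ) → (ℕ → ℤ) → Prop}
    (hs : ∀ i ρ μ, I i ρ μ → a.Safe Γ.x ρ μ Γ.ms ∧ b.Safe Γ.x ρ μ Γ.ms)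
    (hstep : ∀ i ρ μ, I i ρ μ → a.eval Γ.x ρ μ < b.eval Γ.x ρ μ → ∃ C R,
      (a.cost + b.cost + 1 : ℕ) + C + R ≤ cost i ∧
      H.Run start code Γ p ρ μ C fun ρ' μ' => ∃ j, I j ρ' μ' ∧ cost j ≤ R)
    (hend : ∀ i ρ μ, I i ρ μ → ¬ a.eval Γ.x ρ μ < b.eval Γ.x ρ μ →
      ((a.cost + b.cost + 1 : ℕ) : ℝ≥0∞) ≤ cost i ∧ Ψ ρ μ)
    (i : ι) {ρ : W → ℤ} {μ : ℕ → ℤ} (hI : I i ρ μ) :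
    H.Run start code Γ (.whileLt a b p) ρ μ (cost i) Ψ := by
  rintro q q' ⟨hoka, hokb, q₁, q₂, q₃, h₁, h₂, h₃, hp⟩ reg hreg T r
  have h0 := hoka.1
  have h1 := hokb.1
  induction T generalizing i ρ μ reg with
  | zero => exact fun _ _ => WordRAM.good_zero _ _
  | succ T ih =>
    intro hg hbd
    obtain ⟨hsa, hsb⟩ := hs i ρ μ hI
    -- The jump at the end of the guard uses up one unit of the horizon, so that the induction
    -- hypothesis applies after the body.
    have hguard : ∀ R : ℝ≥0∞, (∀ reg' : H.R → ℤ, (∀ w, reg' (.inl w) = ρ w) → H.Bd Γ reg' μ →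
        H.GoodAt start code Γ T (if a.eval Γ.x ρ μ < b.eval Γ.x ρ μ then q₃ else q') reg' μ R) →
        H.GoodAt start code Γ (T + 1) q reg μ ((a.cost + b.cost + 1 : ℕ) + R) := by
      intro R hR
      have := reach_expr (start := start) h₁ hreg (by omega) hoka.2.1 hoka.2.2 hsa (T + 1)
        (b.cost + (1 + R)) ?_ hbd
      · exact this.mono (by push_cast; rw [add_assoc, add_assoc])
      rintro reg₁ mem₁ hbd₁ ⟨rfl, hv1, hρ1, -⟩
      refine reach_expr h₂ hρ1 (by omega) hokb.2.1 hokb.2.2 hsb (T + 1) (1 + R) ?_ hbd₁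
      rintro reg₂ mem₂ hbd₂ ⟨rfl, hv2, hρ2, hf2⟩
      have hv1' : reg₂ (H.tmp 0) = a.eval Γ.x ρ mem₂ := by rw [hf2 0 (by omega), hv1]
      refine goodAt_of_step hbd₂ (by simp [h₃]) (by simp [WordRAM.Accesses, h₃]) ?_
        (hR reg₂ hρ2 hbd₂)
      simp only [WordRAM.step, h₃, hv1', hv2]
    by_cases hlt : a.eval Γ.x ρ μ < b.eval Γ.x ρ μ
    · obtain ⟨C, R, hCR, hbody⟩ := hstep i ρ μ hI hlt
      refine (hguard (C + (R + r)) fun reg' hreg' hbd' => ?_).mono ?_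
      · rw [if_pos hlt]
        refine hbody q₃ q hp reg' hreg' T (R + r) ?_ hbd'
        rintro reg₂ μ₂ hbd₂ ⟨j, hj, hjR⟩
        exact (ih j hj reg₂ (fun _ => rfl) (fun reg' mem' hb hΨ =>
          (hg reg' mem' hb hΨ).anti (Nat.le_succ _)) hbd₂).mono (by gcongr)
      · rw [← add_assoc, ← add_assoc]
        gcongr
    · obtain ⟨hc, hΨ⟩ := hend i ρ μ hI hlt
      refine (hguard r fun reg' hreg' hbd' => ?_).mono (by gcongr)
      rw [if_neg hlt]
      refine (hg reg' μ hbd' ?_).anti (Nat.le_succ _)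
      have : (fun w => reg' (.inl w)) = ρ := funext hreg'
      simpa only [this] using hΨ

lemma run_skip {ρ : W → ℤ} {μ : ℕ → ℤ} {Ψ : (W → ℤ) → (ℕ → ℤ) → Prop} (h : Ψ ρ μ) :
    H.Run start code Γ .skip ρ μ 1 Ψ := by
  intro q q' hat reg hreg
  refine (reach_jump hat (by simp)).weaken le_rfl ?_
  rintro reg' _ ⟨rfl, rfl⟩
  have : (fun w => reg' (.inl w)) = ρ := funext hreg
  simpa only [this] using h

/-- The postcondition is arbitrary because the end of the program is not reached. -/
lemma run_halt {b : Bool} {ρ : W → ℤ} {μ : ℕ → ℤ} {Ψ : (W → ℤ) → (ℕ → ℤ) → Prop}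
    (h : b = true ↔ Γ.yes) : H.Run start code Γ (.halt b) ρ μ 0 Ψ :=
  fun _ _ hat _ _ _ _ _ hbd => goodAt_halt _ b hbd hat h

end Host

namespace Host

variable {W : Type} [Fintype W] [DecidableEq W] {H : Host W}
variable {Q : Type} [Fintype Q] {start : Q} {code : Q → Instr Q H.R} {Γ : Job}

/-! ### Subroutine calls -/

/-- The registers `reg` and the memory `μ` of the host represent the configuration `c` of the called
machine on the input `y`, with `ms` cells of memory from `base` on; apart from that, variables are
as in `ρ` and memory is as in `μ₀`. -/
structure Sim (H : Host W) (y : List ℤ) (base ms : ℕ) (ρ : W → ℤ) (μ₀ : ℕ → ℤ) (c : H.M.Config)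
    (reg : H.R → ℤ) (μ : ℕ → ℤ) : Prop where
  reg_eq : ∀ r, reg (.inl (H.reg r)) = c.reg r
  var_eq : ∀ w ∉ Set.range H.reg, reg (.inl w) = ρ w
  mem_eq : ∀ i < ms, μ (base + i) = c.mem i
  frame : ∀ i < base, μ i = μ₀ i

lemma Sim.update_reg {y : List ℤ} {base ms : ℕ} {ρ : W → ℤ} {μ₀ μ : ℕ → ℤ} {c : H.M.Config}
    {reg : H.R → ℤ} (h : Sim H y base ms ρ μ₀ c reg μ) (d : H.M.R) (z : ℤ) (q : H.M.Q) :
    Sim H y base ms ρ μ₀ (c.set d z q) (Function.update reg (.inl (H.reg d)) z) μ where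
  reg_eq r := by
    by_cases hr : r = d
    · subst hr; simp [WordRAM.Config.set]
    · have : (Sum.inl (H.reg r) : H.R) ≠ .inl (H.reg d) := by simpa [H.inj.eq_iff] using hr
      simp [WordRAM.Config.set, hr, Function.update_of_ne this, h.reg_eq]
  var_eq w hw := by
    have : (Sum.inl w : H.R) ≠ .inl (H.reg d) := by
      rintro h'
      exact hw ⟨d, (Sum.inl.inj h').symm⟩
    rw [Function.update_of_ne this, h.var_eq w hw]
  mem_eq := h.mem_eq
  frame := h.frame

lemma Sim.update_tmp {y : List ℤ} {base ms : ℕ} {ρ : W → ℤ} {μ₀ μ : ℕ → ℤ} {c : H.M.Config}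
    {reg : H.R → ℤ} (h : Sim H y base ms ρ μ₀ c reg μ) (k : ℕ) (z : ℤ) :
    Sim H y base ms ρ μ₀ c (Function.update reg (H.tmp k) z) μ where
  reg_eq r := by simpa [Host.tmp] using h.reg_eq r
  var_eq w hw := by simpa [Host.tmp] using h.var_eq w hw
  mem_eq := h.mem_eq
  frame := h.frame

lemma Sim.pc {y : List ℤ} {base ms : ℕ} {ρ : W → ℤ} {μ₀ μ : ℕ → ℤ} {c : H.M.Config}
    {reg : H.R → ℤ} (h : Sim H y base ms ρ μ₀ c reg μ) (q : H.M.Q) :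
    Sim H y base ms ρ μ₀ { c with pc := q } reg μ :=
  ⟨h.reg_eq, h.var_eq, h.mem_eq, h.frame⟩

lemma Sim.update_mem {y : List ℤ} {base ms : ℕ} {ρ : W → ℤ} {μ₀ μ : ℕ → ℤ} {c : H.M.Config}
    {reg : H.R → ℤ} (h : Sim H y base ms ρ μ₀ c reg μ) (i : ℕ) (z : ℤ) (q : H.M.Q) :
    Sim H y base ms ρ μ₀ { c with pc := q, mem := Function.update c.mem i z } reg
      (Function.update μ (base + i) z) where
  reg_eq := h.reg_eq
  var_eq := h.var_eq
  mem_eq j hj := by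
    by_cases hji : j = i
    · subst hji; simp
    · simp [hji, h.mem_eq j hj]
  frame j hj := by rw [Function.update_of_ne (by omega), h.frame j hj]

/-- The run of the called machine. -/
lemma goodAt_sim {y : List ℤ} {base ms : ℕ} {ρ : W → ℤ} {μ₀ : ℕ → ℤ} {q' : Q}
    {emb : H.M.Q → Fin 4 → Q} (hemb : ∀ s i, code (emb s i) = H.callInstr emb q' s i)
    (hs : 2 ≤ Γ.s)
    (hbase : H.base ∉ Set.range H.reg) (hρb : ρ H.base = base)
    (hlen : H.len ∉ Set.range H.reg) (hρl : ρ H.len = y.length)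
    (hy0 : 0 < y.length) (hyb : y.length ≤ base) (hy : ∀ i, ∀ h : i < y.length, μ₀ i = y[i]) (hms : base + ms ≤ Γ.ms)
    (hfit : ∀ c, H.M.Reachable y c → (∀ r, (c.reg r).natAbs ≤ Γ.Y) ∧ ∀ i, (c.mem i).natAbs ≤ Γ.Y)
    (hspace : ∀ c, H.M.Reachable y c → ∀ i, H.M.Accesses c i → i < ms)
    (hyes : ∀ c, H.M.Reachable y c → H.M.Answers c true → Γ.yes)
    {r : ℝ≥0∞} {T : ℕ}
    (hexit : ∀ c reg μ, H.M.Reachable y c → H.M.Answers c false →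
      Sim H y base ms ρ μ₀ c reg μ → H.Bd Γ reg μ → H.GoodAt start code Γ T q' reg μ r)
    {c : H.M.Config} {reg : H.R → ℤ} {μ : ℕ → ℤ} (hc : H.M.Reachable y c)
    (hsim : Sim H y base ms ρ μ₀ c reg μ) (hbd : H.Bd Γ reg μ) :
    H.GoodAt start code Γ T (emb c.pc 0) reg μ (3 * H.M.remainingTime y c + 1 + r) := by
  induction T generalizing c reg μ with
  | zero => exact WordRAM.good_zero _ _
  | succ T ih =>
    have ih' := fun {c reg μ} => @ih (fun c reg μ h1 h2 h3 h4 =>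
      (hexit c reg μ h1 h2 h3 h4).anti (Nat.le_succ T)) c reg μ
    have hb : reg (.inl H.base) = base := by rw [hsim.var_eq _ hbase, hρb]
    have hl : reg (.inl H.len) = y.length := by rw [hsim.var_eq _ hlen, hρl]
    have hce := fun i => hemb c.pc i
    have hsp := hspace c hc
    simp only [WordRAM.Accesses] at hsp
    -- One deterministic step of the called machine becomes one host step followed by a path of cost
    -- at most `2`. This is the source of the factor `3`.
    have hstep : ∀ {c' : H.M.Config} {reg' : H.R → ℤ} {μ' : ℕ → ℤ} {C : ℝ≥0∞}
        {q₁ : Q} {reg₁ : H.R → ℤ} {μ₁ : ℕ → ℤ}, ¬ H.M.Halted c → H.M.step y c = PMF.pure c' →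
        (H.M.Reachable y c' → Sim H y base ms ρ μ₀ c' reg' μ' ∧ H.Bd Γ reg' μ') → C ≤ 2 →
        (∀ R, H.GoodAt start code Γ T (emb c'.pc 0) reg' μ' R →
          H.GoodAt start code Γ T q₁ reg₁ μ₁ (C + R)) →
        (H.mach start code).step Γ.x ⟨emb c.pc 0, reg, μ⟩ = PMF.pure ⟨q₁, reg₁, μ₁⟩ →
        (∀ b, code (emb c.pc 0) ≠ .halt b) →
        (∀ i, (H.mach start code).Accesses ⟨emb c.pc 0, reg, μ⟩ i → i < Γ.ms) →
        H.GoodAt start code Γ (T + 1) (emb c.pc 0) reg μ (3 * H.M.remainingTime y c + 1 + r) := by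
      intro c' reg' μ' C q₁ reg₁ μ₁ hh hst hsim' hC hpath hs₁ hnh hacc
      have hr := hc.step (c' := c') (by rw [hst]; simp)
      refine (goodAt_of_step hbd hnh hacc hs₁
        (hpath _ (ih' hr (hsim' hr).1 (hsim' hr).2))).mono ?_
      rw [H.M.remainingTime_eq y hh, hst, PMF.expect_pure, mul_add, mul_one, ← add_assoc,
        add_assoc 3, add_assoc 3]
      have : (1 : ℝ≥0∞) + C ≤ 3 := by
        calc (1 : ℝ≥0∞) + C ≤ 1 + 2 := by gcongr
          _ = 3 := by norm_num
      rw [add_assoc (3 * _)]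
      gcongr
    have nostep : ∀ R q₁ reg₁ μ₁, H.GoodAt start code Γ T q₁ reg₁ μ₁ R →
        H.GoodAt start code Γ T q₁ reg₁ μ₁ (0 + R) := fun R _ _ _ h => by rwa [zero_add]
    have hbnd := hfit c hc
    have hY := Γ.two_le
    have hbY : base ≤ Γ.Y := by
      have := hbd.var H.base
      rw [hb] at this
      simpa using this
    -- An address is a sum of two words. It need not be below `Y`, but fits into a temporary
    -- register as `2 ≤ s`.
    have hYs : 2 * Γ.Y ≤ Γ.Y ^ Γ.s := by
      calc 2 * Γ.Y ≤ Γ.Y ^ 2 := by nlinarith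
        _ ≤ _ := Nat.pow_le_pow_right (by omega) hs
    have haddr : ∀ a : H.M.R, (reg (.inl (H.reg a)) + base).natAbs ≤ Γ.Y ^ Γ.s := fun a => by
      have := hbd.var (H.reg a)
      omega
    -- the address computation for a memory access of the machine
    have mem_path : ∀ (a : H.M.R) {c' : H.M.Config} {reg' : H.R → ℤ} {μ' : ℕ → ℤ},
        code (emb c.pc 0) = .op .add (H.tmp 0) (.inl H.base) (.inl (H.reg a)) (emb c.pc 1) →
        code (emb c.pc 1) = .jumpLt (H.tmp 0) (.inl H.base) (emb c.pc 2) (emb c.pc 3) →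
        ¬ H.M.Halted c → H.M.step y c = PMF.pure c' →
        (H.M.Reachable y c' → Sim H y base ms ρ μ₀ c' reg' μ' ∧ H.Bd Γ reg' μ') →
        (∀ (reg₁ : H.R → ℤ) (q : Q) (b : H.R), reg₁ = Function.update reg (H.tmp 0)
            (base + c.reg a) → H.Bd Γ reg₁ μ → (reg₁ b).toNat = base + (c.reg a).toNat →
            (q = emb c.pc 2 ∧ b = .inl H.base ∨ q = emb c.pc 3 ∧ b = H.tmp 0) →
            H.Reach start code Γ q reg₁ μ 1 (emb c'.pc 0) fun r₂ μ₂ => r₂ = reg' ∧ μ₂ = μ') →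
        H.GoodAt start code Γ (T + 1) (emb c.pc 0) reg μ
          (3 * H.M.remainingTime y c + 1 + r) := by
      intro a c' reg' μ' h0 h1 hh hst hsim' hacc
      refine hstep (C := 2) (q₁ := emb c.pc 1) (μ₁ := μ)
        (reg₁ := Function.update reg (H.tmp 0) (base + c.reg a)) hh hst hsim' le_rfl ?_
        (by simp [WordRAM.step, h0, WordRAM.Config.set, WordOp.eval, hb, hsim.reg_eq])
        (by simp [h0]) (by simp [WordRAM.Accesses, h0])
      intro R hR
      have hbd₁ : H.Bd Γ (Function.update reg (H.tmp 0) (base + c.reg a)) μ := by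
        refine hbd.update_tmp 0 ?_
        rw [← hsim.reg_eq, add_comm]
        exact haddr a
      rw [show (2 : ℝ≥0∞) = 1 + 1 by norm_num]
      by_cases hneg : c.reg a < 0
      · refine (reach_jump (q' := emb c.pc 2) h1 ?_).trans (C' := 1) (q'' := emb c'.pc 0)
          (Ψ := fun r₂ μ₂ => r₂ = reg' ∧ μ₂ = μ') ?_ T R ?_ hbd₁
        · rw [if_pos]
          rw [Function.update_self, Function.update_of_ne (by simp [Host.tmp]), hb]
          omega
        · rintro _ _ ⟨rfl, rfl⟩
          refine hacc _ _ _ rfl hbd₁ ?_ (Or.inl ⟨rfl, rfl⟩)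
          rw [Function.update_of_ne (by simp [Host.tmp]), hb]
          omega
        · rintro _ _ _ ⟨rfl, rfl⟩
          exact hR
      · refine (reach_jump (q' := emb c.pc 3) h1 ?_).trans (C' := 1) (q'' := emb c'.pc 0)
          (Ψ := fun r₂ μ₂ => r₂ = reg' ∧ μ₂ = μ') ?_ T R ?_ hbd₁
        · rw [if_neg]
          rw [Function.update_self, Function.update_of_ne (by simp [Host.tmp]), hb]
          omega
        · rintro _ _ ⟨rfl, rfl⟩
          refine hacc _ _ _ rfl hbd₁ ?_ (Or.inr ⟨rfl, rfl⟩)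
          rw [Function.update_self]
          omega
        · rintro _ _ _ ⟨rfl, rfl⟩
          exact hR
    cases hcode : H.M.code c.pc with
    | const d z s' =>
      have h0 := hce 0
      simp only [callInstr, hcode] at h0
      refine hstep (c' := c.set d z s') (by rintro ⟨b, hb⟩; simp [WordRAM.Answers, hcode] at hb)
        (by simp [WordRAM.step, hcode]) (fun hr => ⟨hsim.update_reg d z s', hbd.update_var _ ?_⟩)
        zero_le_two (fun R => nostep R _ _ _)
        (by simp only [WordRAM.step, h0, WordRAM.Config.set]) (by simp [h0])
        (by simp [WordRAM.Accesses, h0])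
      simpa [WordRAM.Config.set] using (hfit _ hr).1 d
    | op o d a b s' =>
      have h0 := hce 0
      simp only [callInstr, hcode] at h0
      refine hstep (c' := c.set d (o.eval (c.reg a) (c.reg b)) s')
        (by rintro ⟨b, hb⟩; simp [WordRAM.Answers, hcode] at hb)
        (by simp [WordRAM.step, hcode]) (fun hr => ⟨hsim.update_reg d _ s', hbd.update_var _ ?_⟩)
        zero_le_two (fun R => nostep R _ _ _)
        (by simp only [WordRAM.step, h0, WordRAM.Config.set, hsim.reg_eq]) (by simp [h0])
        (by simp [WordRAM.Accesses, h0])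
      simpa [WordRAM.Config.set] using (hfit _ hr).1 d
    | input d a s' =>
      have h0 := hce 0
      have h1 := hce 1
      have h2 := hce 2
      simp only [callInstr, hcode] at h0 h1 h2
      have hbval : H.M.Reachable y (c.set d (y.getD (c.reg a).toNat 0) s') →
          Sim H y base ms ρ μ₀ (c.set d (y.getD (c.reg a).toNat 0) s')
            (Function.update reg (.inl (H.reg d)) (y.getD (c.reg a).toNat 0)) μ ∧
          H.Bd Γ (Function.update reg (.inl (H.reg d)) (y.getD (c.reg a).toNat 0)) μ := by
        refine fun hr => ⟨hsim.update_reg d _ s', hbd.update_var _ ?_⟩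
        simpa [WordRAM.Config.set] using (hfit _ hr).1 d
      refine hstep (C := 1) (q₁ := if c.reg a < y.length then emb c.pc 1 else emb c.pc 2)
        (reg₁ := reg) (μ₁ := μ) (c' := c.set d (y.getD (c.reg a).toNat 0) s')
        (by rintro ⟨b, hb⟩; simp [WordRAM.Answers, hcode] at hb)
        (by simp [WordRAM.step, hcode]) hbval one_le_two ?_
        (by simp only [WordRAM.step, h0, hsim.reg_eq, hl]) (by simp [h0])
        (by simp [WordRAM.Accesses, h0])
      intro R hR
      by_cases hlt : c.reg a < y.length
      · rw [if_pos hlt]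
        have hlt' : (c.reg a).toNat < y.length := by omega
        refine reach_load_var h1 (by rw [hsim.reg_eq]; omega) T R ?_ hbd
        rintro _ _ _ ⟨rfl, rfl⟩
        rw [hsim.reg_eq, hsim.frame _ (by omega), hy _ hlt']
        rwa [List.getD_eq_getElem _ _ hlt'] at hR
      · rw [if_neg hlt]
        refine reach_const_var h2 (by simp) T R ?_ hbd
        rintro _ _ _ ⟨rfl, rfl⟩
        rw [List.getD_eq_default _ _ (by omega)] at hR
        exact hR
    | load d a s' =>
      have h0 := hce 0
      have h1 := hce 1
      have h2 := hce 2
      have h3 := hce 3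
      simp only [callInstr, hcode] at h0 h1 h2 h3
      simp only [hcode] at hsp
      have hms' := hsp _ rfl
      refine mem_path a (c' := c.set d (c.mem (c.reg a).toNat) s') (μ' := μ)
        (reg' := Function.update (Function.update reg (H.tmp 0) (base + c.reg a))
          (.inl (H.reg d)) (c.mem (c.reg a).toNat)) h0 h1
        (by rintro ⟨b, hb⟩; simp [WordRAM.Answers, hcode] at hb)
        (by simp [WordRAM.step, hcode])
        (fun hr => ⟨(hsim.update_tmp 0 _).update_reg d _ s', (hbd.update_tmp 0 ?_).update_var _ ?_⟩)
        ?_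
      · rw [← hsim.reg_eq, add_comm]; exact haddr a
      · exact hbnd.2 _
      · rintro reg₁ q b rfl hbd₁ hval hqb
        have hl : code q = .load (.inl (H.reg d)) b (emb s' 0) := by
          rcases hqb with ⟨rfl, rfl⟩ | ⟨rfl, rfl⟩ <;> assumption
        refine (reach_load_var hl (by rw [hval]; omega)).weaken le_rfl ?_
        rintro _ _ ⟨rfl, rfl⟩
        rw [hval, hsim.mem_eq _ hms']
        exact ⟨rfl, rfl⟩
    | store a v s' =>
      have h0 := hce 0
      have h1 := hce 1
      have h2 := hce 2
      have h3 := hce 3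
      simp only [callInstr, hcode] at h0 h1 h2 h3
      simp only [hcode] at hsp
      have hms' := hsp _ rfl
      refine mem_path a
        (c' := { c with pc := s', mem := Function.update c.mem (c.reg a).toNat (c.reg v) })
        (μ' := Function.update μ (base + (c.reg a).toNat) (c.reg v))
        (reg' := Function.update reg (H.tmp 0) (base + c.reg a)) h0 h1
        (by rintro ⟨b, hb⟩; simp [WordRAM.Answers, hcode] at hb)
        (by simp [WordRAM.step, hcode])
        (fun hr => ⟨(hsim.update_tmp 0 _).update_mem _ _ s', (hbd.update_tmp 0 ?_).update_mem _ ?_⟩)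
        ?_
      · rw [← hsim.reg_eq, add_comm]; exact haddr a
      · exact hbnd.1 _
      · rintro reg₁ q b rfl hbd₁ hval hqb
        have hl : code q = .store b (.inl (H.reg v)) (emb s' 0) := by
          rcases hqb with ⟨rfl, rfl⟩ | ⟨rfl, rfl⟩ <;> assumption
        have hv : Function.update reg (H.tmp 0) (base + c.reg a) (.inl (H.reg v)) = c.reg v := by
          rw [Function.update_of_ne (by simp [Host.tmp]), hsim.reg_eq]
        refine (reach_store hl (by rw [hval]; omega) (by rw [hv]; exact hbnd.1 v)).weaken le_rfl ?_
        rintro _ _ ⟨rfl, rfl⟩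
        rw [hval, hv]
        exact ⟨rfl, rfl⟩
    | rand d a s' =>
      have h0 := hce 0
      simp only [callInstr, hcode] at h0
      have hh : ¬ H.M.Halted c := by rintro ⟨b, hb⟩; simp [WordRAM.Answers, hcode] at hb
      have hst : H.M.step y c = (WordRAM.uniformBelow (c.reg a)).map fun z => c.set d z s' := by
        simp [WordRAM.step, hcode]
      let g : ℤ → (H.mach start code).Config := fun z =>
        ⟨emb s' 0, Function.update reg (.inl (H.reg d)) z, μ⟩
      have hst' : (H.mach start code).step Γ.x ⟨emb c.pc 0, reg, μ⟩ =
          (WordRAM.uniformBelow (c.reg a)).map g := by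
        simp only [WordRAM.step, h0, hsim.reg_eq, WordRAM.Config.set, g]
      -- Host and called machine draw from the same distribution. The budget after the draw is the
      -- remaining time for the number drawn, and its average is given by `remainingTime_eq`.
      have hgood := WordRAM.good_step (M := H.mach start code) (x := Γ.x) (T := T)
        (c := ⟨emb c.pc 0, reg, μ⟩) (Safe := H.SafeCfg start code Γ)
        (f := fun c₁ => 3 * H.M.remainingTime y (c.set d (c₁.reg (.inl (H.reg d))) s') + 1 + r)
        ⟨fun b hb => absurd hb (by simp [WordRAM.Answers, h0]),
          by simp [WordRAM.Accesses, h0], hbd⟩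
        (by rintro ⟨b, hb⟩; simp [WordRAM.Answers, h0] at hb) (by
          intro c₁ hc₁
          rw [hst', PMF.mem_support_map_iff] at hc₁
          obtain ⟨z, hz, rfl⟩ := hc₁
          have hr : H.M.Reachable y (c.set d z s') := hc.step (by
            rw [hst, PMF.mem_support_map_iff]; exact ⟨z, hz, rfl⟩)
          have hzY : z.natAbs ≤ Γ.Y := by simpa [WordRAM.Config.set] using (hfit _ hr).1 d
          have := ih' hr (hsim.update_reg d z s') (hbd.update_var _ hzY)
          simpa [g, GoodAt, WordRAM.Config.set] using this)
      refine GoodAt.mono (show H.GoodAt start code Γ (T + 1) _ _ _ _ from hgood) ?_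
      rw [hst', PMF.expect_map, H.M.remainingTime_eq y hh, hst, PMF.expect_map]
      simp only [g, Function.update_self, add_assoc]
      rw [PMF.expect_add, PMF.expect_const, PMF.expect_const_mul, mul_add, mul_one, add_assoc]
      gcongr
      norm_num
    | jumpLt a b s₁ s₂ =>
      have h0 := hce 0
      simp only [callInstr, hcode] at h0
      refine hstep (c' := { c with pc := if c.reg a < c.reg b then s₁ else s₂ })
        (by rintro ⟨b, hb⟩; simp [WordRAM.Answers, hcode] at hb)
        (by simp [WordRAM.step, hcode]) (fun hr => ⟨hsim.pc _, hbd⟩)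
        zero_le_two (fun R => nostep R _ _ _)
        ?_ (by simp [h0]) (by simp [WordRAM.Accesses, h0])
      simp only [WordRAM.step, h0, hsim.reg_eq]
      split_ifs <;> rfl
    | halt b =>
      have h0 := hce 0
      cases b with
      | true =>
        simp only [callInstr, hcode] at h0
        exact goodAt_halt _ true hbd h0 (by simpa using hyes c hc hcode)
      | false =>
        simp only [callInstr, hcode] at h0
        refine GoodAt.mono ?_ (show 1 + r ≤ _ by gcongr; exact le_add_self)
        refine reach_jump (q' := q') (Γ := Γ) h0 (by simp) (T + 1) r ?_ hbd
        rintro _ _ hbd' ⟨rfl, rfl⟩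
        exact hexit c _ _ hc hcode hsim hbd'

/-- A call of the subroutine on the instance `y` in the work memory. -/
lemma run_call {y : List ℤ} {base ms : ℕ} {ρ : W → ℤ} {μ : ℕ → ℤ} (hs : 2 ≤ Γ.s)
    (hbase : H.base ∉ Set.range H.reg) (hρb : ρ H.base = base)
    (hlen : H.len ∉ Set.range H.reg) (hρl : ρ H.len = y.length) (hy0 : 0 < y.length)
    (hyb : y.length ≤ base) (hy : ∀ i, ∀ h : i < y.length, μ i = y[i]) (hms : base + ms ≤ Γ.ms)
    (hreg : ∀ r, ρ (H.reg r) = 0) (hmem : ∀ i < ms, μ (base + i) = 0)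
    (hfit : ∀ c, H.M.Reachable y c → (∀ r, (c.reg r).natAbs ≤ Γ.Y) ∧ ∀ i, (c.mem i).natAbs ≤ Γ.Y)
    (hspace : ∀ c, H.M.Reachable y c → ∀ i, H.M.Accesses c i → i < ms)
    (hyes : ∀ c, H.M.Reachable y c → H.M.Answers c true → Γ.yes)
    {Ψ : (W → ℤ) → (ℕ → ℤ) → Prop}
    (hΨ : ∀ c ρ' μ', H.M.Reachable y c → H.M.Answers c false →
      (∀ w ∉ Set.range H.reg, ρ' w = ρ w) → (∀ i < base, μ' i = μ i) → Ψ ρ' μ') :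
    H.Run start code Γ .call ρ μ (3 * H.M.expectedTime y + 1) Ψ := by
  rintro q q' ⟨emb, rfl, hemb⟩ reg hρ T r hg hbd
  rw [← WordRAM.remainingTime_init]
  refine goodAt_sim (c := H.M.init) (μ₀ := μ) hemb hs hbase hρb hlen hρl hy0 hyb hy hms hfit hspace
    hyes (fun c reg' μ' hc hans hsim hbd' => hg reg' μ' hbd' ?_) WordRAM.reachable_init
    ⟨fun r => by rw [hρ, hreg]; rfl, fun w _ => hρ w, fun i hi => hmem i hi, fun _ _ => rfl⟩ hbd
  exact hΨ c _ _ hc hans (fun w hw => hsim.var_eq w hw) hsim.frame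

end Host

/-! ### Sums over vectors of chunk numbers -/

/-- The sum of `F` over the vectors that have arbitrary entries below `m` at the places below `d`
and agree with `c` elsewhere. -/
def levSum (m : ℕ) : ℕ → ((ℕ → ℕ) → ℕ) → (ℕ → ℕ) → ℕ
  | 0, F, c => F c
  | d + 1, F, c => ∑ x ∈ Finset.range m, levSum m d F (Function.update c d x)

/-- The two vectors are compared only below `d`, and may differ elsewhere. This allows the
coordinate `d` to be moved from the vector into the function in `levSum_between_le`. -/
lemma levSum_le (m d : ℕ) {F G : (ℕ → ℕ) → ℕ} {c e : ℕ → ℕ}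
    (h : ∀ c' e', (∀ i < d, c' i = e' i ∧ c' i < m) → (∀ i, d ≤ i → c' i = c i ∧ e' i = e i) →
      F c' ≤ G e') : levSum m d F c ≤ levSum m d G e := by
  induction d generalizing c e with
  | zero => exact h c e (by simp) (by simp)
  | succ d ih =>
    refine Finset.sum_le_sum fun x hx => ih fun c' e' h₁ h₂ => h c' e' (fun i hi => ?_) fun i hi => ?_
    · rcases Nat.lt_succ_iff_lt_or_eq.1 hi with hi | rfl
      · exact h₁ i hi
      · obtain ⟨h3, h4⟩ := h₂ i le_rfl
        simp only [Function.update_self] at h3 h4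
        rw [h3, h4]
        exact ⟨rfl, Finset.mem_range.1 hx⟩
    · have := h₂ i (by omega)
      rwa [Function.update_of_ne (by omega), Function.update_of_ne (by omega)] at this

lemma levSum_sum {ι : Type*} (m d : ℕ) (s : Finset ι) (F : ι → (ℕ → ℕ) → ℕ) (c : ℕ → ℕ) :
    levSum m d (fun c' => ∑ j ∈ s, F j c') c = ∑ j ∈ s, levSum m d (F j) c := by
  induction d generalizing c with
  | zero => rfl
  | succ d ih =>
    simp only [levSum, ih]
    exact Finset.sum_comm

lemma levSum_add (m d : ℕ) (F G : (ℕ → ℕ) → ℕ) (c : ℕ → ℕ) :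
    levSum m d (fun c' => F c' + G c') c = levSum m d F c + levSum m d G c := by
  induction d generalizing c with
  | zero => rfl
  | succ d ih => simp only [levSum, ih, Finset.sum_add_distrib]

lemma levSum_mul (m d K : ℕ) (F : (ℕ → ℕ) → ℕ) (c : ℕ → ℕ) :
    levSum m d (fun c' => K * F c') c = K * levSum m d F c := by
  induction d generalizing c with
  | zero => rfl
  | succ d ih => simp only [levSum, ih, Finset.mul_sum]

lemma levSum_const (m d K : ℕ) (c : ℕ → ℕ) : levSum m d (fun _ => K) c = m ^ d * K := by
  induction d generalizing c with
  | zero => simp [levSum]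
  | succ d ih => simp [levSum, ih, pow_succ']; ring

/-- Along chains of intervals, only few vectors of intervals can have a given number strictly
between their sums. -/
lemma levSum_between_le {m : ℕ} {lo hi : ℕ → ℕ → ℤ}
    (h : ∀ i x x', x < x' → x' < m → hi i x ≤ lo i x') (d : ℕ) (T : ℤ) (c : ℕ → ℕ) :
    levSum m d (fun c' => if ∑ i ∈ Finset.range d, lo i (c' i) < T ∧
      T < ∑ i ∈ Finset.range d, hi i (c' i) then 1 else 0) c ≤ d * m ^ (d - 1) := by
  induction d generalizing T c with
  | zero =>
    have : ¬ (0 < T ∧ T < 0) := by omega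
    simp [levSum, this]
  | succ d ih =>
    set L : (ℕ → ℕ) → ℤ := fun c' => ∑ i ∈ Finset.range d, lo i (c' i)
    set U : (ℕ → ℕ) → ℤ := fun c' => ∑ i ∈ Finset.range d, hi i (c' i)
    -- Let `x` be the last coordinate. Either `T - lo d x` is strictly between the sums over the
    -- other coordinates, and the induction hypothesis counts these cases, or `T - U` lies in the
    -- half-open interval from `lo d x` to `hi d x`. These intervals are disjoint, so the second
    -- case fixes `x` once the other coordinates are given.
    let F : ℕ → (ℕ → ℕ) → ℕ := fun x c' =>
      if L c' < T - lo d x ∧ T - lo d x < U c' then 1 else 0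
    let G : ℕ → (ℕ → ℕ) → ℕ := fun x c' => if lo d x ≤ T - U c' ∧ T - U c' < hi d x then 1 else 0
    calc _ ≤ ∑ x ∈ Finset.range m, levSum m d (fun c' => F x c' + G x c') c := by
          refine Finset.sum_le_sum fun x _ => levSum_le m d fun c' e' h₁ h₂ => ?_
          have hL : L c' = L e' := Finset.sum_congr rfl fun i hi => by
            rw [(h₁ i (Finset.mem_range.1 hi)).1]
          have hU : U c' = U e' := Finset.sum_congr rfl fun i hi => by
            rw [(h₁ i (Finset.mem_range.1 hi)).1]
          have hx : c' d = x := by rw [(h₂ d le_rfl).1]; simp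
          rw [Finset.sum_range_succ, Finset.sum_range_succ, hx]
          change (if L c' + lo d x < T ∧ T < U c' + hi d x then 1 else 0) ≤ F x e' + G x e'
          simp only [F, G, ← hL, ← hU]
          split_ifs <;> omega
      _ = ∑ x ∈ Finset.range m, levSum m d (F x) c +
            levSum m d (fun c' => ∑ x ∈ Finset.range m, G x c') c := by
          simp only [levSum_add, Finset.sum_add_distrib, levSum_sum]
      _ ≤ ∑ x ∈ Finset.range m, d * m ^ (d - 1) + levSum m d (fun _ => 1) c := by
          refine add_le_add (Finset.sum_le_sum fun x _ => ih _ _) (levSum_le m d ?_)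
          intro c' e' _ _
          simp only [G]
          rw [Finset.sum_boole, Nat.cast_id, Finset.card_le_one]
          intro a ha b hb
          simp only [Finset.mem_filter, Finset.mem_range] at ha hb
          rcases lt_trichotomy a b with hab | hab | hab
          · have := h d a b hab hb.1; omega
          · exact hab
          · have := h d b a hab ha.1; omega
      _ = (d + 1) * m ^ (d + 1 - 1) := by
          rw [levSum_const, Finset.sum_const, Finset.card_range, smul_eq_mul]
          rcases d with _ | d
          · simp
          · simp only [Nat.add_sub_cancel, pow_succ]; ring

/-! ### Sorting keys -/

section Keys

variable (g : ℕ → ℤ) (N : ℕ)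

/-- The sort key of the number `g j`: ties are broken by the index. -/
def sortKey (j : ℕ) : ℤ := g j * N + j

variable {g N}

/-- As `0 ≤ j < N`, Euclidean division separates the two parts of a key, also for negative `g j`. -/
lemma sortKey_div {j : ℕ} (hj : j < N) : sortKey g N j / N = g j := by
  have : (N : ℤ) ≠ 0 := by omega
  rw [sortKey, Int.add_comm, Int.add_mul_ediv_right _ _ this,
    Int.ediv_eq_zero_of_lt (by omega) (by omega), zero_add]

lemma sortKey_mod {j : ℕ} (hj : j < N) : sortKey g N j % N = j := by
  rw [sortKey, Int.add_comm, Int.add_mul_emod_self_right]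
  exact Int.emod_eq_of_lt (by omega) (by omega)

lemma sortKey_inj {j j' : ℕ} (hj : j < N) (hj' : j' < N)
    (h : sortKey g N j = sortKey g N j') : j = j' := by
  have h1 := sortKey_mod (g := g) hj
  rw [h, sortKey_mod hj'] at h1
  omega

variable (g N) in
/-- The set of keys. -/
def keySet : Finset ℤ := (Finset.range N).image (sortKey g N)

lemma card_keySet : (keySet g N).card = N := by
  rw [keySet, Finset.card_image_of_injOn, Finset.card_range]
  intro a ha b hb h
  exact sortKey_inj (by simpa using ha) (by simpa using hb) h

variable (g N) in
/-- The key of rank `r`. -/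
noncomputable def sorted (r : ℕ) : ℤ :=
  if h : r < N then (keySet g N).orderEmbOfFin card_keySet ⟨r, h⟩ else 0

lemma sorted_lt {r r' : ℕ} (h : r < r') (hr' : r' < N) : sorted g N r < sorted g N r' := by
  rw [sorted, sorted, dif_pos (h.trans hr'), dif_pos hr']
  exact (OrderEmbedding.lt_iff_lt _).2 h

lemma sorted_le {r r' : ℕ} (h : r ≤ r') (hr' : r' < N) : sorted g N r ≤ sorted g N r' := by
  rcases h.eq_or_lt with rfl | h
  · exact le_rfl
  · exact (sorted_lt h hr').le

lemma sorted_lt_iff {r r' : ℕ} (hr : r < N) (hr' : r' < N) :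
    sorted g N r < sorted g N r' ↔ r < r' :=
  ⟨fun h => by by_contra h'; exact absurd (sorted_le (not_lt.1 h') hr) (not_le.2 h),
    fun h => sorted_lt h hr'⟩

lemma sorted_mem {r : ℕ} (hr : r < N) : ∃ j < N, sorted g N r = sortKey g N j := by
  have := Finset.orderEmbOfFin_mem (keySet g N) card_keySet ⟨r, hr⟩
  obtain ⟨j, hj, h⟩ := Finset.mem_image.1 this
  exact ⟨j, Finset.mem_range.1 hj, by rw [sorted, dif_pos hr, ← h]⟩

lemma exists_sorted {j : ℕ} (hj : j < N) : ∃ r < N, sorted g N r = sortKey g N j := by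
  have h1 : sortKey g N j ∈ Set.range ((keySet g N).orderEmbOfFin card_keySet) := by
    rw [Finset.range_orderEmbOfFin]
    simpa [keySet] using ⟨j, hj, rfl⟩
  obtain ⟨r, hr⟩ := h1
  exact ⟨r, r.2, by rw [sorted, dif_pos r.2]; exact hr⟩

/-! ### Selection of the smallest keys above a threshold -/

variable (g N) in
/-- After the indices below `J` have been treated, the buffer `B` of size `n` holds the smallest of
their keys above `θ`, padded with `big`, and `root` is its maximum. -/
structure Selected (n : ℕ) (big θ : ℤ) (J : ℕ) (B : ℕ → ℤ) (root : ℤ) : Prop where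
  leaf : ∀ x < n, B x = big ∨ ∃ j < J, θ < sortKey g N j ∧ B x = sortKey g N j
  inj : ∀ x < n, ∀ y < n, B x = B y → B x ≠ big → x = y
  cover : ∀ j < J, θ < sortKey g N j → (∃ x < n, B x = sortKey g N j) ∨ root ≤ sortKey g N j
  le_root : ∀ x < n, B x ≤ root
  root_mem : ∃ x < n, B x = root

variable {n : ℕ} {big θ : ℤ} {J : ℕ} {B : ℕ → ℤ} {root : ℤ}

lemma selected_zero (hn : 1 ≤ n) (hB : ∀ x < n, B x = big) : Selected g N n big θ 0 B big where
  leaf x hx := Or.inl (hB x hx)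
  inj x hx y hy _ h := absurd (hB x hx) h
  cover j hj := absurd hj (by omega)
  le_root x hx := (hB x hx).le
  root_mem := ⟨0, by omega, hB 0 (by omega)⟩

lemma Selected.skip (h : Selected g N n big θ J B root)
    (hJ : sortKey g N J ≤ θ ∨ root ≤ sortKey g N J) : Selected g N n big θ (J + 1) B root where
  leaf x hx := (h.leaf x hx).imp_right fun ⟨j, hj, h'⟩ => ⟨j, by omega, h'⟩
  inj := h.inj
  cover j hj hθ := by
    rcases Nat.lt_succ_iff_lt_or_eq.1 hj with hj | rfl
    · exact h.cover j hj hθ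
    · exact Or.inr (hJ.resolve_left (by omega))
  le_root := h.le_root
  root_mem := h.root_mem

/-- The evicted leaf has the value `root`, and the new maximum is at most `root`. Hence the evicted
key and all keys dismissed before stay covered by the second alternative of `cover`. The leaves stay
distinct because the old ones carry indices below `J`. -/
lemma Selected.replace (h : Selected g N n big θ J B root) (hJN : J < N)
    (hθ : θ < sortKey g N J) (hlt : sortKey g N J < root) {x₀ : ℕ} (hx₀ : x₀ < n)
    (hx₀' : B x₀ = root) {B' : ℕ → ℤ} (hB' : ∀ x < n, B' x = if x = x₀ then sortKey g N J else B x)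
    {root' : ℤ} (hle : ∀ x < n, B' x ≤ root') (hmem : ∃ x < n, B' x = root') :
    Selected g N n big θ (J + 1) B' root' := by
  have hroot : root' ≤ root := by
    obtain ⟨x, hx, hb⟩ := hmem
    rw [← hb, hB' x hx]
    split_ifs
    · exact hlt.le
    · exact h.le_root x hx
  have hne : ∀ x < n, B x ≠ big → B x ≠ sortKey g N J := fun x hx hb heq => by
    obtain ⟨j, hj, -, hb'⟩ := (h.leaf x hx).resolve_left hb
    exact absurd (sortKey_inj hJN (hj.trans hJN) (heq.symm.trans hb')) (by omega)
  refine ⟨fun x hx => ?_, fun x hx y hy => ?_, fun j hj hθj => ?_, hle, hmem⟩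
  · rw [hB' x hx]
    split_ifs
    · exact Or.inr ⟨J, by omega, hθ, rfl⟩
    · exact (h.leaf x hx).imp_right fun ⟨j, hj, h'⟩ => ⟨j, by omega, h'⟩
  · rw [hB' x hx, hB' y hy]
    split_ifs with h1 h2 h2
    · intros; omega
    · intro heq hb
      rw [heq] at hb
      exact absurd heq.symm (hne y hy hb)
    · intro heq hb
      exact absurd heq (hne x hx hb)
    · exact h.inj x hx y hy
  · rcases Nat.lt_succ_iff_lt_or_eq.1 hj with hj | rfl
    · rcases h.cover j hj hθj with ⟨x, hx, hb⟩ | hb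
      · by_cases hxx : x = x₀
        · subst hxx
          exact Or.inr (by rw [← hb, hx₀']; exact hroot)
        · exact Or.inl ⟨x, hx, by rw [hB' x hx, if_neg hxx, hb]⟩
      · exact Or.inr (hroot.trans hb)
    · exact Or.inl ⟨x₀, hx₀, by rw [hB' x₀ hx₀, if_pos rfl]⟩

/-- A key without a leaf is at least `root`; if it is also at most `root`, it equals the value of a
maximal leaf. -/
lemma Selected.exists_leaf (h : Selected g N n big θ N B root) {j : ℕ} (hj : j < N)
    (hθ : θ < sortKey g N j) (hr : sortKey g N j ≤ root) : ∃ x < n, B x = sortKey g N j := by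
  rcases h.cover j hj hθ with h' | h'
  · exact h'
  · obtain ⟨x, hx, hb⟩ := h.root_mem
    exact ⟨x, hx, by rw [hb]; omega⟩

/-- If the threshold separates the first `a` keys from the others, the next `n` keys are selected. -/
lemma Selected.chunk (h : Selected g N n big θ N B root) (hn : 1 ≤ n) {a : ℕ} (ha : a + n ≤ N)
    (hbig : ∀ j < N, sortKey g N j < big) (hθ : ∀ r < N, θ < sorted g N r ↔ a ≤ r) :
    root = sorted g N (a + n - 1) ∧ (∀ r, a ≤ r → r < a + n → ∃ x < n, B x = sorted g N r) ∧
      ∀ x < n, ∃ r, a ≤ r ∧ r < a + n ∧ B x = sorted g N r := by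
  have hleaf : ∀ x < n, B x = big ∨ ∃ r < N, a ≤ r ∧ B x = sorted g N r := fun x hx =>
    (h.leaf x hx).imp_right fun ⟨j, hj, hθj, hb⟩ => by
      obtain ⟨r, hr, hrj⟩ := exists_sorted (g := g) hj
      exact ⟨r, hr, (hθ r hr).1 (hrj ▸ hθj), by rw [hb, hrj]⟩
  have hcov : ∀ r < N, a ≤ r → sorted g N r ≤ root → ∃ x < n, B x = sorted g N r := by
    intro r hr har hle
    obtain ⟨j, hj, hrj⟩ := sorted_mem (g := g) hr
    have := (hθ r hr).2 har
    rw [hrj] at this hle ⊢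
    exact h.exists_leaf hj this hle
  have hlast : a + n - 1 < N := by omega
  have hsb : ∀ r < N, sorted g N r < big := fun r hr => by
    obtain ⟨j, hj, hrj⟩ := sorted_mem (g := g) hr
    exact hrj ▸ hbig j hj
  have hroot : root = sorted g N (a + n - 1) := by
    rcases lt_trichotomy root (sorted g N (a + n - 1)) with hlt | heq | hgt
    · -- too few keys
      exfalso
      have hnb : ∀ x < n, B x ≠ big := fun x hx hb => by
        have := h.le_root x hx
        have := hsb _ hlast
        omega
      have : ∀ x : Fin n, ∃ r : ℕ, a ≤ r ∧ r < a + n - 1 ∧ B x = sorted g N r := fun x => by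
        obtain ⟨r, hr, har, hb⟩ := (hleaf x x.2).resolve_left (hnb x x.2)
        refine ⟨r, har, ?_, hb⟩
        rw [← sorted_lt_iff (g := g) hr hlast, ← hb]
        exact (h.le_root x x.2).trans_lt hlt
      choose f hf1 hf2 hf3 using this
      -- The `n` leaves would hold distinct keys whose ranks lie among the `n - 1` ranks from `a` to
      -- `a + n - 2`.
      have hinj : Function.Injective fun x : Fin n => (⟨f x - a, by
          have := hf1 x; have := hf2 x; omega⟩ : Fin (n - 1)) := by
        intro x y hxy
        have hfe : f x = f y := by
          have := hf1 x; have := hf1 y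
          simp only [Fin.mk.injEq] at hxy
          omega
        exact Fin.ext (h.inj x x.2 y y.2 (by rw [hf3, hf3, hfe]) (hnb x x.2))
      have := Fintype.card_le_of_injective _ hinj
      simp only [Fintype.card_fin] at this
      omega
    · exact heq
    · -- too many keys
      exfalso
      have : ∀ i : Fin n, ∃ x < n, B x = sorted g N (a + i) := fun i =>
        hcov _ (by omega) (by omega) ((sorted_le (by omega) hlast).trans hgt.le)
      choose f hf1 hf2 using this
      have hlt' : ∀ i : Fin n, sorted g N (a + i) < root := fun i =>
        (sorted_le (by omega) hlast).trans_lt hgt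
      obtain ⟨x₀, hx₀, hb₀⟩ := h.root_mem
      -- The `n` keys of the chunk together with the larger `root` would occupy `n + 1` different
      -- leaves; `none` stands for the leaf of `root`.
      have hinj : Function.Injective fun i : Option (Fin n) =>
          (i.elim ⟨x₀, hx₀⟩ fun i => ⟨f i, hf1 i⟩ : Fin n) := by
        have hfi : ∀ i j : Fin n, f i = f j → i = j := fun i j hij => by
          have h1 := hf2 i
          rw [hij, hf2 j] at h1
          by_contra hne
          have hne' : (i : ℕ) ≠ j := fun h => hne (Fin.ext h)
          rcases Nat.lt_or_gt_of_ne hne' with h2 | h2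
          · exact absurd h1 (sorted_lt (by omega) (by omega)).ne'
          · exact absurd h1 (sorted_lt (by omega) (by omega)).ne
        have hf0 : ∀ i : Fin n, f i ≠ x₀ := fun i hi => by
          have := hf2 i
          rw [hi, hb₀] at this
          exact absurd this (hlt' i).ne'
        rintro (_ | i) (_ | j) hij
        · rfl
        · simp only [Option.elim, Fin.mk.injEq] at hij; exact absurd hij.symm (hf0 j)
        · simp only [Option.elim, Fin.mk.injEq] at hij; exact absurd hij (hf0 i)
        · simp only [Option.elim, Fin.mk.injEq] at hij; rw [hfi i j hij]
      have := Fintype.card_le_of_injective _ hinj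
      simp at this
  refine ⟨hroot, fun r har hr => hcov r (by omega) har ?_, fun x hx => ?_⟩
  · rw [hroot]; exact sorted_le (by omega) hlast
  · have hle := h.le_root x hx
    have := hsb _ hlast
    obtain ⟨r, hr, har, hb⟩ := (hleaf x hx).resolve_left (by omega)
    refine ⟨r, har, ?_, hb⟩
    rw [hb, hroot] at hle
    by_contra hcon
    exact absurd (sorted_lt (g := g) (show a + n - 1 < r by omega) hr) (not_lt.2 hle)

end Keys

/-! ### Loops with a counter -/

namespace Host

variable {W : Type} [Fintype W] [DecidableEq W] {H : Host W}
variable {Q : Type} [Fintype Q] {start : Q} {code : Q → Instr Q H.R} {Γ : Job}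

/-- The potential for `run_whileLt` is the cost of the rounds still to come and of the last
evaluation of the guard. -/
lemma run_count {a b : Expr W} {p : Prog W} (I : ℕ → (W → ℤ) → (ℕ → ℤ) → Prop) (N : ℕ)
    (cost : ℕ → ℝ≥0∞) {Ψ : (W → ℤ) → (ℕ → ℤ) → Prop}
    (hs : ∀ i ρ μ, I i ρ μ → a.Safe Γ.x ρ μ Γ.ms ∧ b.Safe Γ.x ρ μ Γ.ms)
    (hstep : ∀ i ρ μ, I i ρ μ → a.eval Γ.x ρ μ < b.eval Γ.x ρ μ → i < N ∧
      H.Run start code Γ p ρ μ (cost i) (I (i + 1)))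
    (hend : ∀ i ρ μ, I i ρ μ → ¬ a.eval Γ.x ρ μ < b.eval Γ.x ρ μ → Ψ ρ μ)
    {ρ : W → ℤ} {μ : ℕ → ℤ} (hI : I 0 ρ μ) :
    H.Run start code Γ (.whileLt a b p) ρ μ (∑ i ∈ Finset.range N,
      (((a.cost + b.cost + 1 : ℕ) : ℝ≥0∞) + cost i) + (a.cost + b.cost + 1 : ℕ)) Ψ := by
  set G : ℝ≥0∞ := ((a.cost + b.cost + 1 : ℕ) : ℝ≥0∞)
  have := run_whileLt (H := H) (start := start) (code := code) (Γ := Γ) (Ψ := Ψ) (p := p) I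
    (fun i => ∑ i ∈ Finset.Ico i N, (G + cost i) + G) hs ?_ ?_ 0 hI
  · rwa [Finset.range_eq_Ico]
  · intro i ρ μ hi hlt
    obtain ⟨hiN, hrun⟩ := hstep i ρ μ hi hlt
    refine ⟨cost i, ∑ i ∈ Finset.Ico (i + 1) N, (G + cost i) + G, ?_,
      hrun.weaken le_rfl fun _ _ h => ⟨i + 1, h, le_rfl⟩⟩
    rw [Finset.sum_eq_sum_Ico_succ_bot hiN, add_assoc (G + cost i)]
  · exact fun i ρ μ hi hlt => ⟨le_add_self, hend i ρ μ hi hlt⟩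

/-- The convention for deterministic parts is to charge a program `u` times its static length, where
`u` accounts for repetitions. A loop multiplies `u` by `N + 1` and the other constructs keep it, so
no constants have to be computed. -/
lemma run_count_mul {a b : Expr W} {p : Prog W} (I : ℕ → (W → ℤ) → (ℕ → ℤ) → Prop) (N u : ℕ)
    (hu : 1 ≤ u) {Ψ : (W → ℤ) → (ℕ → ℤ) → Prop}
    (hs : ∀ i ρ μ, I i ρ μ → a.Safe Γ.x ρ μ Γ.ms ∧ b.Safe Γ.x ρ μ Γ.ms)
    (hstep : ∀ i ρ μ, I i ρ μ → a.eval Γ.x ρ μ < b.eval Γ.x ρ μ → i < N ∧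
      H.Run start code Γ p ρ μ (u * p.len : ℕ) (I (i + 1)))
    (hend : ∀ i ρ μ, I i ρ μ → ¬ a.eval Γ.x ρ μ < b.eval Γ.x ρ μ → Ψ ρ μ)
    {ρ : W → ℤ} {μ : ℕ → ℤ} (hI : I 0 ρ μ) :
    H.Run start code Γ (.whileLt a b p) ρ μ ((N + 1) * u * (Prog.whileLt a b p).len : ℕ) Ψ := by
  refine (run_count I N (fun _ => ((u * p.len : ℕ) : ℝ≥0∞)) hs hstep hend hI).weaken ?_
    fun _ _ => id
  rw [Finset.sum_const, Finset.card_range, nsmul_eq_mul]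
  norm_cast
  rw [Prog.len]
  generalize a.cost + b.cost + 1 = G
  have h1 : G ≤ u * G := Nat.le_mul_of_pos_left _ hu
  have h2 : N * G ≤ N * (u * G) := Nat.mul_le_mul_left _ h1
  have h3 : 0 ≤ u * p.len := Nat.zero_le _
  nlinarith

lemma run_assign_len {d : W} {e : Expr W} {ρ : W → ℤ} {μ : ℕ → ℤ} {p : Prog W} (u : ℕ)
    (hu : 1 ≤ u) {Ψ : (W → ℤ) → (ℕ → ℤ) → Prop} (z : ℤ) (hz : e.eval Γ.x ρ μ = z)
    (hs : e.Safe Γ.x ρ μ Γ.ms) (hv : z.natAbs ≤ Γ.Y)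
    (hp : H.Run start code Γ p (Function.update ρ d z) μ (u * p.len : ℕ) Ψ) :
    H.Run start code Γ (.assign d e ;; p) ρ μ (u * (Prog.assign d e ;; p).len : ℕ) Ψ := by
  subst hz
  refine ((run_assign (Ψ := fun ρ' μ' => ρ' = Function.update ρ d (e.eval Γ.x ρ μ) ∧ μ' = μ)
    hs hv ⟨rfl, rfl⟩).seq (C' := (u * p.len : ℕ)) ?_).weaken ?_ fun _ _ => id
  · rintro _ _ ⟨rfl, rfl⟩
    exact hp
  · norm_cast
    change (Prog.assign d e).len + u * p.len ≤ u * ((Prog.assign d e).len + p.len)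
    rw [mul_add]
    gcongr
    exact Nat.le_mul_of_pos_left _ hu

lemma run_store_len {a e : Expr W} {ρ : W → ℤ} {μ : ℕ → ℤ} {p : Prog W} (u : ℕ)
    (hu : 1 ≤ u) {Ψ : (W → ℤ) → (ℕ → ℤ) → Prop} (i : ℕ) (z : ℤ)
    (hi : (a.eval Γ.x ρ μ).toNat = i) (hz : e.eval Γ.x ρ μ = z)
    (hsa : a.Safe Γ.x ρ μ Γ.ms) (hse : e.Safe Γ.x ρ μ Γ.ms) (hims : i < Γ.ms) (hv : z.natAbs ≤ Γ.Y)
    (hp : H.Run start code Γ p ρ (Function.update μ i z) (u * p.len : ℕ) Ψ) :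
    H.Run start code Γ (.store a e ;; p) ρ μ (u * (Prog.store a e ;; p).len : ℕ) Ψ := by
  subst hz hi
  refine ((run_store (Ψ := fun ρ' μ' => ρ' = ρ ∧ μ' = Function.update μ (a.eval Γ.x ρ μ).toNat
    (e.eval Γ.x ρ μ)) hsa hse hims hv ⟨rfl, rfl⟩).seq (C' := (u * p.len : ℕ)) ?_).weaken ?_
    fun _ _ => id
  · rintro _ _ ⟨rfl, rfl⟩
    exact hp
  · norm_cast
    change (Prog.store a e).len + u * p.len ≤ u * ((Prog.store a e).len + p.len)
    rw [mul_add]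
    gcongr
    exact Nat.le_mul_of_pos_left _ hu

lemma Run.seq_len {p p' : Prog W} {ρ : W → ℤ} {μ : ℕ → ℤ} {u : ℕ}
    {Φ Ψ : (W → ℤ) → (ℕ → ℤ) → Prop} (h : H.Run start code Γ p ρ μ (u * p.len : ℕ) Φ)
    (h' : ∀ ρ' μ', Φ ρ' μ' → H.Run start code Γ p' ρ' μ' (u * p'.len : ℕ) Ψ) :
    H.Run start code Γ (p ;; p') ρ μ (u * (p ;; p').len : ℕ) Ψ :=
  (h.seq h').weaken (by rw [Prog.len, mul_add, Nat.cast_add]) fun _ _ => id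

lemma Run.of_len_le {p : Prog W} {ρ : W → ℤ} {μ : ℕ → ℤ} {u v : ℕ}
    {Φ : (W → ℤ) → (ℕ → ℤ) → Prop} (h : H.Run start code Γ p ρ μ (u * p.len : ℕ) Φ)
    (huv : u ≤ v) : H.Run start code Γ p ρ μ (v * p.len : ℕ) Φ :=
  h.weaken (by gcongr) fun _ _ => id

lemma run_ifLt_mul {a b : Expr W} {p p' : Prog W} {ρ : W → ℤ} {μ : ℕ → ℤ} {u : ℕ} (hu : 1 ≤ u)
    {Ψ : (W → ℤ) → (ℕ → ℤ) → Prop}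
    (hsa : a.Safe Γ.x ρ μ Γ.ms) (hsb : b.Safe Γ.x ρ μ Γ.ms)
    (h : a.eval Γ.x ρ μ < b.eval Γ.x ρ μ → H.Run start code Γ p ρ μ (u * p.len : ℕ) Ψ)
    (h' : ¬ a.eval Γ.x ρ μ < b.eval Γ.x ρ μ → H.Run start code Γ p' ρ μ (u * p'.len : ℕ) Ψ) :
    H.Run start code Γ (.ifLt a b p p') ρ μ (u * (Prog.ifLt a b p p').len : ℕ) Ψ := by
  refine (run_ifLt (C := (u * p.len + u * p'.len : ℕ)) hsa hsb (fun hh => (h hh).weaken ?_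
    fun _ _ => id) fun hh => (h' hh).weaken ?_ fun _ _ => id).weaken ?_ fun _ _ => id
  · exact_mod_cast Nat.le_add_right _ _
  · exact_mod_cast Nat.le_add_left _ _
  · norm_cast
    rw [Prog.len]
    have := Nat.le_mul_of_pos_left (a.cost + b.cost + 1) hu
    linarith [mul_add u (a.cost + b.cost + 1 + p.len) p'.len, mul_add u (a.cost + b.cost + 1) p.len]

lemma run_assign_mul {d : W} {e : Expr W} {ρ : W → ℤ} {μ : ℕ → ℤ} {u : ℕ}
    (hu : 1 ≤ u) {Ψ : (W → ℤ) → (ℕ → ℤ) → Prop} (z : ℤ) (hz : e.eval Γ.x ρ μ = z)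
    (hs : e.Safe Γ.x ρ μ Γ.ms) (hv : z.natAbs ≤ Γ.Y) (hΨ : Ψ (Function.update ρ d z) μ) :
    H.Run start code Γ (.assign d e) ρ μ (u * (Prog.assign d e).len : ℕ) Ψ := by
  subst hz
  exact (run_assign hs hv hΨ).weaken (by gcongr; exact Nat.le_mul_of_pos_left _ hu) fun _ _ => id

lemma run_store_mul {a e : Expr W} {ρ : W → ℤ} {μ : ℕ → ℤ} {u : ℕ}
    (hu : 1 ≤ u) {Ψ : (W → ℤ) → (ℕ → ℤ) → Prop} (i : ℕ) (z : ℤ)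
    (hi : (a.eval Γ.x ρ μ).toNat = i) (hz : e.eval Γ.x ρ μ = z)
    (hsa : a.Safe Γ.x ρ μ Γ.ms) (hse : e.Safe Γ.x ρ μ Γ.ms) (hims : i < Γ.ms) (hv : z.natAbs ≤ Γ.Y)
    (hΨ : Ψ ρ (Function.update μ i z)) :
    H.Run start code Γ (.store a e) ρ μ (u * (Prog.store a e).len : ℕ) Ψ := by
  subst hz hi
  exact (run_store hsa hse hims hv hΨ).weaken (by gcongr; exact Nat.le_mul_of_pos_left _ hu)
    fun _ _ => id

lemma run_skip_mul {ρ : W → ℤ} {μ : ℕ → ℤ} {u : ℕ} (hu : 1 ≤ u)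
    {Ψ : (W → ℤ) → (ℕ → ℤ) → Prop} (h : Ψ ρ μ) :
    H.Run start code Γ .skip ρ μ (u * (Prog.skip : Prog W).len : ℕ) Ψ :=
  (run_skip h).weaken (by rw [Prog.len, mul_one]; exact_mod_cast hu) fun _ _ => id

end Host

/-! ### Trees of maxima -/

/-- `T` is a tree of maxima with root `1`, children `2 u` and `2 u + 1` of `u`, and the leaves
`n, …, 2 n - 1`, except that the equations at proper ancestors of `v` may fail. -/
def MaxTreeOff (n : ℕ) (T : ℕ → ℤ) (v : ℕ) : Prop :=
  ∀ u, 1 ≤ u → u < n → (∀ a, 1 ≤ a → u ≠ v / 2 ^ a) → T u = max (T (2 * u)) (T (2 * u + 1))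

/-- `T` is a tree of maxima. -/
def MaxTree (n : ℕ) (T : ℕ → ℤ) : Prop :=
  ∀ u, 1 ≤ u → u < n → T u = max (T (2 * u)) (T (2 * u + 1))

lemma MaxTree.le_root {n : ℕ} {T : ℕ → ℤ} (h : MaxTree n T) {u : ℕ} (hu : 1 ≤ u) (hun : u < 2 * n) :
    T u ≤ T 1 := by
  induction u using Nat.strong_induction_on with
  | _ u ih =>
    rcases hu.eq_or_lt with rfl | hu1
    · exact le_rfl
    · have h1 := ih (u / 2) (by omega) (by omega) (by omega)
      have h2 := h (u / 2) (by omega) (by omega)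
      have h3 : u = 2 * (u / 2) ∨ u = 2 * (u / 2) + 1 := by omega
      rcases h3 with h3 | h3
      · rw [h3]; exact ((le_max_left _ _).trans h2.ge).trans h1
      · rw [h3]; exact ((le_max_right _ _).trans h2.ge).trans h1

lemma MaxTree.exists_leaf {n : ℕ} {T : ℕ → ℤ} (h : MaxTree n T) {u : ℕ} (hu : 1 ≤ u)
    (hun : u < 2 * n) : ∃ x < n, T (n + x) = T u := by
  induction hk : 2 * n - u using Nat.strong_induction_on generalizing u with
  | _ k ih =>
    subst hk
    by_cases hlt : u < n
    · rw [h u hu hlt]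
      rcases max_choice (T (2 * u)) (T (2 * u + 1)) with hm | hm <;> rw [hm]
      · exact ih _ (by omega) (by omega) (by omega) rfl
      · exact ih _ (by omega) (by omega) (by omega) rfl
    · exact ⟨u - n, by omega, by rw [Nat.add_sub_cancel' (by omega)]⟩

lemma MaxTree.update_leaf {n : ℕ} {T : ℕ → ℤ} (h : MaxTree n T) {v : ℕ} (hv : n ≤ v) (z : ℤ) :
    MaxTreeOff n (Function.update T v z) v := by
  intro u hu hun ha
  have h1 := ha 1 le_rfl
  rw [Function.update_of_ne (by omega), Function.update_of_ne (by omega),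
    Function.update_of_ne (by omega), h u hu hun]

/-- Recomputing the node `v / 2` repairs its own equation and can damage only that of its parent,
which is a proper ancestor of `v / 2`. At `v = 1` no exception is left, as the only proper ancestor
is `0`. -/
lemma MaxTreeOff.ascend {n : ℕ} {T : ℕ → ℤ} {v : ℕ} (h : MaxTreeOff n T v) (hv : 1 < v) :
    MaxTreeOff n (Function.update T (v / 2) (max (T (2 * (v / 2))) (T (2 * (v / 2) + 1))))
      (v / 2) := by
  intro u hu hun ha
  have h1 := ha 1 le_rfl
  by_cases huv : u = v / 2
  · subst huv
    rw [Function.update_self, Function.update_of_ne (by omega), Function.update_of_ne (by omega)]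
  · rw [Function.update_of_ne huv, Function.update_of_ne (by omega),
      Function.update_of_ne (by omega)]
    refine h u hu hun fun a ha1 hua => ?_
    rcases ha1.eq_or_lt with rfl | ha2
    · exact huv (by simpa using hua)
    · refine ha (a - 1) (by omega) ?_
      rw [hua, Nat.div_div_eq_div_mul, ← pow_succ']
      congr 2
      omega

lemma MaxTreeOff.maxTree {n : ℕ} {T : ℕ → ℤ} (h : MaxTreeOff n T 1) : MaxTree n T := by
  intro u hu hun
  refine h u hu hun fun a ha => ?_
  rw [Nat.div_eq_of_lt (Nat.one_lt_two_pow (by omega))]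
  omega

/-! ### The program -/

/-- The variables of the program: the registers of the subroutine, global quantities, scratch
variables, and for each level of the nested loops the threshold of the next chunk, the least and the
largest number of the current chunk, and a counter. -/
inductive Var (R : Type) (κ : ℕ) where
  | sub (r : R)
  | n | t | m | nk | len | base | bz | big
  | j | v | key | y | root | lo | hi | th | lim | go
  | lth (i : Fin κ) | llo (i : Fin κ) | lhi (i : Fin κ) | cnt (i : Fin κ)
  deriving DecidableEq, Fintype

namespace SumProg

variable (R : Type) (κ w C : ℕ)

section
variable {R κ}

/-- A variable as an expression. -/
abbrev vr (x : Var R κ) : Expr (Var R κ) := .var x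

/-- A natural number as an expression. -/
abbrev nat (a : ℕ) : Expr (Var R κ) := .lit a

/-- `n ^ b` -/
def powE : ℕ → Expr (Var R κ)
  | 0 => nat 1
  | b + 1 => powE b * vr .n

/-- The sum over the first `b` of the `w` lists of group `i` of the entries selected by `j`. -/
def groupE (i : ℕ) : ℕ → Expr (Var R κ)
  | 0 => nat 0
  | b + 1 => groupE i b +
      .input (nat 2 + nat (i * w + b) * vr .n + (vr .j / powE b) % vr .n)

/-- The sum of the variables of the first `d` levels. -/
def levelE (f : Fin κ → Var R κ) : (d : ℕ) → d ≤ κ → Expr (Var R κ)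
  | 0, _ => nat 0
  | d + 1, h => levelE f d (by omega) + vr (f ⟨d, h⟩)

/-- The cell of the tree node `e`. -/
abbrev node (e : Expr (Var R κ)) : Expr (Var R κ) := vr .len + e
end

/-- Fill the tree with `big`. -/
def initTree : Prog (Var R κ) :=
  .assign .v (nat 1) ;;
  .whileLt (vr .v) (nat 2 * vr .n)
    (.store (node (vr .v)) (vr .big) ;; .assign .v (vr .v + nat 1))

/-- Go from the root to a maximal leaf. -/
def descend : Prog (Var R κ) :=
  .whileLt (vr .v) (vr .n)
    (.ifLt (.load (node (nat 2 * vr .v))) (.load (node (vr .v)))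
      (.assign .v (nat 2 * vr .v + nat 1)) (.assign .v (nat 2 * vr .v)))

/-- Recompute the maxima on the way to the root. -/
def ascend : Prog (Var R κ) :=
  .whileLt (nat 1) (vr .v)
    (.assign .v (vr .v / nat 2) ;;
      .ifLt (.load (node (nat 2 * vr .v))) (.load (node (nat 2 * vr .v + nat 1)))
        (.store (node (vr .v)) (.load (node (nat 2 * vr .v + nat 1))))
        (.store (node (vr .v)) (.load (node (nat 2 * vr .v)))))

/-- Replace a maximal leaf by `key`. -/
def replace : Prog (Var R κ) :=
  .assign .v (nat 1) ;; descend R κ ;; .store (node (vr .v)) (vr .key) ;; ascend R κ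

/-- Put the smallest keys above the threshold `th` of group `i` into the leaves of the tree. -/
def scan (i : ℕ) : Prog (Var R κ) :=
  .assign .j (nat 0) ;;
  .whileLt (vr .j) (vr .nk)
    (.assign .key (groupE w i w * vr .nk + vr .j) ;;
      .ifLt (vr .th) (vr .key)
        (.ifLt (vr .key) (.load (node (nat 1))) (replace R κ) .skip) .skip ;;
      .assign .j (vr .j + nat 1))

/-- Copy the numbers of the keys in the leaves to the list `i` of the instance for the subroutine,
and find the least of them. -/
def decode (i : ℕ) : Prog (Var R κ) :=
  .assign .lo (vr .hi) ;;
  .assign .j (nat 0) ;;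
  .whileLt (vr .j) (vr .n)
    (.assign .y (.load (node (vr .n + vr .j)) / vr .nk) ;;
      .store (nat 2 + nat i * vr .n + vr .j) (vr .y) ;;
      .ifLt (vr .y) (vr .lo) (.assign .lo (vr .y)) .skip ;;
      .assign .j (vr .j + nat 1))

/-- Select the next chunk of group `i`. -/
def select (i : ℕ) : Prog (Var R κ) :=
  initTree R κ ;; scan R κ w i ;;
  .assign .root (.load (node (nat 1))) ;; .assign .hi (vr .root / vr .nk) ;; decode R κ i

/-- Clear the memory of the subroutine. -/
def clearMem : Prog (Var R κ) :=
  .assign .v (nat 0) ;;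
  .whileLt (vr .v) (nat C * (vr .n + nat 1))
    (.store (vr .base + vr .v) (nat 0) ;; .assign .v (vr .v + nat 1))

/-- Clear the registers of the subroutine. -/
def clearRegs : List R → Prog (Var R κ)
  | [] => .skip
  | r :: l => .assign (.sub r) (nat 0) ;; clearRegs l

/-- Try all chunks of the last group that can contain the missing number. -/
noncomputable def inner [Fintype R] : Prog (Var R κ) :=
  -- Keys have the form `y * N + j` with `0 ≤ j < N`. So a key exceeds `th` exactly if its number
  -- `y` is at least `t - ∑ hi`, and is below `lim` exactly if `y` is at most `t - ∑ lo`.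
  .assign .th ((vr .t - levelE .lhi κ le_rfl) * vr .nk - nat 1) ;;
  .assign .lim ((vr .t - levelE .llo κ le_rfl + nat 1) * vr .nk) ;;
  .assign .go (nat 1) ;;
  .whileLt (nat 0) (vr .go)
    ((select R κ w κ ;; (clearMem R κ C ;; clearRegs R κ Finset.univ.toList ;; .call)) ;;
      .ifLt (vr .root) (vr .lim) (.assign .th (vr .root)) (.assign .go (nat 0)))

/-- Nested loops over the chunks of the groups below `d`. -/
noncomputable def nest [Fintype R] : (d : ℕ) → d ≤ κ → Prog (Var R κ)
  | 0, _ => inner R κ w C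
  | d + 1, h =>
    let i : Fin κ := ⟨d, h⟩
    -- The first threshold `-big` lies below all keys.
    .assign (.cnt i) (nat 0) ;; .assign (.lth i) (nat 0 - vr .big) ;;
    .whileLt (vr (.cnt i)) (vr .m)
      ((.assign .th (vr (.lth i)) ;; select R κ w d ;; .assign (.lth i) (vr .root) ;;
        .assign (.llo i) (vr .lo) ;; .assign (.lhi i) (vr .hi)) ;;
        nest d (by omega) ;; .assign (.cnt i) (vr (.cnt i) + nat 1))

/-- Set up the global variables and the header of the instance for the subroutine. -/
def setup : Prog (Var R κ) :=
  .assign .n (.input (nat 0)) ;; .assign .t (.input (nat 1)) ;;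
  .assign .m (powE (w - 1)) ;; .assign .nk (vr .m * vr .n) ;;
  .assign .len (nat 2 + nat (κ + 1) * vr .n) ;; .assign .base (vr .len + nat 2 * vr .n) ;;
  .assign .bz (nat 1) ;; .assign .j (nat 0) ;;
  .whileLt (vr .j) (nat 2 + nat ((κ + 1) * w) * vr .n)
    -- An integer is bounded in absolute value by its square, so a sum of squares bounds all input
    -- words without a case distinction on signs.
    (.assign .bz (vr .bz + .input (vr .j) * .input (vr .j)) ;; .assign .j (vr .j + nat 1)) ;;
  .assign .big (vr .bz * nat ((κ + 1) * w + 2) * vr .nk) ;;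
  .store (nat 0) (vr .n) ;; .store (nat 1) (vr .t)

/-- The whole program. -/
noncomputable def main [Fintype R] : Prog (Var R κ) :=
  setup R κ w ;; nest R κ w C κ le_rfl ;; .halt false

/-- The program as host of the subroutine. -/
def host (M : WordRAM) (κ D : ℕ) : Host (Var M.R κ) where
  M := M
  reg := .sub
  inj := fun _ _ h => by simpa using h
  base := .base
  len := .len
  D := D

end SumProg

/-! ### Correctness of the selection -/

namespace SumProg

/-- An instance of the problem for `(κ + 1) * w` lists of `n` numbers, and the parameter `C` of the
program. -/
structure Inst where
  κ : ℕ
  w : ℕ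
  C : ℕ
  n : ℕ
  x : List ℤ
  hw : 1 ≤ w
  hn : 1 ≤ n
  hx : x.getD 0 0 = n

namespace Inst

variable (P : Inst)

/-- The entry `p` of the input. -/
def X (p : ℕ) : ℤ := P.x.getD p 0
/-- The target. -/
def t : ℤ := P.X 1
/-- The sum of the entries of group `i` that are selected by the digits of `j`. -/
def g (i j : ℕ) : ℤ := ∑ b ∈ Finset.range P.w, P.X (2 + (i * P.w + b) * P.n + j / P.n ^ b % P.n)
/-- The number of sums in a group. -/
def N : ℕ := P.n ^ P.w
/-- The number of chunks of a group. -/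
def m : ℕ := P.n ^ (P.w - 1)
/-- The length of the instance for the subroutine. -/
def L : ℕ := 2 + (P.κ + 1) * P.n
/-- The start of the memory of the subroutine. -/
def base : ℕ := P.L + 2 * P.n
/-- The number of memory cells. -/
def ms : ℕ := P.base + P.C * (P.n + 1)
/-- The length of the input. -/
def len : ℕ := 2 + (P.κ + 1) * P.w * P.n
/-- A bound on all numbers. -/
def A : ℤ := 1 + ∑ p ∈ Finset.range P.len, P.X p * P.X p
/-- A number that is too large to be in a solution. -/
def bz : ℤ := P.A * ((P.κ + 1) * P.w + 2 : ℕ)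
/-- A bound on all keys. -/
def big : ℤ := P.bz * P.N
/-- A bound on the binary logarithm of `n`. -/
def lg : ℕ := Nat.log 2 P.n + 1

lemma N_eq : P.m * P.n = P.N := by
  rw [m, N, ← pow_succ, Nat.sub_add_cancel P.hw]

lemma one_le_m : 1 ≤ P.m := Nat.one_le_pow _ _ P.hn

lemma one_le_N : 1 ≤ P.N := Nat.one_le_pow _ _ P.hn

lemma n_le_N : P.n ≤ P.N := Nat.le_self_pow (by have := P.hw; omega) _

lemma m_le_N : P.m ≤ P.N := Nat.pow_le_pow_right P.hn (Nat.sub_le _ _)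

lemma n_lt : P.n < 2 ^ P.lg := Nat.lt_pow_succ_log_self one_lt_two _

lemma one_le_A : 1 ≤ P.A := by
  have : 0 ≤ ∑ p ∈ Finset.range P.len, P.X p * P.X p :=
    Finset.sum_nonneg fun p _ => mul_self_nonneg _
  rw [A]
  omega

lemma abs_X_le {p : ℕ} (hp : p < P.len) : |P.X p| ≤ P.A := by
  have h1 : P.X p * P.X p ≤ ∑ p ∈ Finset.range P.len, P.X p * P.X p :=
    Finset.single_le_sum (f := fun p => P.X p * P.X p) (fun p _ => mul_self_nonneg _)
      (Finset.mem_range.2 hp)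
  rw [A, abs_le]
  constructor <;> nlinarith

lemma abs_g_le {i j : ℕ} (hi : i ≤ P.κ) : |P.g i j| ≤ P.w * P.A := by
  refine (Finset.abs_sum_le_sum_abs _ _).trans ?_
  calc _ ≤ ∑ b ∈ Finset.range P.w, P.A := by
        refine Finset.sum_le_sum fun b hb => P.abs_X_le ?_
        have hb := Finset.mem_range.1 hb
        have h1 := Nat.mod_lt (j / P.n ^ b) (show P.n > 0 from P.hn)
        have h2 : i * P.w + b + 1 ≤ (P.κ + 1) * P.w := by nlinarith
        have h3 : (i * P.w + b + 1) * P.n ≤ (P.κ + 1) * P.w * P.n := Nat.mul_le_mul_right _ h2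
        rw [add_mul] at h3
        rw [len]
        omega
    _ = _ := by simp

lemma one_le_bz : 1 ≤ P.bz := by
  have := P.one_le_A
  rw [bz]
  push_cast
  nlinarith [mul_nonneg (show (0 : ℤ) ≤ P.κ + 1 by positivity) (show (0 : ℤ) ≤ P.w by positivity)]

lemma abs_key_lt {i j : ℕ} (hi : i ≤ P.κ) (hj : j < P.N) : |sortKey (P.g i) P.N j| < P.big := by
  have h1 := abs_le.1 (P.abs_g_le (i := i) (j := j) hi)
  have hA := P.one_le_A
  have hN : (1 : ℤ) ≤ P.N := by exact_mod_cast P.one_le_N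
  have hj' : (j : ℤ) < P.N := by exact_mod_cast hj
  have hbz : P.w * P.A + 2 ≤ P.bz := by
    rw [bz]
    push_cast
    nlinarith [mul_nonneg (mul_nonneg (show (0 : ℤ) ≤ P.κ by positivity)
      (show (0 : ℤ) ≤ P.w by positivity)) (show 0 ≤ P.A by omega)]
  rw [sortKey, big, abs_lt]
  constructor <;> nlinarith

lemma N_le_big : (P.N : ℤ) ≤ P.big := by
  have := P.one_le_bz
  rw [big]
  nlinarith [P.one_le_N]

lemma big_pos : 0 < P.big := by
  have := P.N_le_big
  have := P.one_le_N
  omega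

end Inst

/-- The job of solving the instance within the given bounds. -/
structure Fits (P : Inst) (Γ : Job) : Prop where
  x_eq : Γ.x = P.x
  ms_eq : Γ.ms = P.ms
  s_le : 2 ≤ Γ.s
  big_le : P.big ≤ Γ.Y
  addr_le : P.ms + P.len ≤ Γ.Y

/-- The global variables have their values. -/
structure Env (P : Inst) {R : Type} (ρ : Var R P.κ → ℤ) : Prop where
  n_eq : ρ .n = P.n
  t_eq : ρ .t = P.t
  m_eq : ρ .m = P.m
  nk_eq : ρ .nk = P.N
  len_eq : ρ .len = P.L
  base_eq : ρ .base = P.base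
  big_eq : ρ .big = P.big

/-- The variables agree except for those in the list. -/
def SameOff {V : Type} (S : List V) (ρ ρ' : V → ℤ) : Prop := ∀ v, v ∉ S → ρ' v = ρ v

namespace SameOff

variable {V : Type} {S S' : List V} {ρ ρ' ρ'' : V → ℤ}

lemma refl (S : List V) (ρ : V → ℤ) : SameOff S ρ ρ := fun _ _ => rfl

lemma trans (h : SameOff S ρ ρ') (h' : SameOff S ρ' ρ'') : SameOff S ρ ρ'' := fun v hv =>
  (h' v hv).trans (h v hv)

lemma mono (h : SameOff S ρ ρ') (hS : ∀ v ∈ S, v ∈ S') : SameOff S' ρ ρ' := fun v hv =>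
  h v fun h' => hv (hS v h')

lemma update [DecidableEq V] (h : SameOff S ρ ρ') {d : V} (hd : d ∈ S) (z : ℤ) :
    SameOff S ρ (Function.update ρ' d z) := fun v hv => by
  rw [Function.update_of_ne (by rintro rfl; exact hv hd), h v hv]

end SameOff

lemma Env.of_sameOff {P : Inst} {R : Type} {ρ ρ' : Var R P.κ → ℤ} (h : Env P ρ)
    {S : List (Var R P.κ)} (hs : SameOff S ρ ρ')
    (hS : ∀ v ∈ S, v ∉ ([.n, .t, .m, .nk, .len, .base, .big] : List (Var R P.κ))) : Env P ρ' := by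
  have key : ∀ v ∈ ([.n, .t, .m, .nk, .len, .base, .big] : List (Var R P.κ)), ρ' v = ρ v :=
    fun v hv => hs v fun h' => hS v h' hv
  simp only [List.forall_mem_cons] at key
  obtain ⟨h1, h2, h3, h4, h5, h6, h7, -⟩ := key
  exact ⟨h1.trans h.n_eq, h2.trans h.t_eq, h3.trans h.m_eq, h4.trans h.nk_eq, h5.trans h.len_eq,
    h6.trans h.base_eq, h7.trans h.big_eq⟩

variable {M : WordRAM} {P : Inst} {D : ℕ} {Γ : Job} (hfit : Fits P Γ)
variable {Q : Type} [Fintype Q] {start : Q} {code : Q → Instr Q (host M P.κ D).R}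

/-- Triples for programs of the host. -/
abbrev RunP (M : WordRAM) (P : Inst) (D : ℕ) (Γ : Job) {Q : Type} [Fintype Q] (start : Q)
    (code : Q → Instr Q (host M P.κ D).R) (p : Prog (Var M.R P.κ)) (ρ : Var M.R P.κ → ℤ)
    (μ : ℕ → ℤ) (C : ℝ≥0∞) (Ψ : (Var M.R P.κ → ℤ) → (ℕ → ℤ) → Prop) : Prop :=
  (host M P.κ D).Run start code Γ p ρ μ C Ψ

include hfit

/-- The node `v` always carries the value of the root. After `i` rounds `2 ^ i ≤ v`, and another
round requires `v < n < 2 ^ lg`, so there are at most `lg` rounds. -/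
lemma run_descend {ρ : Var M.R P.κ → ℤ} {μ : ℕ → ℤ} (hρ : Env P ρ)
    (hT : MaxTree P.n fun u => μ (P.L + u)) (hv : ρ .v = 1) :
    RunP M P D Γ start code (descend M.R P.κ) ρ μ ((P.lg + 1) * 1 * (descend M.R P.κ).len : ℕ)
      fun ρ' μ' => μ' = μ ∧ SameOff [.v] ρ ρ' ∧
        ∃ v : ℕ, P.n ≤ v ∧ v < 2 * P.n ∧ ρ' .v = v ∧ μ (P.L + v) = μ (P.L + 1) := by
  have hms := hfit.ms_eq
  have haddr := hfit.addr_le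
  have hn := P.hn
  simp only [Inst.ms, Inst.base] at hms haddr
  refine Host.run_count_mul (fun i ρ' μ' => μ' = μ ∧ SameOff [.v] ρ ρ' ∧
    ∃ v : ℕ, 1 ≤ v ∧ 2 ^ i ≤ v ∧ v < 2 * P.n ∧ ρ' .v = v ∧ μ (P.L + v) = μ (P.L + 1))
    P.lg 1 le_rfl ?_ ?_ ?_ ⟨rfl, .refl _ _, 1, le_rfl, by simp, by omega, by simp [hv], rfl⟩
  · intro i ρ' μ' _; simp
  · rintro i ρ' _ ⟨rfl, hso, v, hv1, hvi, hvn, hρv, hmax⟩ hlt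
    have hρ' := hρ.of_sameOff hso (by simp)
    simp only [Expr.eval_var, hρv, hρ'.n_eq, Nat.cast_lt] at hlt
    have a1 : ((P.L : ℤ) + 2 * v).toNat = P.L + 2 * v := by omega
    have a2 : ((P.L : ℤ) + v).toNat = P.L + v := by omega
    refine ⟨?_, Host.run_ifLt_mul le_rfl ?_ ?_ (fun h => ?_) fun h => ?_⟩
    · exact (Nat.pow_lt_pow_iff_right one_lt_two).1 ((hvi.trans_lt hlt).trans P.n_lt)
    · simp [hρv, hρ'.len_eq, a1]; omega
    · simp [hρv, hρ'.len_eq]; omega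
    · simp [hρv, hρ'.len_eq, a1, a2] at h
      refine Host.run_assign_mul le_rfl (2 * v + 1 : ℕ) (by simp [hρv]) (by simp) (by omega)
        ⟨rfl, hso.update (by simp) _, 2 * v + 1, by omega, ?_, by omega, by simp, ?_⟩
      · rw [pow_succ]; omega
      · have := hT v hv1 hlt
        simp only at this
        rw [this] at h
        rw [← hmax, this]
        exact (max_eq_right ((lt_max_iff.1 h).resolve_left (lt_irrefl _)).le).symm
    · simp [hρv, hρ'.len_eq, a1, a2] at h
      refine Host.run_assign_mul le_rfl (2 * v : ℕ) (by simp [hρv]) (by simp) (by omega)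
        ⟨rfl, hso.update (by simp) _, 2 * v, by omega, ?_, by omega, by simp, ?_⟩
      · rw [pow_succ]; omega
      · have := hT v hv1 hlt
        simp only at this
        rw [← hmax]
        refine le_antisymm ?_ h
        rw [this]
        exact le_max_left _ _
  · rintro i ρ' _ ⟨rfl, hso, v, hv1, hvi, hvn, hρv, hmax⟩ hlt
    have hρ' := hρ.of_sameOff hso (by simp)
    simp only [Expr.eval_var, hρv, hρ'.n_eq, Nat.cast_lt, not_lt] at hlt
    exact ⟨rfl, hso, v, hlt, hvn, hρv, hmax⟩

/-- The invariant is `MaxTreeOff` at the current node, which is halved in each round. Only inner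
nodes are written, so the leaves keep their values; the clause about cell `L + 1` matters when `n =
1` and the root is itself the only leaf. -/
lemma run_ascend {ρ : Var M.R P.κ → ℤ} {μ : ℕ → ℤ} (hρ : Env P ρ) {v₀ : ℕ} (hv0 : P.n ≤ v₀)
    (hv0n : v₀ < 2 * P.n) (hT : MaxTreeOff P.n (fun u => μ (P.L + u)) v₀) (hv : ρ .v = v₀) :
    RunP M P D Γ start code (ascend M.R P.κ) ρ μ ((P.lg + 1 + 1) * 1 * (ascend M.R P.κ).len : ℕ)
      fun ρ' μ' => SameOff [.v] ρ ρ' ∧ MaxTree P.n (fun u => μ' (P.L + u)) ∧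
        ∀ i, i < P.L + 1 ∨ P.L + P.n ≤ i → (i ≠ P.L + 1 ∨ P.n = 1) → μ' i = μ i := by
  have hms := hfit.ms_eq
  have haddr := hfit.addr_le
  have hn := P.hn
  simp only [Inst.ms, Inst.base] at hms haddr
  refine Host.run_count_mul (fun i ρ' μ' => SameOff [.v] ρ ρ' ∧
    ∃ v : ℕ, 1 ≤ v ∧ v < 2 ^ (P.lg + 1 - i) ∧ v < 2 * P.n ∧ ρ' .v = v ∧
      MaxTreeOff P.n (fun u => μ' (P.L + u)) v ∧
        ∀ i, i < P.L + 1 ∨ P.L + P.n ≤ i → (i ≠ P.L + 1 ∨ P.n = 1) → μ' i = μ i)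
    (P.lg + 1) 1 le_rfl ?_ ?_ ?_ ⟨.refl _ _, v₀, by omega, ?_, hv0n, hv, hT, fun _ _ _ => rfl⟩
  · intro i ρ' μ' _; simp
  · rintro i ρ' μ' ⟨hso, v, hv1, hvi, hvn, hρv, htree, hfr⟩ hlt
    have hρ' := hρ.of_sameOff hso (by simp)
    have hlt' : 1 < v := by simpa [hρv] using hlt
    have hi : i < P.lg + 1 := by
      by_contra hcon
      rw [Nat.sub_eq_zero_of_le (by omega)] at hvi
      simp at hvi
      omega
    have hvi' : v / 2 < 2 ^ (P.lg + 1 - (i + 1)) := by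
      rw [show P.lg + 1 - i = (P.lg + 1 - (i + 1)) + 1 by omega, pow_succ] at hvi
      omega
    refine ⟨hi, Host.Run.of_bd fun hbd hbdm => ?_⟩
    refine Host.run_assign_len 1 le_rfl (v / 2 : ℕ) (by simp [hρv]) (by simp) (by omega) ?_
    have hso' := hso.update (d := .v) (by simp) ((v / 2 : ℕ) : ℤ)
    have hρ'' := hρ.of_sameOff hso' (by simp)
    set ρ₂ := Function.update ρ' Var.v ((v / 2 : ℕ) : ℤ)
    have hv2 : ρ₂ .v = (v / 2 : ℕ) := by simp [ρ₂]
    set u := v / 2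
    have hu1 : 1 ≤ u := by omega
    have hun : u < P.n := by omega
    have a1 : ((P.L : ℤ) + 2 * u).toNat = P.L + 2 * u := by omega
    have a2 : ((P.L : ℤ) + (2 * u + 1)).toNat = P.L + (2 * u + 1) := by omega
    have a3 : ((P.L : ℤ) + u).toNat = P.L + u := by omega
    have hasc : MaxTreeOff P.n (Function.update (fun u => μ' (P.L + u)) u
      (max (μ' (P.L + 2 * u)) (μ' (P.L + (2 * u + 1))))) u := htree.ascend hlt'
    have hmem : ∀ z, max (μ' (P.L + 2 * u)) (μ' (P.L + (2 * u + 1))) = z →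
        ∃ v : ℕ, 1 ≤ v ∧ v < 2 ^ (P.lg + 1 - (i + 1)) ∧ v < 2 * P.n ∧ ρ₂ .v = v ∧
          MaxTreeOff P.n (fun a => Function.update μ' (P.L + u) z (P.L + a)) v ∧
          ∀ i, i < P.L + 1 ∨ P.L + P.n ≤ i → (i ≠ P.L + 1 ∨ P.n = 1) →
            Function.update μ' (P.L + u) z i = μ i := by
      rintro z rfl
      refine ⟨u, hu1, hvi', by omega, hv2, ?_, fun i hi hi' => ?_⟩
      · convert hasc using 1
        funext a
        by_cases ha : a = u
        · rw [ha, Function.update_self, Function.update_self]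
        · rw [Function.update_of_ne (by omega), Function.update_of_ne ha]
      · rw [Function.update_of_ne (by omega), hfr i hi hi']
    refine Host.run_ifLt_mul le_rfl ?_ ?_ (fun h => ?_) fun h => ?_
    · simp [hv2, hρ''.len_eq]; omega
    · simp [hv2, hρ''.len_eq]; omega
    · simp only [Expr.eval_load, Expr.eval_add, Expr.eval_mul, Expr.eval_var, Expr.eval_lit, hv2,
        hρ''.len_eq, Nat.cast_ofNat, Nat.cast_one, a1, a2] at h
      refine Host.run_store_mul le_rfl (P.L + u) (μ' (P.L + (2 * u + 1)))
        (by simp [hv2, hρ''.len_eq, a3]) (by simp [hv2, hρ''.len_eq, a2])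
        (by simp) (by simp [hv2, hρ''.len_eq]; omega) (by omega) (hbdm _)
        ⟨hso', hmem _ (max_eq_right h.le)⟩
    · simp only [Expr.eval_load, Expr.eval_add, Expr.eval_mul, Expr.eval_var, Expr.eval_lit, hv2,
        hρ''.len_eq, Nat.cast_ofNat, Nat.cast_one, a1, a2, not_lt] at h
      refine Host.run_store_mul le_rfl (P.L + u) (μ' (P.L + 2 * u))
        (by simp [hv2, hρ''.len_eq, a3]) (by simp [hv2, hρ''.len_eq, a1])
        (by simp) (by simp [hv2, hρ''.len_eq]; omega) (by omega) (hbdm _)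
        ⟨hso', hmem _ (max_eq_left h)⟩
  · rintro i ρ' μ' ⟨hso, v, hv1, hvi, hvn, hρv, htree, hfr⟩ hlt
    have : v = 1 := by
      have : ¬ 1 < v := by simpa [hρv] using hlt
      omega
    subst this
    exact ⟨hso, htree.maxTree, hfr⟩
  · have := P.n_lt
    rw [Nat.sub_zero, pow_succ]
    omega

lemma run_replace {ρ : Var M.R P.κ → ℤ} {μ : ℕ → ℤ} (hρ : Env P ρ)
    (hT : MaxTree P.n fun u => μ (P.L + u)) :
    RunP M P D Γ start code (replace M.R P.κ) ρ μ ((P.lg + 2) * (replace M.R P.κ).len : ℕ)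
      fun ρ' μ' => SameOff [.v] ρ ρ' ∧ MaxTree P.n (fun u => μ' (P.L + u)) ∧
        (∀ i, i < P.L ∨ P.L + 2 * P.n ≤ i → μ' i = μ i) ∧
        ∃ x₀ < P.n, μ (P.L + (P.n + x₀)) = μ (P.L + 1) ∧
          ∀ x < P.n, μ' (P.L + (P.n + x)) = if x = x₀ then ρ .key else μ (P.L + (P.n + x)) := by
  have hms := hfit.ms_eq
  have haddr := hfit.addr_le
  have hn := P.hn
  simp only [Inst.ms, Inst.base] at hms haddr
  refine Host.Run.of_bd fun hbd hbdm => ?_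
  refine Host.run_assign_len _ (by omega) 1 (by simp) (by simp) (by omega) ?_
  have hso := (SameOff.refl [.v] ρ).update (d := .v) (by simp) 1
  refine Host.Run.seq_len ((run_descend hfit (hρ.of_sameOff hso (by simp)) hT (by simp)).of_len_le
    (by omega)) ?_
  rintro ρ₁ _ ⟨rfl, hso₁, v, hvn, hv2, hρv, hmax⟩
  have hso₁' := hso.trans hso₁
  have hρ₁ := hρ.of_sameOff hso₁' (by simp)
  refine Host.run_store_len _ (by omega) (P.L + v) (ρ .key) ?_ ?_ (by simp) (by simp) (by omega)
    (hbd _) ?_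
  · simp [hρv, hρ₁.len_eq]; omega
  · simpa using hso₁' .key (by simp)
  refine ((run_ascend hfit hρ₁ hvn hv2 ?_ hρv).of_len_le (by omega)).weaken le_rfl ?_
  · have := hT.update_leaf hvn (ρ .key)
    convert this using 1
    funext a
    by_cases ha : a = v
    · subst ha; simp
    · rw [Function.update_of_ne (by omega), Function.update_of_ne ha]
  · rintro ρ' μ' ⟨hso₂, hT', hfr⟩
    refine ⟨hso₁'.trans hso₂, hT', fun i hi => ?_, v - P.n, by omega, ?_, fun x hx => ?_⟩
    · rw [hfr i (by omega) (by omega), Function.update_of_ne (by omega)]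
    · rw [← hmax]; congr 2; omega
    · rw [hfr _ (by omega) (by omega)]
      split_ifs with h
      · subst h
        rw [show P.L + (P.n + (v - P.n)) = P.L + v by omega, Function.update_self]
      · rw [Function.update_of_ne (by omega)]

lemma run_initTree {ρ : Var M.R P.κ → ℤ} {μ : ℕ → ℤ} (hρ : Env P ρ) :
    RunP M P D Γ start code (initTree M.R P.κ) ρ μ
      ((2 * P.n + 1) * (initTree M.R P.κ).len : ℕ)
      fun ρ' μ' => SameOff [.v] ρ ρ' ∧ (∀ i, i < P.L ∨ P.L + 2 * P.n ≤ i → μ' i = μ i) ∧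
        ∀ u, 1 ≤ u → u < 2 * P.n → μ' (P.L + u) = P.big := by
  have hms := hfit.ms_eq
  have haddr := hfit.addr_le
  have hbig := hfit.big_le
  have hbig' := P.big_pos
  have hn := P.hn
  simp only [Inst.ms, Inst.base] at hms haddr
  refine Host.run_assign_len _ (by omega) 1 (by simp) (by simp) (by omega) ?_
  have hso := (SameOff.refl [.v] ρ).update (d := .v) (by simp) 1
  refine (Host.run_count_mul (fun i ρ' μ' => SameOff [.v] ρ ρ' ∧ ρ' .v = (i + 1 : ℕ) ∧
    i + 1 ≤ 2 * P.n ∧ (∀ i, i < P.L ∨ P.L + 2 * P.n ≤ i → μ' i = μ i) ∧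
    ∀ u, 1 ≤ u → u < i + 1 → μ' (P.L + u) = P.big) (2 * P.n) 1 le_rfl ?_ ?_ ?_
    ⟨hso, by simp, by omega, fun _ _ => rfl, by omega⟩).of_len_le (by omega)
  · intro i ρ' μ' _; simp
  · rintro i ρ' μ' ⟨hso, hv, hi, hfr, hval⟩ hlt
    have hρ' := hρ.of_sameOff hso (by simp)
    simp only [Expr.eval_var, hv, Expr.eval_mul, Expr.eval_lit, hρ'.n_eq] at hlt
    refine ⟨by omega, ?_⟩
    refine Host.run_store_len 1 le_rfl (P.L + (i + 1)) P.big (by simp [hv, hρ'.len_eq]; omega)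
      (by simp [hρ'.big_eq]) (by simp) (by simp) (by omega) (by omega) ?_
    refine Host.run_assign_mul le_rfl (i + 1 + 1 : ℕ) (by simp [hv]) (by simp) (by omega) ?_
    refine ⟨hso.update (by simp) _, by simp, by omega, fun i hi => ?_, fun u hu hui => ?_⟩
    · rw [Function.update_of_ne (by omega), hfr i hi]
    · by_cases hu' : u = i + 1
      · subst hu'; simp
      · rw [Function.update_of_ne (by omega), hval u hu (by omega)]
  · rintro i ρ' μ' ⟨hso, hv, hi, hfr, hval⟩ hlt
    have hρ' := hρ.of_sameOff hso (by simp)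
    simp only [Expr.eval_var, hv, Expr.eval_mul, Expr.eval_lit, hρ'.n_eq] at hlt
    exact ⟨hso, hfr, fun u hu hu' => hval u hu (by omega)⟩

end SumProg

/-! ### Scanning a group and decoding the selected chunk -/

namespace SumProg

variable {M : WordRAM} {P : Inst} {D : ℕ} {Γ : Job} (hfit : Fits P Γ)
variable {Q : Type} [Fintype Q] {start : Q} {code : Q → Instr Q (host M P.κ D).R}

lemma eval_powE {R : Type} {x : List ℤ} {ρ : Var R P.κ → ℤ} {μ : ℕ → ℤ} (hρ : ρ .n = P.n) (b : ℕ) :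
    (powE b : Expr (Var R P.κ)).eval x ρ μ = (P.n ^ b : ℕ) := by
  induction b with
  | zero => simp [powE]
  | succ b ih => simp [powE, ih, hρ, pow_succ]

lemma safe_powE {R : Type} {x : List ℤ} {ρ : Var R P.κ → ℤ} {μ : ℕ → ℤ} {ms : ℕ} (b : ℕ) :
    (powE b : Expr (Var R P.κ)).Safe x ρ μ ms := by
  induction b with
  | zero => simp [powE]
  | succ b ih => simp [powE, ih]

lemma eval_groupE {R : Type} {ρ : Var R P.κ → ℤ} {μ : ℕ → ℤ} (hρ : Env P ρ) {j : ℕ}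
    (hj : ρ .j = j) (i b : ℕ) : (groupE P.w i b : Expr (Var R P.κ)).eval P.x ρ μ =
      ∑ b ∈ Finset.range b, P.X (2 + (i * P.w + b) * P.n + j / P.n ^ b % P.n) := by
  induction b with
  | zero => simp [groupE]
  | succ b ih =>
    have h : (2 + ((i * P.w + b : ℕ) : ℤ) * (P.n : ℤ) + (j : ℤ) / ((P.n ^ b : ℕ) : ℤ) % (P.n : ℤ)).toNat
        = 2 + (i * P.w + b) * P.n + j / P.n ^ b % P.n := by
      rw [show (2 + ((i * P.w + b : ℕ) : ℤ) * (P.n : ℤ) + (j : ℤ) / ((P.n ^ b : ℕ) : ℤ) % (P.n : ℤ))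
        = ((2 + (i * P.w + b) * P.n + j / P.n ^ b % P.n : ℕ) : ℤ) by push_cast; rfl]
      exact Int.toNat_natCast _
    rw [groupE, Expr.eval_add, ih, Finset.sum_range_succ]
    simp only [Expr.eval_input, Expr.eval_add, Expr.eval_mul, Expr.eval_lit, Expr.eval_var,
      Expr.eval_mod, Expr.eval_div, eval_powE hρ.n_eq, hρ.n_eq, hj, Nat.cast_ofNat]
    rw [h]
    rfl

lemma safe_groupE {R : Type} {x : List ℤ} {ρ : Var R P.κ → ℤ} {μ : ℕ → ℤ} {ms : ℕ} (i b : ℕ) :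
    (groupE P.w i b : Expr (Var R P.κ)).Safe x ρ μ ms := by
  induction b with
  | zero => simp [groupE]
  | succ b ih => simp [groupE, ih, safe_powE]

include hfit

/-- The invariant joins `Selected`, for the indices treated so far, with `MaxTree`, which makes the
root the largest retained key. A key is skipped if it is at most `th` or not below the root;
otherwise it evicts a maximal leaf in logarithmic time. -/
lemma run_scan {ρ : Var M.R P.κ → ℤ} {μ : ℕ → ℤ} (hρ : Env P ρ) {i : ℕ} (hi : i ≤ P.κ)
    (hbig : ∀ u, 1 ≤ u → u < 2 * P.n → μ (P.L + u) = P.big) :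
    RunP M P D Γ start code (scan M.R P.κ P.w i) ρ μ
      ((P.N + 1) * (P.lg + 2) * (scan M.R P.κ P.w i).len : ℕ)
      fun ρ' μ' => SameOff [.j, .v, .key] ρ ρ' ∧
        (∀ a, a < P.L ∨ P.L + 2 * P.n ≤ a → μ' a = μ a) ∧
        Selected (P.g i) P.N P.n P.big (ρ .th) P.N (fun x => μ' (P.L + (P.n + x)))
          (μ' (P.L + 1)) := by
  have hms := hfit.ms_eq
  have haddr := hfit.addr_le
  have hbY := hfit.big_le
  have hNb := P.N_le_big
  have hn := P.hn
  simp only [Inst.ms, Inst.base] at hms haddr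
  have h1 : ((P.L : ℤ) + 1).toNat = P.L + 1 := by omega
  refine Host.run_assign_len _ (Nat.mul_pos (by omega) (by omega)) 0 (by simp) (by simp) (by omega) ?_
  refine Host.run_count_mul (fun J ρ' μ' => SameOff [.j, .v, .key] ρ ρ' ∧ ρ' .j = J ∧ J ≤ P.N ∧
    (∀ a, a < P.L ∨ P.L + 2 * P.n ≤ a → μ' a = μ a) ∧ MaxTree P.n (fun u => μ' (P.L + u)) ∧
    Selected (P.g i) P.N P.n P.big (ρ .th) J (fun x => μ' (P.L + (P.n + x))) (μ' (P.L + 1)))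
    P.N (P.lg + 2) (by omega) ?_ ?_ ?_
    ⟨(SameOff.refl _ ρ).update (by simp) 0, by simp, by omega, fun _ _ => rfl, ?_, ?_⟩
  · intro J ρ' μ' _; simp
  · rintro J ρ' μ' ⟨hso, hj, hJ, hfr, htree, hsel⟩ hlt
    have hρ' := hρ.of_sameOff hso (by simp)
    have hlt' : J < P.N := by simpa [hj, hρ'.nk_eq] using hlt
    refine ⟨hlt', ?_⟩
    set y := sortKey (P.g i) P.N J
    have hyb := abs_lt.1 (P.abs_key_lt hi hlt')
    refine Host.run_assign_len _ (by omega) y ?_ (by simp [safe_groupE]) (by omega) ?_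
    · simp only [Expr.eval_add, Expr.eval_mul, Expr.eval_var, hfit.x_eq, eval_groupE hρ' hj, hj,
        hρ'.nk_eq]
      rfl
    have hso₁ := hso.update (d := .key) (by simp) y
    have hρ₁ := hρ.of_sameOff hso₁ (by simp)
    have hj₁ : Function.update ρ' Var.key y .j = J := by simp [hj]
    have hy₁ : Function.update ρ' Var.key y .key = y := by simp
    have hth : Function.update ρ' Var.key y .th = ρ .th := hso₁ .th (by simp)
    generalize Function.update ρ' Var.key y = ρ₁ at hso₁ hρ₁ hj₁ hy₁ hth ⊢
    refine Host.Run.seq_len (Φ := fun ρ' μ' => SameOff [.j, .v, .key] ρ ρ' ∧ ρ' .j = J ∧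
      (∀ a, a < P.L ∨ P.L + 2 * P.n ≤ a → μ' a = μ a) ∧ MaxTree P.n (fun u => μ' (P.L + u)) ∧
      Selected (P.g i) P.N P.n P.big (ρ .th) (J + 1) (fun x => μ' (P.L + (P.n + x)))
        (μ' (P.L + 1))) ?_ ?_
    · refine Host.run_ifLt_mul (by omega) (by simp) (by simp) (fun h => ?_) fun h => ?_
      · refine Host.run_ifLt_mul (by omega) (by simp) ?_ (fun h' => ?_) fun h' => ?_
        · simp [hρ₁.len_eq]; omega
        · simp [hρ₁.len_eq, h1, hy₁] at h'
          simp [hth, hy₁] at h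
          refine (run_replace hfit hρ₁ htree).weaken le_rfl ?_
          rintro ρ₂ μ₂ ⟨hso₂, htree₂, hfr₂, x₀, hx₀, hroot, hx⟩
          refine ⟨hso₁.trans (hso₂.mono (by simp)), by rw [hso₂ .j (by simp), hj₁],
            fun a ha => by rw [hfr₂ a ha, hfr a ha], htree₂, ?_⟩
          refine hsel.replace hlt' h h' hx₀ hroot (by rw [hy₁] at hx; exact hx) (fun x hx => ?_) ?_
          · exact htree₂.le_root (u := P.n + x) (by omega) (by omega)
          · exact htree₂.exists_leaf (u := 1) (by omega) (by omega)
        · simp [hρ₁.len_eq, h1, hy₁] at h'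
          exact Host.run_skip_mul (by omega) ⟨hso₁, hj₁, hfr, htree, hsel.skip (Or.inr h')⟩
      · simp [hth, hy₁] at h
        exact Host.run_skip_mul (by omega) ⟨hso₁, hj₁, hfr, htree, hsel.skip (Or.inl h)⟩
    · rintro ρ₂ μ₂ ⟨hso₂, hj₂, hfr₂, htree₂, hsel₂⟩
      exact Host.run_assign_mul (by omega) (J + 1 : ℕ) (by simp [hj₂]) (by simp) (by omega)
        ⟨hso₂.update (by simp) _, by simp, by omega, hfr₂, htree₂, hsel₂⟩
  · rintro J ρ' μ' ⟨hso, hj, hJ, hfr, htree, hsel⟩ hlt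
    have hρ' := hρ.of_sameOff hso (by simp)
    have hlt' : ¬ J < P.N := by simpa [hj, hρ'.nk_eq] using hlt
    obtain rfl : J = P.N := by omega
    exact ⟨hso, hfr, hsel⟩
  · intro u hu hun
    simp only
    rw [hbig u hu (by omega), hbig _ (by omega) (by omega), hbig _ (by omega) (by omega), max_self]
  · rw [hbig 1 le_rfl (by omega)]
    exact selected_zero hn fun x hx => hbig _ (by omega) (by omega)

/-- Division by `N` turns keys into numbers and the padding `big` into `bz`. By `hhi` the initial
value of the minimum is the number of some leaf, so the final minimum is attained. -/
lemma run_decode {ρ : Var M.R P.κ → ℤ} {μ : ℕ → ℤ} (hρ : Env P ρ) {i : ℕ} (hi : i ≤ P.κ)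
    (hhi : ∃ x < P.n, ρ .hi = μ (P.L + (P.n + x)) / P.N) :
    RunP M P D Γ start code (decode M.R P.κ i) ρ μ
      ((P.n + 1) * (decode M.R P.κ i).len : ℕ)
      fun ρ' μ' => SameOff [.lo, .j, .y] ρ ρ' ∧
        (∀ a, a < 2 + i * P.n ∨ 2 + i * P.n + P.n ≤ a → μ' a = μ a) ∧
        (∀ x < P.n, μ' (2 + i * P.n + x) = μ (P.L + (P.n + x)) / P.N) ∧
        (∀ x < P.n, ρ' .lo ≤ μ (P.L + (P.n + x)) / P.N) ∧
        ∃ x < P.n, ρ' .lo = μ (P.L + (P.n + x)) / P.N := by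
  have hms := hfit.ms_eq
  have haddr := hfit.addr_le
  have hbY := hfit.big_le
  have hn := P.hn
  simp only [Inst.ms, Inst.base] at hms haddr
  have hiL : 2 + i * P.n + P.n ≤ P.L := by
    have : (i + 1) * P.n ≤ (P.κ + 1) * P.n := Nat.mul_le_mul_right _ (by omega)
    rw [add_mul, one_mul] at this
    rw [Inst.L]
    omega
  refine Host.Run.of_bd fun hbd _ => ?_
  refine Host.run_assign_len _ (by omega) (ρ .hi) (by simp) (by simp) (hbd _) ?_
  refine Host.run_assign_len _ (by omega) 0 (by simp) (by simp) (by omega) ?_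
  refine (Host.run_count_mul (fun J ρ' μ' => SameOff [.lo, .j, .y] ρ ρ' ∧ ρ' .j = J ∧ J ≤ P.n ∧
    (∀ a, a < 2 + i * P.n ∨ 2 + i * P.n + P.n ≤ a → μ' a = μ a) ∧
    (∀ x < J, μ' (2 + i * P.n + x) = μ (P.L + (P.n + x)) / P.N) ∧
    (∀ x < J, ρ' .lo ≤ μ (P.L + (P.n + x)) / P.N) ∧
    ∃ x < P.n, ρ' .lo = μ (P.L + (P.n + x)) / P.N)
    P.n 1 le_rfl ?_ ?_ ?_
    ⟨((SameOff.refl _ ρ).update (by simp) _).update (by simp) _, by simp, by omega, fun _ _ => rfl,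
      by simp, by simp, by simpa using hhi⟩).of_len_le (by omega)
  · intro J ρ' μ' _; simp
  · rintro J ρ' μ' ⟨hso, hj, hJ, hfr, hcell, hlo, hlo'⟩ hlt
    have hρ' := hρ.of_sameOff hso (by simp)
    have hlt' : J < P.n := by simpa [hj, hρ'.n_eq] using hlt
    refine ⟨hlt', Host.Run.of_bd fun hbd hbdm => ?_⟩
    have a1 : ((P.L : ℤ) + (P.n + J)).toNat = P.L + (P.n + J) := by omega
    have a2 : (2 + (i : ℤ) * P.n + J).toNat = 2 + i * P.n + J := by
      rw [show (2 + (i : ℤ) * P.n + J) = ((2 + i * P.n + J : ℕ) : ℤ) by push_cast; rfl]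
      exact Int.toNat_natCast _
    set y := μ (P.L + (P.n + J)) / P.N
    have hyval : μ' (P.L + (P.n + J)) / P.N = y := by rw [hfr _ (by omega)]
    have hyY : y.natAbs ≤ Γ.Y := by
      rw [← hyval]
      exact (Int.natAbs_ediv_le_natAbs _ _).trans (hbdm _)
    refine Host.run_assign_len _ (by omega) y ?_ ?_ hyY ?_
    · simp [hρ'.len_eq, hρ'.n_eq, hj, a1, hρ'.nk_eq, hyval]
    · simp [hρ'.len_eq, hρ'.n_eq, hj, a1]; omega
    have hso₁ := hso.update (d := .y) (by simp) y
    have hρ₁ := hρ.of_sameOff hso₁ (by simp)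
    have hj₁ : Function.update ρ' Var.y y .j = J := by simp [hj]
    have hlo₁ : Function.update ρ' Var.y y .lo = ρ' .lo := by simp
    have hy₁ : Function.update ρ' Var.y y .y = y := by simp
    generalize Function.update ρ' Var.y y = ρ₁ at hso₁ hρ₁ hj₁ hlo₁ hy₁ ⊢
    refine Host.run_store_len _ (by omega) (2 + i * P.n + J) y ?_ (by simp [hy₁]) (by simp) (by simp)
      (by omega) hyY ?_
    · simp [hρ₁.n_eq, hj₁, a2]
    have hend : ∀ ρ₂ : Var M.R P.κ → ℤ, SameOff [.lo, .j, .y] ρ ρ₂ → ρ₂ .j = J →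
        ρ₂ .lo = min y (ρ' .lo) → RunP M P D Γ start code (.assign .j (vr .j + nat 1)) ρ₂
        (Function.update μ' (2 + i * P.n + J) y)
        (1 * (Prog.assign .j (vr .j + nat 1) : Prog (Var M.R P.κ)).len : ℕ) fun ρ' μ' =>
          SameOff [.lo, .j, .y] ρ ρ' ∧ ρ' .j = (J + 1 : ℕ) ∧ J + 1 ≤ P.n ∧
          (∀ a, a < 2 + i * P.n ∨ 2 + i * P.n + P.n ≤ a → μ' a = μ a) ∧
          (∀ x < J + 1, μ' (2 + i * P.n + x) = μ (P.L + (P.n + x)) / P.N) ∧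
          (∀ x < J + 1, ρ' .lo ≤ μ (P.L + (P.n + x)) / P.N) ∧
          ∃ x < P.n, ρ' .lo = μ (P.L + (P.n + x)) / P.N := by
      intro ρ₂ hso₂ hj₂ hlo₂
      refine Host.run_assign_mul le_rfl (J + 1 : ℕ) (by simp [hj₂]) (by simp) (by omega)
        ⟨hso₂.update (by simp) _, by simp, by omega, fun a ha => ?_, fun x hx => ?_,
          fun x hx => ?_, ?_⟩
      · rw [Function.update_of_ne (by omega), hfr a ha]
      · by_cases hxJ : x = J
        · subst hxJ; simp [y]
        · rw [Function.update_of_ne (by omega), hcell x (by omega)]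
      · rw [Function.update_of_ne (by simp), hlo₂]
        by_cases hxJ : x = J
        · subst hxJ; exact min_le_left _ _
        · exact (min_le_right _ _).trans (hlo x (by omega))
      · rw [Function.update_of_ne (by simp), hlo₂]
        rcases min_choice y (ρ' .lo) with h | h <;> rw [h]
        · exact ⟨J, hlt', rfl⟩
        · exact hlo'
    refine Host.Run.seq_len (Φ := fun ρ₂ μ₂ => SameOff [.lo, .j, .y] ρ ρ₂ ∧ ρ₂ .j = J ∧
        ρ₂ .lo = min y (ρ' .lo) ∧ μ₂ = Function.update μ' (2 + i * P.n + J) y) ?_ ?_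
    · refine Host.run_ifLt_mul le_rfl (by simp) (by simp) (fun h => ?_) fun h => ?_
      · simp [hy₁, hlo₁] at h
        refine Host.run_assign_mul le_rfl y (by simp [hy₁]) (by simp) hyY
          ⟨hso₁.update (by simp) _, by simp [hj₁], by simp [min_eq_left h.le], rfl⟩
      · simp [hy₁, hlo₁] at h
        exact Host.run_skip_mul le_rfl ⟨hso₁, hj₁, by rw [hlo₁, min_eq_right h], rfl⟩
    · rintro ρ₂ _ ⟨hso₂, hj₂, hlo₂, rfl⟩
      exact hend ρ₂ hso₂ hj₂ hlo₂
  · rintro J ρ' μ' ⟨hso, hj, hJ, hfr, hcell, hlo, hlo'⟩ hlt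
    have hρ' := hρ.of_sameOff hso (by simp)
    have hlt' : ¬ J < P.n := by simpa [hj, hρ'.n_eq] using hlt
    obtain rfl : J = P.n := by omega
    exact ⟨hso, hfr, hcell, hlo, hlo'⟩

/-- The scratch variables of the selection. -/
abbrev scratch {R : Type} {κ : ℕ} : List (Var R κ) := [.j, .v, .key, .root, .hi, .lo, .y]

/-- One selection costs a scan of the group and writes only to the list `i` and the tree. It is
described by an abstract buffer `B`, which serves both aligned chunks and the blocks of the last
group, where padding can occur. -/
lemma run_select {ρ : Var M.R P.κ → ℤ} {μ : ℕ → ℤ} (hρ : Env P ρ) {i : ℕ} (hi : i ≤ P.κ) :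
    RunP M P D Γ start code (select M.R P.κ P.w i) ρ μ
      (2 * (P.N + 1) * (P.lg + 2) * (select M.R P.κ P.w i).len : ℕ)
      fun ρ' μ' => SameOff scratch ρ ρ' ∧
        (∀ a, a < 2 + i * P.n ∨ 2 + i * P.n + P.n ≤ a → a < P.L ∨ P.base ≤ a → μ' a = μ a) ∧
        ∃ B, Selected (P.g i) P.N P.n P.big (ρ .th) P.N B (ρ' .root) ∧
          (∀ x < P.n, μ' (2 + i * P.n + x) = B x / P.N) ∧
          (∀ x < P.n, ρ' .lo ≤ B x / P.N) ∧ (∃ x < P.n, ρ' .lo = B x / P.N) ∧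
          ρ' .hi = ρ' .root / P.N := by
  have hms := hfit.ms_eq
  have hn := P.hn
  have hnN := P.n_le_N
  simp only [Inst.ms] at hms
  rw [Inst.base] at *
  have hu1 : 1 ≤ 2 * (P.N + 1) * (P.lg + 2) := Nat.mul_pos (by omega) (by omega)
  have hu2 : 2 * P.n + 1 ≤ 2 * (P.N + 1) * (P.lg + 2) := by nlinarith
  have hu3 : (P.N + 1) * (P.lg + 2) ≤ 2 * (P.N + 1) * (P.lg + 2) := by nlinarith
  have hu4 : P.n + 1 ≤ 2 * (P.N + 1) * (P.lg + 2) := by nlinarith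
  refine Host.Run.seq_len ((run_initTree hfit hρ).of_len_le hu2) ?_
  rintro ρ₁ μ₁ ⟨hso₁, hfr₁, hbig₁⟩
  refine Host.Run.seq_len ((run_scan hfit (hρ.of_sameOff hso₁ (by simp)) hi hbig₁).of_len_le hu3) ?_
  rintro ρ₂ μ₂ ⟨hso₂, hfr₂, hsel⟩
  rw [hso₁ .th (by simp)] at hsel
  have hso₂' : SameOff scratch ρ ρ₂ := (hso₁.mono (by simp)).trans (hso₂.mono (by simp))
  have hρ₂ := hρ.of_sameOff hso₂' (by simp)
  refine Host.Run.of_bd fun _ hbdm => ?_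
  refine Host.run_assign_len _ hu1 (μ₂ (P.L + 1)) ?_ ?_ (hbdm _) ?_
  · simp only [Expr.eval_load, Expr.eval_add, Expr.eval_var, Expr.eval_lit, hρ₂.len_eq]
    congr 1
  · simp [hρ₂.len_eq]; omega
  have hso₃ := hso₂'.update (d := .root) (by simp) (μ₂ (P.L + 1))
  have hρ₃ := hρ.of_sameOff hso₃ (by simp)
  have hr₃ : Function.update ρ₂ Var.root (μ₂ (P.L + 1)) .root = μ₂ (P.L + 1) := by simp
  generalize Function.update ρ₂ Var.root (μ₂ (P.L + 1)) = ρ₃ at hso₃ hρ₃ hr₃ ⊢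
  refine Host.run_assign_len _ hu1 (μ₂ (P.L + 1) / P.N) (by simp [hr₃, hρ₃.nk_eq]) (by simp)
    ((Int.natAbs_ediv_le_natAbs _ _).trans (hbdm _)) ?_
  have hso₄ := hso₃.update (d := .hi) (by simp) (μ₂ (P.L + 1) / P.N)
  have hρ₄ := hρ.of_sameOff hso₄ (by simp)
  have hr₄ : Function.update ρ₃ Var.hi (μ₂ (P.L + 1) / P.N) .root = μ₂ (P.L + 1) := by simp [hr₃]
  have hh₄ : Function.update ρ₃ Var.hi (μ₂ (P.L + 1) / P.N) .hi = μ₂ (P.L + 1) / P.N := by simp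
  generalize Function.update ρ₃ Var.hi (μ₂ (P.L + 1) / P.N) = ρ₄ at hso₄ hρ₄ hr₄ hh₄ ⊢
  refine ((run_decode hfit hρ₄ hi ?_).of_len_le hu4).weaken le_rfl ?_
  · obtain ⟨x, hx, hb⟩ := hsel.root_mem
    exact ⟨x, hx, by rw [hh₄, ← hb]⟩
  · rintro ρ₅ μ₅ ⟨hso₅, hfr₅, hcell, hlo, hlo'⟩
    refine ⟨hso₄.trans (hso₅.mono (by simp)), fun a ha ha' => ?_, _, ?_, hcell, hlo, hlo', ?_⟩
    · rw [hfr₅ a ha, hfr₂ a ha', hfr₁ a ha']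
    · rw [hso₅ .root (by simp), hr₄]
      exact hsel
    · rw [hso₅ .hi (by simp), hso₅ .root (by simp), hr₄, hh₄]

end SumProg

/-! ### Calling the subroutine on a tuple of chunks -/

namespace SumProg

lemma eval_levelE {R : Type} {κ : ℕ} {x : List ℤ} {ρ : Var R κ → ℤ} {μ : ℕ → ℤ}
    {f : Fin κ → Var R κ} {v : ℕ → ℤ} (hv : ∀ i : Fin κ, ρ (f i) = v i) (d : ℕ) (hd : d ≤ κ) :
    (levelE f d hd).eval x ρ μ = ∑ i ∈ Finset.range d, v i := by
  induction d with
  | zero => simp [levelE]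
  | succ d ih => simp [levelE, ih, Finset.sum_range_succ, hv]

lemma safe_levelE {R : Type} {κ : ℕ} {x : List ℤ} {ρ : Var R κ → ℤ} {μ : ℕ → ℤ} {ms : ℕ}
    {f : Fin κ → Var R κ} (d : ℕ) (hd : d ≤ κ) : (levelE f d hd).Safe x ρ μ ms := by
  induction d with
  | zero => simp [levelE]
  | succ d ih => simp [levelE, ih]

lemma length_kSumInput {k n : ℕ} (S : Fin k → Fin n → ℤ) (t : ℤ) :
    (kSumInput S t).length = 2 + k * n := by
  simp [kSumInput]; omega

lemma getElem_kSumInput {k n : ℕ} {B : ℕ → ℕ → ℤ} {t : ℤ} {μ : ℕ → ℤ} (h0 : μ 0 = n) (h1 : μ 1 = t)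
    (hB : ∀ i < k, ∀ x < n, μ (2 + i * n + x) = B i x) (p : ℕ)
    (hp : p < (kSumInput (fun (i : Fin k) (x : Fin n) => B i x) t).length) :
    μ p = (kSumInput (fun (i : Fin k) (x : Fin n) => B i x) t)[p] := by
  have hl := hp
  rw [length_kSumInput] at hl
  match p with
  | 0 => simpa [kSumInput] using h0
  | 1 => simpa [kSumInput] using h1
  | p + 2 =>
    have hpn : p < k * n := by omega
    have hn : 0 < n := Nat.pos_of_ne_zero (by rintro rfl; simp at hpn)
    have := hB (p / n) (Nat.div_lt_of_lt_mul (by rwa [mul_comm])) (p % n) (Nat.mod_lt _ hn)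
    rw [show 2 + p / n * n + p % n = p + 2 by
      have := Nat.div_add_mod' p n; omega] at this
    simp [kSumInput, this, Fin.coe_divNat, Fin.coe_modNat]

/-- What is needed of the subroutine: on instances with numbers up to `bz` it is right, and runs
within the bounds. -/
def Sub (M : WordRAM) (P : Inst) (Γ : Job) (T : ℝ≥0∞) : Prop :=
  ∀ S : Fin (P.κ + 1) → Fin P.n → ℤ, (∀ i x, |S i x| ≤ P.bz) →
    (∀ c b, M.Reachable (kSumInput S P.t) c → M.Answers c b → (b = true ↔ KSum S P.t)) ∧
    M.expectedTime (kSumInput S P.t) ≤ T ∧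
    ∀ c, M.Reachable (kSumInput S P.t) c → (∀ i, M.Accesses c i → i < P.C * (P.n + 1)) ∧
      (∀ r, (c.reg r).natAbs ≤ Γ.Y) ∧ ∀ i, (c.mem i).natAbs ≤ Γ.Y

variable {M : WordRAM} {P : Inst} {D : ℕ} {Γ : Job} (hfit : Fits P Γ)
variable {Q : Type} [Fintype Q] {start : Q} {code : Q → Instr Q (host M P.κ D).R}

include hfit

lemma run_clearMem {ρ : Var M.R P.κ → ℤ} {μ : ℕ → ℤ} (hρ : Env P ρ) :
    RunP M P D Γ start code (clearMem M.R P.κ P.C) ρ μ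
      ((P.C * (P.n + 1) + 1) * (clearMem M.R P.κ P.C).len : ℕ)
      fun ρ' μ' => SameOff [.v] ρ ρ' ∧ (∀ i < P.base, μ' i = μ i) ∧
        ∀ i < P.C * (P.n + 1), μ' (P.base + i) = 0 := by
  have hms := hfit.ms_eq
  have haddr := hfit.addr_le
  simp only [Inst.ms] at hms haddr
  have hlen : 2 ≤ P.len := by rw [Inst.len]; omega
  refine Host.run_assign_len _ (by omega) 0 (by simp) (by simp) (by omega) ?_
  refine (Host.run_count_mul (fun i ρ' μ' => SameOff [.v] ρ ρ' ∧ ρ' .v = i ∧ i ≤ P.C * (P.n + 1) ∧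
    (∀ i < P.base, μ' i = μ i) ∧ ∀ u < i, μ' (P.base + u) = 0) (P.C * (P.n + 1)) 1 le_rfl
    ?_ ?_ ?_ ⟨(SameOff.refl _ ρ).update (by simp) 0, by simp, by omega, fun _ _ => rfl,
      by simp⟩).of_len_le (by omega)
  · intro i ρ' μ' _; simp
  · rintro i ρ' μ' ⟨hso, hv, hi, hfr, hval⟩ hlt
    have hρ' := hρ.of_sameOff hso (by simp)
    simp only [Expr.eval_var, hv, Expr.eval_mul, Expr.eval_add, Expr.eval_lit, hρ'.n_eq] at hlt
    have hlt' : i < P.C * (P.n + 1) := by exact_mod_cast hlt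
    refine ⟨hlt', ?_⟩
    refine Host.run_store_len 1 le_rfl (P.base + i) 0 (by simp [hv, hρ'.base_eq]; omega)
      (by simp) (by simp) (by simp) (by omega) (by omega) ?_
    refine Host.run_assign_mul le_rfl (i + 1 : ℕ) (by simp [hv]) (by simp) (by omega) ?_
    refine ⟨hso.update (by simp) _, by simp, by omega, fun i hi => ?_, fun u hu => ?_⟩
    · rw [Function.update_of_ne (by omega), hfr i hi]
    · by_cases hu' : u = i
      · subst hu'; simp
      · rw [Function.update_of_ne (by omega), hval u (by omega)]
  · rintro i ρ' μ' ⟨hso, hv, hi, hfr, hval⟩ hlt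
    have hρ' := hρ.of_sameOff hso (by simp)
    simp only [Expr.eval_var, hv, Expr.eval_mul, Expr.eval_add, Expr.eval_lit, hρ'.n_eq] at hlt
    have hlt' : ¬ i < P.C * (P.n + 1) := by exact_mod_cast hlt
    exact ⟨hso, hfr, fun u hu => hval u (by omega)⟩

/-- The last clause also admits registers that are zero beforehand, which the induction on the list
needs for those already cleared. -/
lemma run_clearRegs (l : List M.R) (ρ : Var M.R P.κ → ℤ) (μ : ℕ → ℤ) :
    RunP M P D Γ start code (clearRegs M.R P.κ l) ρ μ ((clearRegs M.R P.κ l : Prog (Var M.R P.κ)).len : ℕ)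
      fun ρ' μ' => μ' = μ ∧ (∀ v, (∀ r, v ≠ .sub r) → ρ' v = ρ v) ∧
        ∀ r, r ∈ l ∨ ρ (.sub r) = 0 → ρ' (.sub r) = 0 := by
  induction l generalizing ρ with
  | nil =>
    refine Host.Run.weaken (C := 1) (Host.run_skip (Ψ := fun ρ' μ' => ρ' = ρ ∧ μ' = μ) ⟨rfl, rfl⟩)
      (by simp [clearRegs, Prog.len]) ?_
    rintro _ _ ⟨rfl, rfl⟩
    exact ⟨rfl, fun _ _ => rfl, by simp⟩
  | cons r l ih =>
    have := Host.run_assign_len (H := host M P.κ D) (start := start) (code := code) (Γ := Γ)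
      (d := .sub r) (e := nat 0) (ρ := ρ) (μ := μ) (p := clearRegs M.R P.κ l) 1 le_rfl 0 (by simp) (by simp)
      (by simp) ((ih _).weaken (by simp) fun _ _ => id)
    rw [one_mul] at this
    refine this.weaken le_rfl ?_
    rintro ρ' μ' ⟨rfl, h1, h2⟩
    refine ⟨rfl, fun v hv => ?_, fun r' hr' => h2 r' ?_⟩
    · rw [h1 v hv, Function.update_of_ne (hv r)]
    · by_cases hrr : r' = r
      · subst hrr; simp
      · simpa [hrr] using hr'

/-- Clear the registers and the memory of the subroutine, and call it. -/
lemma run_try {T : ℝ≥0∞} (hM : Sub M P Γ T) {ρ : Var M.R P.κ → ℤ} {μ : ℕ → ℤ} (hρ : Env P ρ)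
    {B : ℕ → ℕ → ℤ} (h0 : μ 0 = P.n) (h1 : μ 1 = P.t)
    (hB : ∀ i ≤ P.κ, ∀ x < P.n, μ (2 + i * P.n + x) = B i x)
    (hBz : ∀ i ≤ P.κ, ∀ x < P.n, |B i x| ≤ P.bz)
    (hyes : ∀ f : ℕ → ℕ, (∀ i ≤ P.κ, f i < P.n) →
      ∑ i ∈ Finset.range (P.κ + 1), B i (f i) = P.t → Γ.yes) :
    RunP M P D Γ start code
      (clearMem M.R P.κ P.C ;; clearRegs M.R P.κ Finset.univ.toList ;; .call) ρ μ
      (((P.C * (P.n + 1) + 1) * (clearMem M.R P.κ P.C ;; clearRegs M.R P.κ Finset.univ.toList ;;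
        .call : Prog (Var M.R P.κ)).len : ℕ) + 3 * T)
      fun ρ' μ' => (∀ v, v ≠ .v → (∀ r, v ≠ .sub r) → ρ' v = ρ v) ∧ (∀ i < P.base, μ' i = μ i) ∧
        ∀ f : ℕ → ℕ, (∀ i ≤ P.κ, f i < P.n) → ∑ i ∈ Finset.range (P.κ + 1), B i (f i) ≠ P.t := by
  set u := P.C * (P.n + 1) + 1 with hu
  have hms := hfit.ms_eq
  simp only [Inst.ms] at hms
  refine ((run_clearMem hfit hρ).seq (C' := (u * (clearRegs M.R P.κ Finset.univ.toList :
    Prog (Var M.R P.κ)).len : ℕ) + ((u : ℕ) + 3 * T)) ?_).weaken ?_ fun _ _ => id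
  · rintro ρ₁ μ₁ ⟨hso₁, hfr₁, hz₁⟩
    refine ((run_clearRegs hfit Finset.univ.toList ρ₁ μ₁).seq (C' := 3 * T + 1) ?_).weaken ?_
      fun _ _ => id
    · rintro ρ₂ μ₂ ⟨rfl, hv₂, hs₂⟩
      have hρ₂ : ∀ v, v ≠ .v → (∀ r, v ≠ .sub r) → ρ₂ v = ρ v := fun v h h' =>
        (hv₂ v h').trans (hso₁ v (by simpa using h))
      obtain ⟨hcor, htime, hbds⟩ := hM (fun i x => B i x) fun i x =>
        hBz i (by omega) x x.2
      have hL : (kSumInput (fun (i : Fin (P.κ + 1)) (x : Fin P.n) => B i x) P.t).length = P.L := by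
        rw [length_kSumInput, Inst.L]
      have hLb : P.L ≤ P.base := by rw [Inst.base]; omega
      have hL2 : 2 ≤ P.L := by rw [Inst.L]; omega
      refine (Host.run_call (H := host M P.κ D) (base := P.base) (ms := P.C * (P.n + 1))
        (y := kSumInput (fun (i : Fin (P.κ + 1)) (x : Fin P.n) => B i x) P.t)
        hfit.s_le (by simp [host]) ?_ (by simp [host]) ?_ (by omega) (by omega)
        (fun p hp => ?_) (by omega) (fun r => hs₂ r (.inl (Finset.mem_toList.2 (Finset.mem_univ _)))) hz₁ (fun c hc => (hbds c hc).2)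
        (fun c hc i hi => (hbds c hc).1 i hi) (fun c hc ha => ?_) ?_).weaken ?_ fun _ _ => id
      · exact (hρ₂ .base (by simp) (by simp)).trans hρ.base_eq
      · rw [hL]; exact (hρ₂ .len (by simp) (by simp)).trans hρ.len_eq
      · have hp' := hp
        rw [hL] at hp'
        refine getElem_kSumInput (μ := μ₂) ?_ ?_ (fun i hi x hx => ?_) p hp
        · rw [hfr₁ 0 (by omega), h0]
        · rw [hfr₁ 1 (by omega), h1]
        · rw [hfr₁, hB i (by omega) x hx]
          have : (i + 1) * P.n ≤ (P.κ + 1) * P.n := Nat.mul_le_mul_right _ (by omega)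
          rw [add_mul, one_mul] at this
          rw [Inst.L] at hLb
          omega
      · obtain ⟨f, hf⟩ := (hcor c true hc ha).1 rfl
        refine hyes (fun i => if h : i < P.κ + 1 then f ⟨i, h⟩ else 0) (fun i hi => ?_) ?_
        · rw [dif_pos (by omega)]
          exact (f ⟨i, by omega⟩).2
        · rw [← hf, Finset.sum_range]
          exact Finset.sum_congr rfl fun i _ => by rw [dif_pos i.2]
      · intro c ρ₃ μ₃ hc ha hρ₃ hμ₃
        refine ⟨fun v h h' => ?_, fun i hi => by rw [hμ₃ i hi, hfr₁ i hi], fun f hf hsum => ?_⟩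
        · rw [hρ₃ v (by rintro ⟨r, rfl⟩; exact h' r rfl), hρ₂ v h h']
        · have := (hcor c false hc ha).2
            ⟨fun i => ⟨f i, hf i (by omega)⟩, by rw [← hsum, Finset.sum_range]⟩
          simp at this
      · gcongr
        exact htime
    · rw [add_comm (3 * T) 1]
      gcongr
      · exact Nat.le_mul_of_pos_left _ (by omega)
      · exact_mod_cast Nat.le_add_left 1 _
  · rw [← add_assoc, ← add_assoc]
    gcongr
    norm_cast
    have h : ∀ a b : ℕ, u * a + u * b + u ≤ u * (a + (b + 1)) := fun a b => by
      rw [mul_add, mul_add, mul_one, add_assoc]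
    exact h _ _

end SumProg

/-! ### Chunks, solutions, and the number of calls -/

namespace SumProg

namespace Inst

variable (P : Inst)

/-- The number of rank `r` of group `i`. -/
noncomputable def z (i r : ℕ) : ℤ := sorted (P.g i) P.N r / P.N

/-- The ranks of the chunk `c` of a group. -/
def InChunk (c r : ℕ) : Prop := c * P.n ≤ r ∧ r < c * P.n + P.n

/-- There is a solution with numbers in the chunks `c i` of the groups `i` from `d` on, except for
the last group. -/
def SolAt (d : ℕ) (c : ℕ → ℕ) : Prop :=
  ∃ r : ℕ → ℕ, (∀ i < P.κ, r i < P.N) ∧ (∀ i < P.κ, d ≤ i → P.InChunk (c i) (r i)) ∧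
    ∃ J < P.N, ∑ i ∈ Finset.range P.κ, P.z i (r i) + P.g P.κ J = P.t

/-- The chunks `c i` do not have a solution with a key of the last group up to `θ`. -/
def NoSolUpTo (c : ℕ → ℕ) (θ : ℤ) : Prop :=
  ∀ r : ℕ → ℕ, (∀ i < P.κ, P.InChunk (c i) (r i)) → ∀ J < P.N, sortKey (P.g P.κ) P.N J ≤ θ →
    ∑ i ∈ Finset.range P.κ, P.z i (r i) + P.g P.κ J ≠ P.t

/-- The least number in a chunk. -/
noncomputable def lo (i c : ℕ) : ℤ := P.z i (c * P.n)
/-- The largest number in a chunk. -/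
noncomputable def hi (i c : ℕ) : ℤ := P.z i (c * P.n + P.n - 1)

/-- The missing number `y` is strictly between the sums of the extreme numbers of the chunks. -/
def Between (c : ℕ → ℕ) (y : ℤ) : Prop :=
  ∑ i ∈ Finset.range P.κ, P.lo i (c i) < P.t - y ∧ P.t - y < ∑ i ∈ Finset.range P.κ, P.hi i (c i)

noncomputable instance (c : ℕ → ℕ) (y : ℤ) : Decidable (P.Between c y) :=
  inferInstanceAs (Decidable (_ ∧ _))

/-- The number of keys of the last group above `θ` with a number strictly between the extremes. -/
noncomputable def numAbove (c : ℕ → ℕ) (θ : ℤ) : ℕ :=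
  ((Finset.range P.N).filter fun j => θ < sortKey (P.g P.κ) P.N j ∧ P.Between c (P.g P.κ j)).card

/-- The number of keys of the last group with a number strictly between the extremes. -/
noncomputable def num (c : ℕ → ℕ) : ℕ :=
  ((Finset.range P.N).filter fun j => P.Between c (P.g P.κ j)).card

lemma numAbove_le (c : ℕ → ℕ) (θ : ℤ) : P.numAbove c θ ≤ P.num c :=
  Finset.card_le_card fun j hj => by
    simp only [Finset.mem_filter] at hj ⊢
    exact ⟨hj.1, hj.2.2⟩

lemma exists_z {i r : ℕ} (hr : r < P.N) : ∃ j < P.N, P.z i r = P.g i j := by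
  obtain ⟨j, hj, h⟩ := sorted_mem (g := P.g i) hr
  exact ⟨j, hj, by rw [z, h, sortKey_div hj]⟩

lemma z_of_key {i r j : ℕ} (hj : j < P.N) (h : sorted (P.g i) P.N r = sortKey (P.g i) P.N j) :
    P.z i r = P.g i j := by rw [z, h, sortKey_div hj]

lemma abs_z_le {i r : ℕ} (hi : i ≤ P.κ) (hr : r < P.N) : |P.z i r| ≤ P.w * P.A := by
  obtain ⟨j, -, h⟩ := P.exists_z (i := i) hr
  rw [h]
  exact P.abs_g_le hi

lemma z_mono {i r r' : ℕ} (h : r ≤ r') (hr' : r' < P.N) : P.z i r ≤ P.z i r' :=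
  Int.ediv_le_ediv (by have := P.one_le_N; omega) (sorted_le h hr')

lemma chunk_le {c : ℕ} (hc : c < P.m) : c * P.n + P.n ≤ P.N := by
  have : (c + 1) * P.n ≤ P.m * P.n := Nat.mul_le_mul_right _ hc
  rw [P.N_eq] at this
  linarith [add_mul c 1 P.n]

variable {P}

lemma InChunk.lt {c r : ℕ} (h : P.InChunk c r) (hc : c < P.m) : r < P.N :=
  h.2.trans_le (P.chunk_le hc)

lemma InChunk.lo_le {i c r : ℕ} (h : P.InChunk c r) (hc : c < P.m) : P.lo i c ≤ P.z i r :=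
  P.z_mono h.1 (h.lt hc)

lemma InChunk.le_hi {i c r : ℕ} (h : P.InChunk c r) (hc : c < P.m) : P.z i r ≤ P.hi i c :=
  P.z_mono (by have := h.2; omega) (by have := P.chunk_le hc; have := P.hn; omega)

variable (P)

lemma inChunk_lo (c : ℕ) : P.InChunk c (c * P.n) := ⟨le_rfl, by have := P.hn; omega⟩

lemma inChunk_hi (c : ℕ) : P.InChunk c (c * P.n + P.n - 1) := by
  have := P.hn
  constructor <;> omega

lemma abs_t_le : |P.t| ≤ P.A := P.abs_X_le (by rw [len]; omega)

lemma abs_sum_le {f : ℕ → ℤ} (hf : ∀ i < P.κ, |f i| ≤ P.w * P.A) :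
    |∑ i ∈ Finset.range P.κ, f i| ≤ P.κ * (P.w * P.A) := by
  refine (Finset.abs_sum_le_sum_abs _ _).trans ((Finset.sum_le_sum fun i hi =>
    hf i (Finset.mem_range.1 hi)).trans ?_)
  simp

/-- The padding number `bz` is larger than any number that can be missing, so it does not create
false solutions. The extra `1` is needed for `lim_le_big`. -/
lemma lt_bz {f : ℕ → ℤ} (hf : ∀ i < P.κ, |f i| ≤ P.w * P.A) :
    |P.t - ∑ i ∈ Finset.range P.κ, f i| + 1 ≤ P.bz := by
  have h1 := abs_le.1 (P.abs_sum_le hf)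
  have h2 := abs_le.1 P.abs_t_le
  have h3 := P.one_le_A
  have h4 : P.bz = P.A + P.κ * (P.w * P.A) + P.w * P.A + P.A := by rw [bz]; push_cast; ring
  have h5 : 0 ≤ P.w * P.A := by positivity
  rw [h4]
  have : |P.t - ∑ i ∈ Finset.range P.κ, f i| ≤ P.A + P.κ * (P.w * P.A) := by
    rw [abs_le]; constructor <;> linarith
  linarith

lemma wA_le_bz : P.w * P.A ≤ P.bz := by
  have h3 := P.one_le_A
  have h4 : P.bz = P.A + P.κ * (P.w * P.A) + P.w * P.A + P.A := by rw [bz]; push_cast; ring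
  have h5 : 0 ≤ P.κ * (P.w * P.A) := by positivity
  linarith

lemma key_lt_big {i j : ℕ} (hi : i ≤ P.κ) (hj : j < P.N) : sortKey (P.g i) P.N j < P.big :=
  (abs_lt.1 (P.abs_key_lt hi hj)).2

/-- A chunk of the last group: its numbers, those of the other chunks, and what the call of the
subroutine has shown. -/
structure Tried (c : ℕ → ℕ) (b : ℕ → ℕ → ℤ) (θ root : ℤ) (B : ℕ → ℤ) : Prop where
  lt : ∀ i < P.κ, c i < P.m
  cover : ∀ i < P.κ, ∀ r, P.InChunk (c i) r → ∃ x < P.n, b i x = P.z i r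
  last : ∀ x < P.n, b P.κ x = B x / P.N
  sel : Selected (P.g P.κ) P.N P.n P.big θ P.N B root
  no : ∀ f : ℕ → ℕ, (∀ i ≤ P.κ, f i < P.n) → ∑ i ∈ Finset.range (P.κ + 1), b i (f i) ≠ P.t

variable {P} {c : ℕ → ℕ} {b : ℕ → ℕ → ℤ} {θ root : ℤ} {B : ℕ → ℤ}

/-- The negative answer speaks about positions in the lists. Each rank of a chunk occurs at some
position, which carries the answer over to ranks. -/
lemma Tried.no_key (h : P.Tried c b θ root B) {r : ℕ → ℕ} (hr : ∀ i < P.κ, P.InChunk (c i) (r i))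
    {J : ℕ} (hJ : J < P.N) {x : ℕ} (hx : x < P.n) (hB : B x = sortKey (P.g P.κ) P.N J) :
    ∑ i ∈ Finset.range P.κ, P.z i (r i) + P.g P.κ J ≠ P.t := by
  have : ∀ i, ∃ x < P.n, i < P.κ → b i x = P.z i (r i) := fun i => by
    by_cases hi : i < P.κ
    · obtain ⟨x, hx, hb⟩ := h.cover i hi _ (hr i hi)
      exact ⟨x, hx, fun _ => hb⟩
    · exact ⟨x, hx, fun h' => absurd h' hi⟩
  choose f hf hfb using this
  have := h.no (fun i => if i < P.κ then f i else x) (fun i _ => by split_ifs <;> simp [*])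
  rw [Finset.sum_range_succ, if_neg (lt_irrefl _), h.last x hx, hB, sortKey_div hJ] at this
  rwa [Finset.sum_congr rfl fun i hi => by
    rw [if_pos (Finset.mem_range.1 hi), hfb i (Finset.mem_range.1 hi)]] at this

/-- The keys above `θ` up to `root` all sit in leaves and were tested by the call. -/
lemma Tried.noSolUpTo (h : P.Tried c b θ root B) (hθ : P.NoSolUpTo c θ) : P.NoSolUpTo c root := by
  intro r hr J hJ hkey
  rcases le_or_gt (sortKey (P.g P.κ) P.N J) θ with h' | h'
  · exact hθ r hr J hJ h'
  · obtain ⟨x, hx, hB⟩ := h.sel.exists_leaf hJ h' hkey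
    exact h.no_key hr hJ hx hB

/-- If the last group runs out of keys, the block is padded and its root is `big`. This bound makes
the test against `lim` stop the loop in that case. -/
lemma lim_le_big (hc : ∀ i < P.κ, c i < P.m) :
    (P.t - ∑ i ∈ Finset.range P.κ, P.lo i (c i) + 1) * P.N ≤ P.big := by
  have h1 := P.lt_bz (f := fun i => P.lo i (c i)) fun i hi =>
    P.abs_z_le hi.le ((P.inChunk_lo _).lt (hc i hi))
  have h2 := le_abs_self (P.t - ∑ i ∈ Finset.range P.κ, P.lo i (c i))
  rw [big]
  exact mul_le_mul_of_nonneg_right (by linarith) (by positivity)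

lemma Tried.lt_root (h : P.Tried c b θ root B) (hbig : root < P.big) : θ < root := by
  obtain ⟨x, hx, hb⟩ := h.sel.root_mem
  rcases h.sel.leaf x hx with hb' | ⟨j, -, hj, hb'⟩ <;> omega

/-- This is the amortization: if the loop goes on, the block has no padding, and its `n` distinct
keys all have numbers strictly between the bounds. They are counted above `θ`, but not above `root`.
-/
lemma Tried.numAbove_le (h : P.Tried c b θ root B)
    (hlo : (P.t - ∑ i ∈ Finset.range P.κ, P.hi i (c i)) * P.N - 1 ≤ θ)
    (hlim : root < (P.t - ∑ i ∈ Finset.range P.κ, P.lo i (c i) + 1) * P.N) :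
    P.numAbove c root + P.n ≤ P.numAbove c θ := by
  have hN : (1 : ℤ) ≤ P.N := by exact_mod_cast P.one_le_N
  have hbig : root < P.big := hlim.trans_le (lim_le_big h.lt)
  have hleaf : ∀ x, ∃ j, x < P.n → j < P.N ∧ θ < sortKey (P.g P.κ) P.N j ∧
      B x = sortKey (P.g P.κ) P.N j := fun x => by
    by_cases hx : x < P.n
    · rcases h.sel.leaf x hx with hb | ⟨j, hj, hθ, hb⟩
      · exact absurd (h.sel.le_root x hx) (by rw [hb]; omega)
      · exact ⟨j, fun _ => ⟨hj, hθ, hb⟩⟩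
    · exact ⟨0, fun h' => absurd h' hx⟩
  choose j hj using hleaf
  have hbet : ∀ x < P.n, P.Between c (P.g P.κ (j x)) := fun x hx => by
    obtain ⟨hjN, hθ, hb⟩ := hj x hx
    have hle := h.sel.le_root x hx
    rw [hb] at hle
    have hjN' : ((j x : ℕ) : ℤ) < P.N := by exact_mod_cast hjN
    have h1 : P.t - ∑ i ∈ Finset.range P.κ, P.hi i (c i) ≤ P.g P.κ (j x) := by
      rw [sortKey] at hθ
      by_contra! hcon
      nlinarith
    have h2 : P.g P.κ (j x) ≤ P.t - ∑ i ∈ Finset.range P.κ, P.lo i (c i) := by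
      rw [sortKey] at hle
      by_contra! hcon
      nlinarith [(j x).cast_nonneg (α := ℤ)]
    -- The extreme numbers of the chunks belong to the tested instance. A number equal to one of the
    -- bounds would have given a solution, so both inequalities are strict.
    have h3 := h.no_key (r := fun i => c i * P.n + P.n - 1) (fun i _ => P.inChunk_hi _) hjN hx hb
    have h4 := h.no_key (r := fun i => c i * P.n) (fun i _ => P.inChunk_lo _) hjN hx hb
    simp only [Between, hi, lo] at *
    constructor <;> omega
  set S := (Finset.range P.n).image j with hS
  have hcard : S.card = P.n := by
    rw [hS, Finset.card_image_of_injOn, Finset.card_range]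
    intro x hx y hy hxy
    simp only [Finset.coe_range, Set.mem_Iio] at hx hy
    refine h.sel.inj x hx y hy ?_ ?_
    · rw [(hj x hx).2.2, (hj y hy).2.2, hxy]
    · have := h.sel.le_root x hx; omega
  rw [← hcard, numAbove, numAbove, ← Finset.card_union_of_disjoint]
  · refine Finset.card_le_card fun y hy => ?_
    rcases Finset.mem_union.1 hy with hy | hy
    · simp only [Finset.mem_filter] at hy ⊢
      refine ⟨hy.1, lt_of_lt_of_le ?_ hy.2.1.le, hy.2.2⟩
      obtain ⟨x, hx, hb⟩ := h.sel.root_mem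
      rw [← hb, (hj x hx).2.2]
      exact (hj x hx).2.1
    · obtain ⟨x, hx, rfl⟩ := Finset.mem_image.1 hy
      have hx := Finset.mem_range.1 hx
      exact Finset.mem_filter.2 ⟨Finset.mem_range.2 (hj x hx).1, (hj x hx).2.1, hbet x hx⟩
  · rw [Finset.disjoint_right]
    intro y hy
    obtain ⟨x, hx, rfl⟩ := Finset.mem_image.1 hy
    have hx := Finset.mem_range.1 hx
    have := h.sel.le_root x hx
    rw [(hj x hx).2.2] at this
    simp only [Finset.mem_filter, not_and]
    intro _ h'
    omega

/-- In a solution within these chunks the number of the last group is at most `t - ∑ lo`, so its key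
is below `lim` and has been excluded. -/
lemma not_solAt_zero (hc : ∀ i < P.κ, c i < P.m) (h : P.NoSolUpTo c root)
    (hlim : (P.t - ∑ i ∈ Finset.range P.κ, P.lo i (c i) + 1) * P.N ≤ root) : ¬ P.SolAt 0 c := by
  rintro ⟨r, hr, hch, J, hJ, hsum⟩
  refine h r (fun i hi => hch i hi (by omega)) J hJ (le_trans ?_ hlim) hsum
  have h1 : ∑ i ∈ Finset.range P.κ, P.lo i (c i) ≤ ∑ i ∈ Finset.range P.κ, P.z i (r i) :=
    Finset.sum_le_sum fun i hi => by
      have hi := Finset.mem_range.1 hi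
      exact (hch i hi (by omega)).lo_le (hc i hi)
  have hJ' : (J : ℤ) < P.N := by exact_mod_cast hJ
  rw [sortKey]
  nlinarith

/-- In a solution within these chunks the number of the last group is at least `t - ∑ hi`, so its
key exceeds `θ`. The search may thus start at the threshold `th` of the innermost loop. -/
lemma noSolUpTo_of_le (hc : ∀ i < P.κ, c i < P.m)
    (hθ : θ ≤ (P.t - ∑ i ∈ Finset.range P.κ, P.hi i (c i)) * P.N - 1) : P.NoSolUpTo c θ := by
  intro r hr J hJ hkey hsum
  have h1 : ∑ i ∈ Finset.range P.κ, P.z i (r i) ≤ ∑ i ∈ Finset.range P.κ, P.hi i (c i) :=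
    Finset.sum_le_sum fun i hi => by
      have hi := Finset.mem_range.1 hi
      exact (hr i hi).le_hi (hc i hi)
  rw [sortKey] at hkey
  have h2 : P.t - ∑ i ∈ Finset.range P.κ, P.hi i (c i) ≤ P.g P.κ J := by linarith
  nlinarith [J.cast_nonneg (α := ℤ)]

/-- The cost of the innermost loop, up to a factor. -/
noncomputable def weight (c : ℕ → ℕ) : ℕ := P.num c / P.n + 1

/-- This permits the overhead of each loop round to be charged to the weights. -/
lemma one_le_levSum_weight (d : ℕ) (c : ℕ → ℕ) : 1 ≤ levSum P.m d P.weight c := by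
  calc 1 ≤ P.m ^ d * 1 := by rw [mul_one]; exact Nat.one_le_pow _ _ P.one_le_m
    _ = levSum P.m d (fun _ => 1) c := (levSum_const _ _ _ _).symm
    _ ≤ _ := levSum_le _ _ fun c' e' _ _ => Nat.le_add_left _ _

/-- On average, few chunks of the last group are tried. -/
lemma levSum_weight_le (hκ : 1 ≤ P.κ) (c : ℕ → ℕ) :
    levSum P.m P.κ P.weight c ≤ (P.κ + 1) * P.m ^ P.κ := by
  have hn := P.hn
  -- Double counting: the sums over tuples of chunks and over the keys of the last group are
  -- exchanged, and `levSum_between_le` is applied to each key.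
  have h1 : levSum P.m P.κ P.num c ≤ P.N * (P.κ * P.m ^ (P.κ - 1)) := by
    calc _ ≤ levSum P.m P.κ (fun c' => ∑ j ∈ Finset.range P.N,
          if ∑ i ∈ Finset.range P.κ, (if c' i < P.m then P.lo i (c' i) else 0) < P.t - P.g P.κ j ∧
            P.t - P.g P.κ j < ∑ i ∈ Finset.range P.κ, (if c' i < P.m then P.hi i (c' i) else 0)
          then 1 else 0) c := by
          refine levSum_le _ _ fun c' e' h _ => ?_
          rw [num, Finset.card_filter]
          refine (Finset.sum_congr rfl fun j _ => ?_).le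
          have key : ∀ F : ℕ → ℕ → ℤ, ∑ i ∈ Finset.range P.κ, F i (c' i) =
              ∑ i ∈ Finset.range P.κ, if e' i < P.m then F i (e' i) else 0 := fun F =>
            Finset.sum_congr rfl fun i hi => by
              obtain ⟨h1, h2⟩ := h i (Finset.mem_range.1 hi)
              rw [← h1, if_pos h2]
          rw [← key P.lo, ← key P.hi]
          exact if_congr Iff.rfl rfl rfl
      _ ≤ _ := by
          rw [levSum_sum]
          refine (Finset.sum_le_sum fun j _ => levSum_between_le
            (lo := fun i x => if x < P.m then P.lo i x else 0)
            (hi := fun i x => if x < P.m then P.hi i x else 0) ?_ P.κ _ c).trans ?_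
          · intro i x x' hx hx'
            simp only [hx', hx.trans hx', if_true]
            refine P.z_mono ?_ ((P.inChunk_lo _).lt hx')
            have : (x + 1) * P.n ≤ x' * P.n := Nat.mul_le_mul_right _ hx
            rw [add_mul, one_mul] at this
            omega
          · simp
  have h2 : P.n * levSum P.m P.κ (fun c' => P.num c' / P.n) c ≤ P.N * (P.κ * P.m ^ (P.κ - 1)) := by
    rw [← levSum_mul]
    refine (levSum_le _ _ (G := P.num) fun c' e' h h' => ?_).trans h1
    have : c' = e' := by
      funext i
      by_cases hi : i < P.κ
      · exact (h i hi).1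
      · rw [(h' i (by omega)).1, (h' i (by omega)).2]
    subst this
    exact Nat.mul_div_le _ _
  have h3 : levSum P.m P.κ (fun c' => P.num c' / P.n) c ≤ P.κ * P.m ^ P.κ := by
    refine Nat.le_of_mul_le_mul_left (h2.trans_eq ?_) hn
    -- With `N = m n`, the bound is `n` times `κ m ^ κ`, and the factor `n` cancels.
    rw [← P.N_eq]
    obtain ⟨k, hk⟩ : ∃ k, P.κ = k + 1 := ⟨P.κ - 1, by omega⟩
    rw [hk]
    simp only [Nat.add_sub_cancel, pow_succ]
    ring
  change levSum P.m P.κ (fun c' => P.num c' / P.n + 1) c ≤ _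
  rw [levSum_add, levSum_const]
  linarith [add_mul P.κ 1 (P.m ^ P.κ)]

end Inst

end SumProg

/-! ### The innermost loop and the nested loops over chunks -/

lemma Host.run_assign_seq {W : Type} [Fintype W] [DecidableEq W] {H : Host W} {Q : Type} [Fintype Q]
    {start : Q} {code : Q → Instr Q H.R} {Γ : Job} {d : W} {e : Expr W} {ρ : W → ℤ} {μ : ℕ → ℤ}
    {p : Prog W} {C : ℝ≥0∞} {Ψ : (W → ℤ) → (ℕ → ℤ) → Prop} (z : ℤ) (hz : e.eval Γ.x ρ μ = z)
    (hs : e.Safe Γ.x ρ μ Γ.ms) (hv : z.natAbs ≤ Γ.Y)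
    (hp : H.Run start code Γ p (Function.update ρ d z) μ C Ψ) :
    H.Run start code Γ (.assign d e ;; p) ρ μ ((Prog.assign d e).len + C) Ψ := by
  subst hz
  refine (Host.run_assign (Ψ := fun ρ' μ' => ρ' = Function.update ρ d (e.eval Γ.x ρ μ) ∧ μ' = μ)
    hs hv ⟨rfl, rfl⟩).seq ?_
  rintro _ _ ⟨rfl, rfl⟩
  exact hp

namespace SumProg

/-- The chunks `c i` of the groups from `d` on are selected. -/
structure Held (P : Inst) {R : Type} (d : ℕ) (c : ℕ → ℕ) (ρ : Var R P.κ → ℤ) (μ : ℕ → ℤ) : Prop where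
  env : Env P ρ
  zero : μ 0 = P.n
  one : μ 1 = P.t
  lt : ∀ i < P.κ, d ≤ i → c i < P.m
  llo : ∀ i : Fin P.κ, d ≤ i → ρ (.llo i) = P.lo i (c i)
  lhi : ∀ i : Fin P.κ, d ≤ i → ρ (.lhi i) = P.hi i (c i)
  cell : ∀ i < P.κ, d ≤ i → ∀ x < P.n, ∃ r, P.InChunk (c i) r ∧ μ (2 + i * P.n + x) = P.z i r
  cover : ∀ i < P.κ, d ≤ i → ∀ r, P.InChunk (c i) r → ∃ x < P.n, μ (2 + i * P.n + x) = P.z i r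

lemma cell_lt {P : Inst} {i j x : ℕ} (hi : i < j) (hx : x < P.n) : 2 + i * P.n + x < 2 + j * P.n := by
  have : (i + 1) * P.n ≤ j * P.n := Nat.mul_le_mul_right _ hi
  rw [add_mul, one_mul] at this
  omega

lemma Held.of_same {P : Inst} {R : Type} {d : ℕ} {c : ℕ → ℕ} {ρ ρ' : Var R P.κ → ℤ} {μ μ' : ℕ → ℤ}
    (h : Held P d c ρ μ) {S : List (Var R P.κ)} (hs : SameOff S ρ ρ')
    (hS : ∀ v ∈ S, v ∉ ([.n, .t, .m, .nk, .len, .base, .big] : List (Var R P.κ)))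
    (hS' : ∀ i, .llo i ∉ S ∧ .lhi i ∉ S) (hμ : ∀ a < 2 + P.κ * P.n, μ' a = μ a) :
    Held P d c ρ' μ' where
  env := h.env.of_sameOff hs hS
  zero := by rw [hμ 0 (by omega), h.zero]
  one := by rw [hμ 1 (by omega), h.one]
  lt := h.lt
  llo i hi := by rw [hs _ (hS' i).1, h.llo i hi]
  lhi i hi := by rw [hs _ (hS' i).2, h.lhi i hi]
  cell i hi hd x hx := by rw [hμ _ (cell_lt hi hx)]; exact h.cell i hi hd x hx
  cover i hi hd r hr := by
    obtain ⟨x, hx, hb⟩ := h.cover i hi hd r hr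
    exact ⟨x, hx, by rw [hμ _ (cell_lt hi hx), hb]⟩

/-- A bound on the costs of the steps between two calls of the subroutine, up to a factor. -/
def Inst.u (P : Inst) : ℕ := (P.C + 2) * (P.N + 1) * (P.lg + 2)

lemma Inst.select_le_u (P : Inst) : 2 * (P.N + 1) * (P.lg + 2) ≤ P.u := by
  rw [Inst.u]
  gcongr
  omega

lemma Inst.clear_le_u (P : Inst) : P.C * (P.n + 1) + 1 ≤ P.u := by
  have h1 : P.C * (P.n + 1) ≤ P.C * (P.N + 1) := Nat.mul_le_mul_left _ (by have := P.n_le_N; omega)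
  calc _ ≤ (P.C + 2) * (P.N + 1) := by linarith [add_mul P.C 2 (P.N + 1)]
    _ ≤ _ := Nat.le_mul_of_pos_right _ (by omega)

lemma Inst.one_le_u (P : Inst) : 1 ≤ P.u := le_trans (by omega) P.clear_le_u

variable {M : WordRAM} {P : Inst} {D : ℕ} {Γ : Job} (hfit : Fits P Γ)
variable {Q : Type} [Fintype Q] {start : Q} {code : Q → Instr Q (host M P.κ D).R}
variable {T : ℝ≥0∞} (hM : Sub M P Γ T) (hyes : P.SolAt P.κ (fun _ => 0) → Γ.yes)

/-- The variables that are changed by a call of the subroutine. -/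
noncomputable abbrev roundVars {R : Type} [Fintype R] {κ : ℕ} : List (Var R κ) :=
  .v :: scratch ++ Finset.univ.toList.map .sub

/-- The variables that are changed by the innermost loop. -/
noncomputable abbrev innerVars {R : Type} [Fintype R] {κ : ℕ} : List (Var R κ) :=
  [.th, .lim, .go] ++ roundVars

include hfit hM hyes

/-- If the call succeeds, the program halts, and `hyes` makes that answer right. Hence the end of
the round is reached only with a negative answer, recorded by `Tried`. -/
lemma run_round {c : ℕ → ℕ} {ρ : Var M.R P.κ → ℤ} {μ : ℕ → ℤ} (h : Held P 0 c ρ μ) :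
    RunP M P D Γ start code (select M.R P.κ P.w P.κ ;; (clearMem M.R P.κ P.C ;;
      clearRegs M.R P.κ Finset.univ.toList ;; .call)) ρ μ
      ((P.u * (select M.R P.κ P.w P.κ ;; (clearMem M.R P.κ P.C ;;
        clearRegs M.R P.κ Finset.univ.toList ;; .call)).len : ℕ) + 3 * T)
      fun ρ' μ' => SameOff roundVars ρ ρ' ∧ (∀ a < 2 + P.κ * P.n, μ' a = μ a) ∧
        ∃ b B, P.Tried c b (ρ .th) (ρ' .root) B := by
  have hbL : 2 + P.κ * P.n + P.n = P.L := by rw [Inst.L, add_mul, one_mul, add_assoc]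
  have hLb : P.L ≤ P.base := by rw [Inst.base]; omega
  have hn := P.hn
  have hN0 : (P.N : ℤ) ≠ 0 := by have := P.one_le_N; omega
  refine (((run_select hfit h.env le_rfl).of_len_le P.select_le_u).seq
    (C' := (P.u * (clearMem M.R P.κ P.C ;; clearRegs M.R P.κ Finset.univ.toList ;; .call).len : ℕ)
      + 3 * T) ?_).weaken ?_ fun _ _ => id
  · rintro ρ₁ μ₁ ⟨hso₁, hfr₁, B, hsel, hcell, -, -, -⟩
    have hfr₁' : ∀ a < 2 + P.κ * P.n, μ₁ a = μ a := fun a ha => hfr₁ a (by omega) (by omega)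
    have h₁ : Held P 0 c ρ₁ μ₁ := h.of_same hso₁ (by simp) (by simp) hfr₁'
    have hB : ∀ x < P.n, B x / P.N = P.bz ∨ ∃ J < P.N, B x / P.N = P.g P.κ J := fun x hx =>
      (hsel.leaf x hx).imp (fun hb => by rw [hb, Inst.big, Int.mul_ediv_cancel _ hN0])
        fun ⟨J, hJ, _, hb⟩ => ⟨J, hJ, by rw [hb, sortKey_div hJ]⟩
    refine ((run_try hfit hM h₁.env (B := fun i x => μ₁ (2 + i * P.n + x)) h₁.zero h₁.one
      (fun _ _ _ _ => rfl) ?_ ?_).weaken ?_ ?_)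
    · intro i hi x hx
      rcases hi.eq_or_lt with rfl | hi'
      · simp only [hcell x hx]
        rcases hB x hx with hb | ⟨J, hJ, hb⟩
        · rw [hb, abs_of_nonneg (by have := P.one_le_bz; omega)]
        · rw [hb]; exact (P.abs_g_le le_rfl).trans P.wA_le_bz
      · obtain ⟨r, hr, hb⟩ := h₁.cell i hi' (by omega) x hx
        simp only [hb]
        exact (P.abs_z_le hi (hr.lt (h.lt i hi' (by omega)))).trans P.wA_le_bz
    · intro f hf hsum
      have : ∀ i, ∃ r, i < P.κ → P.InChunk (c i) r ∧ μ₁ (2 + i * P.n + f i) = P.z i r := fun i => by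
        by_cases hi : i < P.κ
        · obtain ⟨r, hr⟩ := h₁.cell i hi (by omega) (f i) (hf i hi.le)
          exact ⟨r, fun _ => hr⟩
        · exact ⟨0, fun h' => absurd h' hi⟩
      choose r hr using this
      have hrN : ∀ i < P.κ, r i < P.N := fun i hi => (hr i hi).1.lt (h.lt i hi (by omega))
      rw [Finset.sum_range_succ, Finset.sum_congr rfl fun i hi => (hr i (Finset.mem_range.1 hi)).2,
        hcell _ (hf _ le_rfl)] at hsum
      -- A padded entry would make `bz` the missing number, which `lt_bz` forbids; otherwise the
      -- entry is a genuine sum of the last group.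
      rcases hB _ (hf _ le_rfl) with hb | ⟨J, hJ, hb⟩
      · have := P.lt_bz fun i hi => P.abs_z_le (i := i) hi.le (hrN i hi)
        rw [← hsum, hb, add_sub_cancel_left] at this
        have := le_abs_self P.bz
        omega
      · exact hyes ⟨r, hrN, fun i hi hi' => absurd hi (by omega), J, hJ, by rw [← hsum, hb]⟩
    · gcongr
      exact P.clear_le_u
    · rintro ρ₂ μ₂ ⟨hv₂, hfr₂, hno⟩
      have hso₂ : SameOff (.v :: Finset.univ.toList.map .sub) ρ₁ ρ₂ := fun v hv => by
        refine hv₂ v ?_ ?_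
        · rintro rfl; simp at hv
        · rintro r rfl; simp at hv
      refine ⟨(hso₁.mono fun v hv => ?_).trans
        (hso₂.mono fun v hv => ?_), fun a ha => ?_, fun i x => μ₁ (2 + i * P.n + x),
        B, fun i hi => h.lt i hi (by omega), fun i hi => h₁.cover i hi (by omega), hcell, ?_, hno⟩
      · simp only [List.mem_append, List.cons_append, List.mem_cons] at hv ⊢; tauto
      · simp only [List.mem_append, List.cons_append, List.mem_cons] at hv ⊢; tauto
      · rw [hfr₂ a (by omega), hfr₁' a ha]
      · rw [hso₂ .root (by simp)]
        exact hsel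
  · rw [← add_assoc]
    gcongr
    norm_cast
    exact (Nat.mul_add _ _ _).symm.le

/-- `V` pays for one round including the expected time of the call. Each round that is not the last
lowers `numAbove` by at least `n`, which leads to the factor `weight c`. -/
lemma run_inner {c : ℕ → ℕ} {ρ : Var M.R P.κ → ℤ} {μ : ℕ → ℤ} (h : Held P 0 c ρ μ) {V : ℝ≥0∞}
    (hV : ((P.u * (inner M.R P.κ P.w P.C).len : ℕ) : ℝ≥0∞) + 3 * T ≤ V) :
    RunP M P D Γ start code (inner M.R P.κ P.w P.C) ρ μ (3 * (P.weight c * V))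
      fun ρ' μ' => SameOff innerVars ρ ρ' ∧ (∀ a < 2 + P.κ * P.n, μ' a = μ a) ∧ ¬ P.SolAt 0 c := by
  have hn := P.hn
  have hbigY := hfit.big_le
  have hN : (1 : ℤ) ≤ P.N := by exact_mod_cast P.one_le_N
  have hbz := P.one_le_bz
  have hNbig := P.N_le_big
  have hc : ∀ i < P.κ, c i < P.m := fun i hi => h.lt i hi (by omega)
  have hval : ∀ y : ℤ, |y| ≤ P.bz → (y * P.N).natAbs ≤ Γ.Y := fun y hy => by
    have : |y * P.N| ≤ P.big := by
      rw [abs_mul, Nat.abs_cast, Inst.big]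
      exact mul_le_mul_of_nonneg_right hy (by omega)
    have := abs_le.1 this
    omega
  have hsafe : ∀ (f : Fin P.κ → Var M.R P.κ) (ρ : Var M.R P.κ → ℤ) (μ : ℕ → ℤ),
    (levelE f P.κ le_rfl).Safe Γ.x ρ μ Γ.ms := fun f ρ μ => safe_levelE _ _
  set θ₀ := (P.t - ∑ i ∈ Finset.range P.κ, P.hi i (c i)) * P.N - 1 with hθ₀
  set lim := (P.t - ∑ i ∈ Finset.range P.κ, P.lo i (c i) + 1) * P.N with hlim
  have hE : ∀ f : Fin P.κ → Var M.R P.κ, ∀ v : ℕ → ℤ, (∀ i, ρ (f i) = v i) →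
      ∀ ρ' : Var M.R P.κ → ℤ, (∀ i, ρ' (f i) = ρ (f i)) →
      (levelE f P.κ le_rfl).eval Γ.x ρ' μ = ∑ i ∈ Finset.range P.κ, v i :=
    fun f v hv ρ' hρ' => eval_levelE (fun i => (hρ' i).trans (hv i)) _ _
  refine (Host.run_assign_seq θ₀ ?_ (by simp [hsafe]) ?_ (Host.run_assign_seq lim ?_
    (by simp [hsafe]) ?_ (Host.run_assign_seq 1 (by simp) (by simp) (by omega)
    -- In state `some θ` the keys up to `θ` are excluded; the potential pays for `numAbove c θ / n`
    -- further full blocks, the last block, and the final guard. State `none` means that the search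
    -- is over and only the final guard is left.
    (Host.run_whileLt (ι := Option ℤ) (fun o ρ' μ' => SameOff innerVars ρ ρ' ∧
      (∀ a < 2 + P.κ * P.n, μ' a = μ a) ∧ match o with
      | none => ρ' .go = 0 ∧ ¬ P.SolAt 0 c
      | some θ => ρ' .go = 1 ∧ ρ' .th = θ ∧ ρ' .lim = lim ∧ θ₀ ≤ θ ∧ P.NoSolUpTo c θ)
    (fun o => match o with
      | none => V
      | some θ => (P.numAbove c θ / P.n + 2 : ℕ) * V) ?_ ?_ ?_ (some θ₀) ?_)))).weaken ?_
    fun _ _ => id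
  · simp only [Expr.eval_sub, Expr.eval_mul, Expr.eval_var, Expr.eval_lit, h.env.nk_eq, h.env.t_eq]
    rw [hE .lhi (fun i => P.hi i (c i)) (fun i => h.lhi i (by omega)) ρ fun _ => rfl]
    simp [hθ₀]
  · have h1 := P.lt_bz (f := fun i => P.hi i (c i)) fun i hi =>
      P.abs_z_le hi.le ((P.inChunk_hi _).lt (hc i hi))
    have h2 : |θ₀| ≤ P.big := by
      rw [hθ₀, Inst.big]
      refine (abs_sub _ _).trans ?_
      rw [abs_mul, Nat.abs_cast, abs_one]
      nlinarith
    have := abs_le.1 h2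
    omega
  · simp only [Expr.eval_sub, Expr.eval_mul, Expr.eval_var, Expr.eval_lit, Expr.eval_add]
    rw [hE .llo (fun i => P.lo i (c i)) (fun i => h.llo i (by omega)) _ fun _ => by simp]
    simp [hlim, h.env.nk_eq, h.env.t_eq]
  · refine hval _ ((abs_add_le _ _).trans ?_)
    rw [abs_one]
    exact P.lt_bz (f := fun i => P.lo i (c i)) fun i hi =>
      P.abs_z_le hi.le ((P.inChunk_lo _).lt (hc i hi))
  · intro i ρ' μ' _; simp
  · rintro (_ | θ) ρ₁ μ₁ ⟨hso₁, hfr₁, hI⟩ hlt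
    · simp [hI.1] at hlt
    · obtain ⟨hgo, hth, hlim₁, hθ, hno⟩ := hI
      have h₁ := h.of_same hso₁ (by simp) (by simp) hfr₁
      set body := (select M.R P.κ P.w P.κ ;; (clearMem M.R P.κ P.C ;;
        clearRegs M.R P.κ Finset.univ.toList ;; .call))
      set test : Prog (Var M.R P.κ) :=
        .ifLt (vr .root) (vr .lim) (.assign .th (vr .root)) (.assign .go (nat 0))
      refine ⟨(P.u * body.len : ℕ) + 3 * T + (P.u * test.len : ℕ),
        (P.numAbove c θ / P.n + 1 : ℕ) * V, ?_, ?_⟩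
      · have hle : 1 + 1 + 1 + (body.len + test.len) ≤ (inner M.R P.κ P.w P.C).len := by
          simp only [inner, Prog.len, Expr.cost, body, test]
          omega
        have h3 : ((P.u * (1 + 1 + 1 + (body.len + test.len)) : ℕ) : ℝ≥0∞) + 3 * T ≤ V :=
          le_trans (by gcongr) hV
        have h4 : (((1 + 1 + 1 : ℕ) : ℝ≥0∞) + ((P.u * body.len : ℕ) + 3 * T +
            (P.u * test.len : ℕ))) ≤ V := by
          refine le_trans ?_ h3
          rw [mul_add, mul_add P.u body.len]
          push_cast
          have : (1 : ℝ≥0∞) ≤ P.u := by exact_mod_cast P.one_le_u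
          calc _ = (1 + 1 + 1 : ℝ≥0∞) * 1 + (P.u * body.len + P.u * test.len) + 3 * T := by ring
            _ ≤ (1 + 1 + 1 : ℝ≥0∞) * P.u + (P.u * body.len + P.u * test.len) + 3 * T := by gcongr
            _ = _ := by ring
        refine (add_le_add_left h4 _).trans_eq ?_
        push_cast
        ring
      · refine (run_round hfit hM hyes h₁).seq ?_
        rintro ρ₂ μ₂ ⟨hso₂, hfr₂, b, B, htry⟩
        rw [hth] at htry
        have hlim₂ : ρ₂ .lim = lim := (hso₂ .lim (by simp)).trans hlim₁
        have hso₂' : SameOff innerVars ρ ρ₂ := hso₁.trans (hso₂.mono fun v hv =>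
          List.mem_append_right _ hv)
        have hfr₂' : ∀ a < 2 + P.κ * P.n, μ₂ a = μ a := fun a ha => by rw [hfr₂ a ha, hfr₁ a ha]
        have hY : (ρ₂ .root).natAbs ≤ Γ.Y → RunP M P D Γ start code test ρ₂ μ₂
            (P.u * test.len : ℕ) fun ρ' μ' => ∃ o : Option ℤ, (SameOff innerVars ρ ρ' ∧
            (∀ a < 2 + P.κ * P.n, μ' a = μ a) ∧ match o with
            | none => ρ' .go = 0 ∧ ¬ P.SolAt 0 c
            | some θ => ρ' .go = 1 ∧ ρ' .th = θ ∧ ρ' .lim = lim ∧ θ₀ ≤ θ ∧ P.NoSolUpTo c θ) ∧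
            (match o with
              | none => V
              | some θ => (P.numAbove c θ / P.n + 2 : ℕ) * V) ≤
              (P.numAbove c θ / P.n + 1 : ℕ) * V := fun hY => by
          refine Host.run_ifLt_mul P.one_le_u (by simp) (by simp) (fun hlt => ?_) fun hlt => ?_
          · simp only [Expr.eval_var, hlim₂] at hlt
            have hprog := htry.numAbove_le hθ hlt
            refine Host.run_assign_mul P.one_le_u (ρ₂ .root) (by simp) (by simp) hY
              ⟨some (ρ₂ .root), ⟨hso₂'.update (by simp) _, hfr₂', ?_, by simp, by simp [hlim₂], ?_,
                htry.noSolUpTo hno⟩, ?_⟩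
            · simp [hso₂ .go (by simp), hgo]
            · exact hθ.trans (htry.lt_root (hlt.trans_le (Inst.lim_le_big hc))).le
            · change ((P.numAbove c (ρ₂ .root) / P.n + 2 : ℕ) : ℝ≥0∞) * V ≤ _
              refine mul_le_mul' (Nat.cast_le.2 ?_) le_rfl
              have : (P.numAbove c (ρ₂ .root) + P.n) / P.n ≤ P.numAbove c θ / P.n :=
                Nat.div_le_div_right hprog
              rw [Nat.add_div_right _ hn] at this
              omega
          · simp only [Expr.eval_var, hlim₂, not_lt] at hlt
            refine Host.run_assign_mul P.one_le_u 0 (by simp) (by simp) (by simp)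
              ⟨none, ⟨hso₂'.update (by simp) _, hfr₂', by simp,
                Inst.not_solAt_zero hc (htry.noSolUpTo hno) hlt⟩, ?_⟩
            calc V = 1 * V := (one_mul _).symm
              _ ≤ _ := by gcongr; exact_mod_cast Nat.le_add_left 1 _
        exact Host.Run.of_bd fun hbd _ => hY (hbd _)
  · rintro (_ | θ) ρ₁ μ₁ ⟨hso₁, hfr₁, hI⟩ hlt
    · refine ⟨le_trans (le_trans ?_ le_self_add) hV, hso₁, hfr₁, hI.2⟩
      have : (nat 0 : Expr (Var M.R P.κ)).cost + (vr .go : Expr (Var M.R P.κ)).cost + 1 ≤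
          (inner M.R P.κ P.w P.C).len := by
        simp only [inner, Prog.len]
        omega
      exact_mod_cast this.trans (Nat.le_mul_of_pos_left _ P.one_le_u)
    · simp [hI.1] at hlt
  · refine ⟨(((SameOff.refl _ ρ).update (by simp) _).update (by simp) _).update (by simp) _,
      fun _ _ => rfl, by simp, by simp, by simp, le_rfl, Inst.noSolUpTo_of_le hc hθ₀.le⟩
  · set p₁ : Prog (Var M.R P.κ) :=
      .assign .th ((vr .t - levelE .lhi P.κ le_rfl) * vr .nk - nat 1)
    set p₂ : Prog (Var M.R P.κ) :=
      .assign .lim ((vr .t - levelE .llo P.κ le_rfl + nat 1) * vr .nk)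
    set p₃ : Prog (Var M.R P.κ) := .assign .go (nat 1)
    have h1 : ((p₁.len + p₂.len + p₃.len : ℕ) : ℝ≥0∞) ≤ V := by
      refine le_trans (le_trans ?_ le_self_add) hV
      have : p₁.len + p₂.len + p₃.len ≤ (inner M.R P.κ P.w P.C).len := by
        simp only [inner, Prog.len, p₁, p₂, p₃]
        omega
      exact_mod_cast this.trans (Nat.le_mul_of_pos_left _ P.one_le_u)
    have h2 : P.numAbove c θ₀ / P.n + 3 ≤ 3 * P.weight c := by
      have : P.numAbove c θ₀ / P.n ≤ P.num c / P.n := Nat.div_le_div_right (P.numAbove_le c θ₀)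
      rw [Inst.weight]
      linarith [Nat.zero_le (P.num c / P.n)]
    calc _ = ((p₁.len + p₂.len + p₃.len : ℕ) : ℝ≥0∞) + (P.numAbove c θ₀ / P.n + 2 : ℕ) * V := by
          push_cast; ring
      _ ≤ V + (P.numAbove c θ₀ / P.n + 2 : ℕ) * V := by gcongr
      _ = (P.numAbove c θ₀ / P.n + 3 : ℕ) * V := by push_cast; ring
      _ ≤ (3 * P.weight c : ℕ) * V := by gcongr
      _ = _ := by push_cast; ring

/-- The state of the loop over the chunks of group `d` in round `J`. -/
structure NestInv (P : Inst) {R : Type} {d : ℕ} (hd : d < P.κ) (c : ℕ → ℕ) (ρ₀ ρ : Var R P.κ → ℤ)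
    (μ : ℕ → ℤ) (J : ℕ) : Prop where
  held : Held P (d + 1) c ρ μ
  frame : ∀ i : Fin P.κ, d + 1 ≤ i → ρ (.cnt i) = ρ₀ (.cnt i) ∧ ρ (.lth i) = ρ₀ (.lth i)
  cnt : ρ (.cnt ⟨d, hd⟩) = J
  lth : ∀ r < P.N, ρ (.lth ⟨d, hd⟩) < sorted (P.g d) P.N r ↔ J * P.n ≤ r
  no : ∀ x < J, ¬ P.SolAt d (Function.update c d x)

/-- The threshold separates the keys of the first `J` chunks from the others, so `Selected.chunk`
yields exactly chunk `J`. Its root is the key of rank `J * n + n - 1`, hence the right threshold for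
the next round. -/
lemma run_pre {d : ℕ} (hd : d < P.κ) {c : ℕ → ℕ} {ρ₀ ρ : Var M.R P.κ → ℤ} {μ : ℕ → ℤ} {J : ℕ}
    (h : NestInv P hd c ρ₀ ρ μ J) (hJ : J < P.m) :
    RunP M P D Γ start code (.assign .th (vr (.lth ⟨d, hd⟩)) ;; select M.R P.κ P.w d ;;
        .assign (.lth ⟨d, hd⟩) (vr .root) ;;
        .assign (.llo ⟨d, hd⟩) (vr .lo) ;; .assign (.lhi ⟨d, hd⟩) (vr .hi)) ρ μ
      (P.u * (Prog.assign .th (vr (.lth ⟨d, hd⟩)) ;; select M.R P.κ P.w d ;;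
        .assign (.lth ⟨d, hd⟩) (vr .root) ;;
        .assign (.llo ⟨d, hd⟩) (vr .lo) ;; .assign (.lhi ⟨d, hd⟩) (vr .hi)).len : ℕ)
      fun ρ' μ' => Held P d (Function.update c d J) ρ' μ' ∧
        (∀ i : Fin P.κ, d + 1 ≤ i → ρ' (.cnt i) = ρ₀ (.cnt i) ∧ ρ' (.lth i) = ρ₀ (.lth i)) ∧
        ρ' (.cnt ⟨d, hd⟩) = J ∧
        ∀ r < P.N, ρ' (.lth ⟨d, hd⟩) < sorted (P.g d) P.N r ↔ (J + 1) * P.n ≤ r := by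
  have hn := P.hn
  have hu := P.one_le_u
  have hN : (1 : ℤ) ≤ P.N := by exact_mod_cast P.one_le_N
  have hbL : 2 + P.κ * P.n + P.n = P.L := by rw [Inst.L, add_mul, one_mul, add_assoc]
  have hch := P.chunk_le hJ
  refine Host.Run.of_bd fun hbd _ => ?_
  refine Host.run_assign_len _ hu (ρ (.lth ⟨d, hd⟩)) (by simp) (by simp) (hbd _) ?_
  have hso := (SameOff.refl [.th] ρ).update (d := .th) (by simp) (ρ (.lth ⟨d, hd⟩))
  have hth : Function.update ρ Var.th (ρ (.lth ⟨d, hd⟩)) .th = ρ (.lth ⟨d, hd⟩) := by simp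
  generalize Function.update ρ Var.th (ρ (.lth ⟨d, hd⟩)) = ρ₁ at hso hth ⊢
  refine Host.Run.seq_len ((run_select hfit (h.held.env.of_sameOff hso (by simp)) hd.le).of_len_le
    P.select_le_u) ?_
  rintro ρ₂ μ₂ ⟨hso₂, hfr, B, hsel, hcell, hlo, ⟨x₀, hx₀, hlo₀⟩, hhi⟩
  have hso₂' : SameOff (.th :: scratch) ρ ρ₂ := (hso.mono (by simp)).trans
    (hso₂.mono fun v hv => List.mem_cons_of_mem _ hv)
  obtain ⟨hroot, hcov, hmem⟩ := hsel.chunk (a := J * P.n) hn hch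
    (fun j hj => P.key_lt_big hd.le hj) (by rw [hth]; exact h.lth)
  have hlo' : ρ₂ .lo = P.lo d J := by
    refine le_antisymm ?_ ?_
    · obtain ⟨x, hx, hb⟩ := hcov (J * P.n) le_rfl (by omega)
      have := hlo x hx
      rwa [hb] at this
    · obtain ⟨r, hr, hr', hb⟩ := hmem x₀ hx₀
      rw [hlo₀, hb]
      exact P.z_mono hr (by omega)
  have hhi' : ρ₂ .hi = P.hi d J := by rw [hhi, hroot]; rfl
  refine Host.Run.of_bd fun hbd₂ _ => ?_
  refine Host.run_assign_len _ hu (ρ₂ .root) (by simp) (by simp) (hbd₂ _) ?_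
  refine Host.run_assign_len _ hu (ρ₂ .lo) (by simp) (by simp) (hbd₂ _) ?_
  refine Host.run_assign_mul hu (ρ₂ .hi) (by simp) (by simp) (hbd₂ _) ?_
  have hso₃ : SameOff (.lth ⟨d, hd⟩ :: .llo ⟨d, hd⟩ :: .lhi ⟨d, hd⟩ :: .th :: scratch) ρ
      (Function.update (Function.update (Function.update ρ₂ (.lth ⟨d, hd⟩) (ρ₂ .root))
        (.llo ⟨d, hd⟩) (ρ₂ .lo)) (.lhi ⟨d, hd⟩) (ρ₂ .hi)) :=
    (((hso₂'.mono fun v hv => by simp only [List.mem_cons] at hv ⊢; tauto).update (by simp)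
      _).update (by simp) _).update (by simp) _
  have e1 : Function.update (Function.update (Function.update ρ₂ (.lth ⟨d, hd⟩) (ρ₂ .root))
        (.llo ⟨d, hd⟩) (ρ₂ .lo)) (.lhi ⟨d, hd⟩) (ρ₂ .hi) (.lth ⟨d, hd⟩) = ρ₂ .root := by simp
  have e2 : Function.update (Function.update (Function.update ρ₂ (.lth ⟨d, hd⟩) (ρ₂ .root))
        (.llo ⟨d, hd⟩) (ρ₂ .lo)) (.lhi ⟨d, hd⟩) (ρ₂ .hi) (.llo ⟨d, hd⟩) = ρ₂ .lo := by simp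
  have e3 : Function.update (Function.update (Function.update ρ₂ (.lth ⟨d, hd⟩) (ρ₂ .root))
        (.llo ⟨d, hd⟩) (ρ₂ .lo)) (.lhi ⟨d, hd⟩) (ρ₂ .hi) (.lhi ⟨d, hd⟩) = ρ₂ .hi := by simp
  generalize Function.update (Function.update (Function.update ρ₂ (.lth ⟨d, hd⟩) (ρ₂ .root))
        (.llo ⟨d, hd⟩) (ρ₂ .lo)) (.lhi ⟨d, hd⟩) (ρ₂ .hi) = ρ₃ at hso₃ e1 e2 e3 ⊢
  have hne : ∀ i : Fin P.κ, d + 1 ≤ i → i ≠ ⟨d, hd⟩ := fun i hi h' => by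
    rw [h'] at hi; simp at hi
  have hcellfr : ∀ i < P.κ, d + 1 ≤ i → ∀ x < P.n, μ₂ (2 + i * P.n + x) = μ (2 + i * P.n + x) := by
    intro i hi hdi x hx
    have h1 := cell_lt (P := P) (i := i) hi hx
    have h2 : (d + 1) * P.n ≤ i * P.n := Nat.mul_le_mul_right _ hdi
    rw [add_mul, one_mul] at h2
    exact hfr _ (by omega) (by omega)
  refine ⟨⟨h.held.env.of_sameOff hso₃ (by simp), ?_, ?_, fun i hi hdi => ?_, fun i hi => ?_,
    fun i hi => ?_, fun i hi hdi x hx => ?_, fun i hi hdi r hr => ?_⟩, fun i hi => ?_, ?_, fun r hr => ?_⟩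
  · rw [hfr 0 (by omega) (by omega), h.held.zero]
  · rw [hfr 1 (by omega) (by omega), h.held.one]
  · rcases hdi.eq_or_lt with rfl | hdi
    · simpa using hJ
    · rw [Function.update_of_ne (by omega)]
      exact h.held.lt i hi hdi
  · rcases hi.eq_or_lt with hi' | hi'
    · obtain rfl : i = ⟨d, hd⟩ := Fin.ext hi'.symm
      simp [e2, hlo']
    · rw [Function.update_of_ne (by omega), hso₃ _ (by simp [hne i hi']), h.held.llo i hi']
  · rcases hi.eq_or_lt with hi' | hi'
    · obtain rfl : i = ⟨d, hd⟩ := Fin.ext hi'.symm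
      simp [e3, hhi']
    · rw [Function.update_of_ne (by omega), hso₃ _ (by simp [hne i hi']), h.held.lhi i hi']
  · rcases hdi.eq_or_lt with rfl | hdi
    · obtain ⟨r, hr, hr', hb⟩ := hmem x hx
      exact ⟨r, by simpa using ⟨hr, hr'⟩, by rw [hcell x hx, hb]; rfl⟩
    · rw [Function.update_of_ne (by omega), hcellfr i hi hdi x hx]
      exact h.held.cell i hi hdi x hx
  · rcases hdi.eq_or_lt with rfl | hdi
    · rw [Function.update_self] at hr
      obtain ⟨x, hx, hb⟩ := hcov r hr.1 hr.2
      exact ⟨x, hx, by rw [hcell x hx, hb]; rfl⟩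
    · rw [Function.update_of_ne (by omega)] at hr
      obtain ⟨x, hx, hb⟩ := h.held.cover i hi hdi r hr
      exact ⟨x, hx, by rw [hcellfr i hi hdi x hx, hb]⟩
  · rw [hso₃ _ (by simp), hso₃ _ (by simp [hne i hi])]
    exact h.frame i hi
  · rw [hso₃ _ (by simp), h.cnt]
  · rw [e1, hroot, sorted_lt_iff (by omega) hr, add_mul, one_mul]
    omega

/-- `levSum` unfolds as the loops do, so the budgets of the inner loops sum up exactly. Each level
adds `2` to the constant factor: the overhead of a round and that of starting and ending the loop
are each at most `V`, which the weights absorb. The length `ℓ` is common to all levels, so that `V`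
is the same throughout. -/
lemma run_nest {V : ℝ≥0∞} {ℓ : ℕ} (hV : ((P.u * ℓ : ℕ) : ℝ≥0∞) + 3 * T ≤ V) (d : ℕ) (hd : d ≤ P.κ)
    (hℓ : (nest M.R P.κ P.w P.C d hd).len ≤ ℓ) {c : ℕ → ℕ} {ρ : Var M.R P.κ → ℤ} {μ : ℕ → ℤ}
    (h : Held P d c ρ μ) :
    RunP M P D Γ start code (nest M.R P.κ P.w P.C d hd) ρ μ
      ((2 * d + 3 : ℕ) * ((levSum P.m d P.weight c : ℕ) * V))
      fun ρ' μ' => Held P d c ρ' μ' ∧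
        (∀ i : Fin P.κ, d ≤ i → ρ' (.cnt i) = ρ (.cnt i) ∧ ρ' (.lth i) = ρ (.lth i)) ∧
        ¬ P.SolAt d c := by
  induction d generalizing c ρ μ with
  | zero =>
    refine (run_inner hfit hM hyes h (V := V) (le_trans ?_ hV)).weaken (by simp [levSum]) ?_
    · have : (inner M.R P.κ P.w P.C).len ≤ ℓ := hℓ
      gcongr
    · rintro ρ' μ' ⟨hso, hfr, hno⟩
      exact ⟨h.of_same hso (by simp) (by simp) hfr, fun i _ => ⟨hso _ (by simp), hso _ (by simp)⟩,
        hno⟩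
  | succ d ih =>
    have hu := P.one_le_u
    have hd' : d < P.κ := hd
    have hbigY := hfit.big_le
    have hmY : P.m ≤ Γ.Y := by have := P.N_le_big; have := P.m_le_N; omega
    set p₁ : Prog (Var M.R P.κ) := .assign (.cnt ⟨d, hd'⟩) (nat 0)
    set p₂ : Prog (Var M.R P.κ) := .assign (.lth ⟨d, hd'⟩) (nat 0 - vr .big)
    set pre : Prog (Var M.R P.κ) := .assign .th (vr (.lth ⟨d, hd'⟩)) ;; select M.R P.κ P.w d ;;
      .assign (.lth ⟨d, hd'⟩) (vr .root) ;; .assign (.llo ⟨d, hd'⟩) (vr .lo) ;;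
      .assign (.lhi ⟨d, hd'⟩) (vr .hi)
    set p₃ : Prog (Var M.R P.κ) := .assign (.cnt ⟨d, hd'⟩) (vr (.cnt ⟨d, hd'⟩) + nat 1)
    have hlen : (nest M.R P.κ P.w P.C (d + 1) hd).len =
      p₁.len + (p₂.len + (1 + 1 + 1 + (pre.len + ((nest M.R P.κ P.w P.C d hd'.le).len + p₃.len)))) :=
      rfl
    set G : ℕ := 1 + 1 + 1 with hG
    set W : (ℕ → ℕ) → ℝ≥0∞ := fun c => (2 * d + 3 : ℕ) * ((levSum P.m d P.weight c : ℕ) * V) with hW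
    have hVle : ∀ a : ℕ, a ≤ P.u * ℓ → (a : ℝ≥0∞) ≤ V := fun a ha =>
      le_trans (by exact_mod_cast ha) (le_self_add.trans hV)
    have hbody : p₁.len + p₂.len + G + (pre.len + p₃.len) ≤ ℓ := by omega
    have hbody' := Nat.mul_le_mul_left P.u hbody
    have hmul := Nat.le_mul_of_pos_left (p₁.len + p₂.len + G) hu
    rw [mul_add] at hbody'
    refine (Host.run_assign_seq 0 (by simp) (by simp) (by simp) (Host.run_assign_seq (-P.big)
      (by simp [h.env.big_eq]) (by simp) (by have := P.big_pos; omega)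
      (Host.run_count (fun J ρ' μ' => NestInv P hd' c ρ ρ' μ' J) P.m
      (fun J => (P.u * pre.len : ℕ) + (W (Function.update c d J) + (P.u * p₃.len : ℕ)))
      (fun J ρ' μ' _ => by simp) ?_ ?_ ?_))).weaken ?_ fun _ _ => id
    · intro J ρ₁ μ₁ hI hlt
      have hJ : J < P.m := by
        simpa only [Expr.eval_var, hI.cnt, hI.held.env.m_eq, Nat.cast_lt] using hlt
      refine ⟨hJ, (run_pre hfit hM hyes hd' hI hJ).seq ?_⟩
      rintro ρ₂ μ₂ ⟨hheld₂, hfr₂, hcnt₂, hlth₂⟩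
      refine (ih hd'.le (by omega) hheld₂).seq ?_
      rintro ρ₃ μ₃ ⟨hheld₃, hfr₃, hno₃⟩
      have hcnt₃ := (hfr₃ ⟨d, hd'⟩ le_rfl).1.trans hcnt₂
      have hlth₃ := (hfr₃ ⟨d, hd'⟩ le_rfl).2
      refine Host.run_assign_mul hu (J + 1 : ℕ) (by simp [hcnt₃]) (by simp) (by omega) ?_
      have hso := (SameOff.refl [.cnt ⟨d, hd'⟩] ρ₃).update (d := .cnt ⟨d, hd'⟩) (by simp) ((J + 1 : ℕ) : ℤ)
      have hself : Function.update ρ₃ (.cnt ⟨d, hd'⟩) ((J + 1 : ℕ) : ℤ) (.cnt ⟨d, hd'⟩) =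
        (J + 1 : ℕ) := by simp
      generalize Function.update ρ₃ (.cnt ⟨d, hd'⟩) ((J + 1 : ℕ) : ℤ) = ρ₄ at hso hself ⊢
      have hheld₄ := hheld₃.of_same (μ' := μ₃) hso (by simp) (by simp) fun _ _ => rfl
      have hupd : ∀ i, d + 1 ≤ i → Function.update c d J i = c i := fun i hi =>
        Function.update_of_ne (by omega) _ _
      refine ⟨⟨hheld₄.env, hheld₄.zero, hheld₄.one, fun i hi hi' => ?_, fun i hi' => ?_,
        fun i hi' => ?_, fun i hi hi' => ?_, fun i hi hi' => ?_⟩, fun i hi => ?_, hself, ?_, ?_⟩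
      · rw [← hupd i hi']; exact hheld₄.lt i hi (by omega)
      · rw [← hupd i hi']; exact hheld₄.llo i (by omega)
      · rw [← hupd i hi']; exact hheld₄.lhi i (by omega)
      · rw [← hupd i hi']; exact hheld₄.cell i hi (by omega)
      · rw [← hupd i hi']; exact hheld₄.cover i hi (by omega)
      · have hne : i ≠ ⟨d, hd'⟩ := fun h' => by rw [h'] at hi; simp at hi
        rw [hso _ (by simp [hne]), hso _ (by simp), (hfr₃ i (by omega)).1, (hfr₃ i (by omega)).2]
        exact hfr₂ i hi
      · rw [hso _ (by simp), hlth₃]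
        exact hlth₂
      · intro x hx
        rcases Nat.lt_succ_iff_lt_or_eq.1 hx with hx | rfl
        · exact hI.no x hx
        · exact hno₃
    · intro J ρ₁ μ₁ hI hlt
      have hJ : ¬ J < P.m := by
        simpa only [Expr.eval_var, hI.cnt, hI.held.env.m_eq, Nat.cast_lt] using hlt
      refine ⟨hI.held, hI.frame, ?_⟩
      rintro ⟨r, hr, hch, hJs⟩
      have hrd := hr d hd'
      -- The rank `r d` of a solution lies in the chunk `r d / n`, which has been excluded in its
      -- round.
      refine hI.no (r d / P.n) ?_ ⟨r, hr, fun i hi hdi => ?_, hJs⟩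
      · refine lt_of_lt_of_le (Nat.div_lt_of_lt_mul ?_) (not_lt.1 hJ)
        rwa [mul_comm, P.N_eq]
      · rcases hdi.eq_or_lt with rfl | hdi
        · rw [Function.update_self]
          have h1 := Nat.div_add_mod' (r d) P.n
          have h2 := Nat.mod_lt (r d) P.hn
          constructor <;> omega
        · rw [Function.update_of_ne (by omega)]
          exact hch i hi hdi
    · have hso : SameOff [.cnt ⟨d, hd'⟩, .lth ⟨d, hd'⟩] ρ
          (Function.update (Function.update ρ (.cnt ⟨d, hd'⟩) 0) (.lth ⟨d, hd'⟩) (-P.big)) :=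
        ((SameOff.refl _ ρ).update (by simp) _).update (by simp) _
      refine ⟨h.of_same hso (by simp) (by simp) fun _ _ => rfl, fun i hi => ?_, by simp,
        fun r hr => ?_, by simp⟩
      · have hne : i ≠ ⟨d, hd'⟩ := fun h' => by rw [h'] at hi; simp at hi
        rw [hso _ (by simp [hne]), hso _ (by simp [hne])]
        exact ⟨rfl, rfl⟩
      · obtain ⟨j, hj, hs⟩ := sorted_mem (g := P.g d) hr
        have := (abs_lt.1 (P.abs_key_lt hd'.le hj)).1
        simp [hs, this]
    · have h1 : ∀ x, ((G : ℕ) : ℝ≥0∞) + ((P.u * pre.len : ℕ) + (W (Function.update c d x) +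
          (P.u * p₃.len : ℕ))) ≤
          (2 * d + 4 : ℕ) * ((levSum P.m d P.weight (Function.update c d x) : ℕ) * V) := fun x => by
        set l := levSum P.m d P.weight (Function.update c d x)
        have hl : 1 ≤ l := Inst.one_le_levSum_weight d _
        calc _ = ((G + (P.u * pre.len + P.u * p₃.len) : ℕ) : ℝ≥0∞) +
              (2 * d + 3 : ℕ) * ((l : ℕ) * V) := by simp only [hW]; push_cast; ring
          _ ≤ (1 : ℕ) * V + (2 * d + 3 : ℕ) * ((l : ℕ) * V) := by
              gcongr
              rw [Nat.cast_one, one_mul]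
              refine hVle _ ?_
              rw [← mul_add]
              omega
          _ ≤ (l : ℕ) * V + (2 * d + 3 : ℕ) * ((l : ℕ) * V) := by gcongr
          _ = _ := by push_cast; ring
      have hl : 1 ≤ levSum P.m (d + 1) P.weight c := Inst.one_le_levSum_weight (d + 1) _
      have h2 : ∑ x ∈ Finset.range P.m,
          (2 * d + 4 : ℕ) * (((levSum P.m d P.weight (Function.update c d x) : ℕ) : ℝ≥0∞) * V) =
          (2 * d + 4 : ℕ) * ((levSum P.m (d + 1) P.weight c : ℕ) * V) := by
        rw [← Finset.mul_sum, ← Finset.sum_mul, levSum, Nat.cast_sum]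
      have h3 := (Finset.sum_le_sum fun x (_ : x ∈ Finset.range P.m) => h1 x).trans_eq h2
      set l := levSum P.m (d + 1) P.weight c
      calc (p₁.len : ℝ≥0∞) + (p₂.len + (∑ x ∈ Finset.range P.m, (((G : ℕ) : ℝ≥0∞) +
            ((P.u * pre.len : ℕ) + (W (Function.update c d x) + (P.u * p₃.len : ℕ)))) + (G : ℕ)))
          = ((p₁.len + p₂.len + G : ℕ) : ℝ≥0∞) + ∑ x ∈ Finset.range P.m, (((G : ℕ) : ℝ≥0∞) +
            ((P.u * pre.len : ℕ) + (W (Function.update c d x) + (P.u * p₃.len : ℕ)))) := by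
            push_cast; ring
        _ ≤ (1 : ℕ) * V + (2 * d + 4 : ℕ) * ((l : ℕ) * V) := by
            gcongr
            rw [Nat.cast_one, one_mul]
            exact hVle _ (by omega)
        _ ≤ (l : ℕ) * V + (2 * d + 4 : ℕ) * ((l : ℕ) * V) := by gcongr
        _ = _ := by push_cast; ring

end SumProg

/-! ### Setup and the whole program -/

namespace SumProg

variable {M : WordRAM} {P : Inst} {D : ℕ} {Γ : Job} (hfit : Fits P Γ)
variable {Q : Type} [Fintype Q] {start : Q} {code : Q → Instr Q (host M P.κ D).R}

include hfit

/-- At level `κ` no chunk is selected yet, so `Held` reduces to the global variables and the two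
header cells, and its vector of chunks plays no role. -/
lemma run_setup (ρ : Var M.R P.κ → ℤ) (μ : ℕ → ℤ) :
    RunP M P D Γ start code (setup M.R P.κ P.w) ρ μ
      ((P.len + 1) * (setup M.R P.κ P.w).len : ℕ)
      fun ρ' μ' => Held P P.κ (fun _ => 0) ρ' μ' := by
  have hms := hfit.ms_eq
  have haddr := hfit.addr_le
  have hbigY := hfit.big_le
  have hNbig := P.N_le_big
  have hn := P.hn
  have hnN := P.n_le_N
  have hmN := P.m_le_N
  have hA := P.one_le_A
  have hN : (1 : ℤ) ≤ P.N := by exact_mod_cast P.one_le_N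
  have hAbz : P.A ≤ P.bz := by
    rw [Inst.bz]; push_cast
    nlinarith [mul_nonneg (show (0 : ℤ) ≤ P.κ + 1 by positivity) (show (0 : ℤ) ≤ P.w by positivity)]
  have hAbig : P.A ≤ P.big := by rw [Inst.big]; nlinarith
  have ht := abs_le.1 P.abs_t_le
  simp only [Inst.ms, Inst.base] at hms haddr
  have hL2 : 2 ≤ P.L := by rw [Inst.L]; omega
  have hu : 1 ≤ P.len + 1 := by omega
  refine Host.run_assign_len _ hu P.n ?_ (by simp) (by omega) ?_
  · simp only [Expr.eval_input, Expr.eval_lit, hfit.x_eq]; exact P.hx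
  refine Host.run_assign_len _ hu P.t ?_ (by simp) (by omega) ?_
  · simp only [Expr.eval_input, Expr.eval_lit, hfit.x_eq]; rfl
  refine Host.run_assign_len _ hu P.m ?_ (by simp [safe_powE]) (by omega) ?_
  · rw [eval_powE (by simp)]; rfl
  refine Host.run_assign_len _ hu P.N ?_ (by simp) (by omega) ?_
  · rw [← P.N_eq]; simp
  refine Host.run_assign_len _ hu P.L ?_ (by simp) (by omega) ?_
  · simp [Inst.L]
  refine Host.run_assign_len _ hu P.base ?_ (by simp) (by rw [Inst.base]; omega) ?_
  · simp [Inst.base]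
  refine Host.run_assign_len _ hu 1 (by simp) (by simp) (by omega) ?_
  refine Host.run_assign_len _ hu 0 (by simp) (by simp) (by omega) ?_
  set ρ₁ := Function.update (Function.update (Function.update (Function.update (Function.update
    (Function.update (Function.update (Function.update ρ Var.n P.n) Var.t P.t) Var.m P.m) Var.nk P.N)
    Var.len P.L) Var.base P.base) Var.bz 1) Var.j 0 with hρ₁
  have e1 : ρ₁ .n = P.n := by simp [hρ₁]
  have e2 : ρ₁ .t = P.t := by simp [hρ₁]
  have e3 : ρ₁ .m = P.m := by simp [hρ₁]
  have e4 : ρ₁ .nk = P.N := by simp [hρ₁]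
  have e5 : ρ₁ .len = P.L := by simp [hρ₁]
  have e6 : ρ₁ .base = P.base := by simp [hρ₁]
  have e7 : ρ₁ .bz = 1 := by simp [hρ₁]
  have e8 : ρ₁ .j = 0 := by simp [hρ₁]
  clear_value ρ₁
  refine Host.Run.seq_len (Φ := fun ρ' μ' => SameOff [.bz, .j] ρ₁ ρ' ∧ ρ' .bz = P.A) ?_ ?_
  · refine (Host.run_count_mul (fun J ρ' _ => SameOff [.bz, .j] ρ₁ ρ' ∧ ρ' .j = J ∧ J ≤ P.len ∧
      ρ' .bz = 1 + ∑ p ∈ Finset.range J, P.X p * P.X p) P.len 1 le_rfl ?_ ?_ ?_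
      ⟨.refl _ _, by simp [e8], by omega, by simp [e7]⟩).of_len_le (by omega)
    · intro J ρ' μ' _; simp
    · rintro J ρ' μ' ⟨hso, hj, hJ, hbz⟩ hlt
      have hn' : ρ' .n = P.n := (hso .n (by simp)).trans e1
      have hlt' : J < P.len := by
        simp only [Expr.eval_var, hj, Expr.eval_add, Expr.eval_mul, Expr.eval_lit, hn'] at hlt
        rw [Inst.len]
        exact_mod_cast hlt
      refine ⟨hlt', ?_⟩
      have hle : 1 + ∑ p ∈ Finset.range (J + 1), P.X p * P.X p ≤ P.A := by
        rw [Inst.A]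
        gcongr
        · exact fun _ _ _ => mul_self_nonneg _
        · exact hlt'
      have h0 : 0 ≤ ∑ p ∈ Finset.range (J + 1), P.X p * P.X p :=
        Finset.sum_nonneg fun _ _ => mul_self_nonneg _
      refine Host.run_assign_len _ le_rfl (1 + ∑ p ∈ Finset.range (J + 1), P.X p * P.X p) ?_
        (by simp) (by omega) ?_
      · rw [Finset.sum_range_succ]
        simp only [Expr.eval_add, Expr.eval_mul, Expr.eval_var, Expr.eval_input, hbz, hj, hfit.x_eq,
          Int.toNat_natCast, Inst.X]
        ring
      refine Host.run_assign_mul le_rfl (J + 1 : ℕ) (by simp [hj]) (by simp) (by omega)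
        ⟨(hso.update (by simp) _).update (by simp) _, by simp, hlt', by simp⟩
    · rintro J ρ' μ' ⟨hso, hj, hJ, hbz⟩ hlt
      have hn' : ρ' .n = P.n := (hso .n (by simp)).trans e1
      have hlt' : ¬ J < P.len := by
        simp only [Expr.eval_var, hj, Expr.eval_add, Expr.eval_mul, Expr.eval_lit, hn'] at hlt
        rw [Inst.len]
        exact_mod_cast hlt
      obtain rfl : J = P.len := by omega
      exact ⟨hso, hbz⟩
  · rintro ρ₂ μ₂ ⟨hso, hbz⟩
    have hnk : ρ₂ .nk = P.N := (hso .nk (by simp)).trans e4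
    have hbigpos := P.big_pos
    refine Host.run_assign_len _ hu P.big (by simp [hbz, hnk, Inst.big, Inst.bz]) (by simp)
      (by omega) ?_
    have hso₃ := (hso.mono (S' := [.big, .bz, .j]) (by simp)).update (d := .big) (by simp) P.big
    have e9 : Function.update ρ₂ .big P.big .big = P.big := by simp
    generalize Function.update ρ₂ .big P.big = ρ₃ at hso₃ e9 ⊢
    have hρ₃ : Env P ρ₃ := ⟨(hso₃ _ (by simp)).trans e1, (hso₃ _ (by simp)).trans e2,
      (hso₃ _ (by simp)).trans e3, (hso₃ _ (by simp)).trans e4, (hso₃ _ (by simp)).trans e5,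
      (hso₃ _ (by simp)).trans e6, e9⟩
    refine Host.run_store_len _ hu 0 P.n (by simp) (by simp [hρ₃.n_eq]) (by simp) (by simp)
      (by omega) (by omega) ?_
    refine Host.run_store_mul hu 1 P.t (by simp) (by simp [hρ₃.t_eq]) (by simp) (by simp)
      (by omega) (by omega) ?_
    exact ⟨hρ₃, by simp, by simp, fun i hi hi' => absurd hi (by omega),
      fun i hi => absurd i.2 (by omega), fun i hi => absurd i.2 (by omega),
      fun i hi hi' => absurd hi (by omega), fun i hi hi' => absurd hi (by omega)⟩

lemma run_main {T : ℝ≥0∞} (hM : Sub M P Γ T) (hyes : Γ.yes ↔ P.SolAt P.κ (fun _ => 0))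
    (hκ : 1 ≤ P.κ) (ρ : Var M.R P.κ → ℤ) (μ : ℕ → ℤ) :
    RunP M P D Γ start code (main M.R P.κ P.w P.C) ρ μ
      (((P.len + 1) * (setup M.R P.κ P.w).len : ℕ) + ((2 * P.κ + 3) * ((P.κ + 1) * P.m ^ P.κ) : ℕ) *
        ((P.u * (nest M.R P.κ P.w P.C P.κ le_rfl).len : ℕ) + 3 * T))
      fun _ _ => False := by
  refine (run_setup hfit ρ μ).seq fun ρ₁ μ₁ h₁ => ?_
  refine ((run_nest hfit hM hyes.2 le_rfl P.κ le_rfl le_rfl h₁).seq (C' := 0) ?_).weaken ?_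
    fun _ _ => id
  · rintro ρ₂ μ₂ ⟨-, -, hno⟩
    exact Host.run_halt (by rw [hyes]; simp [hno])
  · rw [add_zero, Nat.cast_mul (2 * P.κ + 3), mul_assoc]
    gcongr
    exact Inst.levSum_weight_le hκ _

end SumProg

/-! ### The machine -/

namespace Host

variable {W : Type} [Fintype W] [DecidableEq W] (H : Host W) (p : Prog W)

/-- The code of a program, followed by `halt`. -/
def machineCode : Option (H.Pos p) → Instr (Option (H.Pos p)) H.R
  | none => .halt false
  | some r => H.codeP p some none r

/-- The machine that executes a program. -/
abbrev machine : WordRAM := H.mach (some (H.entry p)) (H.machineCode p)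

variable {H p}

/-- The postcondition `False` says that the program halts before its end, so no budget has to be
kept for what follows, and the triple holds for every time horizon. -/
lemma machine_good {Γ : Job} (hp : p.Ok H.D Γ.s Γ.Y) {r : ℝ≥0∞}
    (h : H.Run (some (H.entry p)) (H.machineCode p) Γ p (fun _ => 0) (fun _ => 0) r
      fun _ _ => False) :
    (∀ c, (H.machine p).Reachable Γ.x c → H.SafeCfg _ _ Γ c) ∧
      (H.machine p).expectedTime Γ.x ≤ r := by
  refine WordRAM.good_init fun T => ?_
  have hat := H.at_codeP (H.machineCode p) p hp some none fun r => rfl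
  have := h _ _ hat (fun _ => 0) (fun _ => rfl) T 0 (fun _ _ _ h => h.elim)
    ⟨fun _ => by simp, fun _ => by simp, rfl, fun _ => by simp⟩
  rwa [add_zero] at this

end Host

/-! ### Sums of groups -/

/-- A new leading digit adds a multiple of `n ^ w`, which does not affect the digits at places below
`w`. -/
lemma exists_digits {n : ℕ} (hn : 1 ≤ n) (d : ℕ → ℕ) (hd : ∀ b, d b < n) (w : ℕ) :
    ∃ j < n ^ w, ∀ b < w, j / n ^ b % n = d b := by
  induction w with
  | zero => exact ⟨0, by simp, by simp⟩
  | succ w ih =>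
    obtain ⟨j, hj, hjd⟩ := ih
    refine ⟨j + n ^ w * d w, ?_, fun b hb => ?_⟩
    · have : n ^ w * (d w + 1) ≤ n ^ w * n := Nat.mul_le_mul_left _ (hd w)
      rw [pow_succ]
      linarith [mul_add (n ^ w) (d w) 1]
    · rcases Nat.lt_succ_iff_lt_or_eq.1 hb with hb | rfl
      · rw [← hjd b hb, show n ^ w = n ^ b * (n * n ^ (w - b - 1)) by
          rw [← pow_succ', ← pow_add]; congr 1; omega, mul_assoc,
          Nat.add_mul_div_left _ _ (by positivity), mul_assoc, Nat.add_mul_mod_self_left]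
      · rw [Nat.add_mul_div_left _ _ (by positivity), Nat.div_eq_of_lt hj, zero_add,
          Nat.mod_eq_of_lt (hd b)]

lemma sum_range_mul {M : Type*} [AddCommMonoid M] (F : ℕ → M) (a w : ℕ) :
    ∑ p ∈ Finset.range (a * w), F p = ∑ i ∈ Finset.range a, ∑ b ∈ Finset.range w, F (i * w + b) := by
  induction a with
  | zero => simp
  | succ a ih => rw [add_mul, one_mul, Finset.sum_range_add, ih, Finset.sum_range_succ]

namespace SumProg

/-- The instance `S`, `t`, with groups of `w` lists. -/
def inst (κ w C : ℕ) (hw : 1 ≤ w) {n : ℕ} (hn : 1 ≤ n) (S : Fin ((κ + 1) * w) → Fin n → ℤ) (t : ℤ) :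
    Inst where
  κ := κ
  w := w
  C := C
  n := n
  x := kSumInput S t
  hw := hw
  hn := hn
  hx := by simp [kSumInput]

variable {κ w C : ℕ} {hw : 1 ≤ w} {n : ℕ} {hn : 1 ≤ n} {S : Fin ((κ + 1) * w) → Fin n → ℤ} {t : ℤ}

lemma inst_t : (inst κ w C hw hn S t).t = t := by
  simp [Inst.t, Inst.X, inst, kSumInput]

lemma inst_X (p : Fin ((κ + 1) * w)) (a : Fin n) :
    (inst κ w C hw hn S t).X (2 + p * n + a) = S p a := by
  have hp : (p : ℕ) * n + a < (κ + 1) * w * n := by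
    have : (p + 1) * n ≤ (κ + 1) * w * n := Nat.mul_le_mul_right _ p.2
    rw [add_mul, one_mul] at this
    omega
  have e : 2 + (p : ℕ) * n + a = (p * n + a) + 2 := by omega
  rw [e]
  simp only [Inst.X, inst, kSumInput, List.getD_cons_succ]
  rw [List.getD_eq_getElem _ _ (by simpa using hp), List.getElem_ofFn]
  congr 1 <;> apply Fin.ext
  · simp only [Fin.coe_divNat]
    rw [mul_comm, Nat.mul_add_div (by omega), Nat.div_eq_of_lt a.2, add_zero]
  · simp only [Fin.coe_modNat]
    rw [mul_comm, Nat.mul_add_mod, Nat.mod_eq_of_lt a.2]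

/-- The base `n` digits of `J i` are the positions chosen in the `w` lists of group `i`. -/
lemma kSum_iff_exists_g : KSum S t ↔ ∃ J : ℕ → ℕ, (∀ i ≤ κ, J i < (inst κ w C hw hn S t).N) ∧
    ∑ i ∈ Finset.range (κ + 1), (inst κ w C hw hn S t).g i (J i) = t := by
  have key : ∀ (f : Fin ((κ + 1) * w) → Fin n) (J : ℕ → ℕ),
      (∀ i ≤ κ, ∀ b, ∀ hb : b < w, ∀ h : i * w + b < (κ + 1) * w,
        J i / n ^ b % n = f ⟨i * w + b, h⟩) →
      ∑ p, S p (f p) = ∑ i ∈ Finset.range (κ + 1), (inst κ w C hw hn S t).g i (J i) := by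
    intro f J h
    let F : ℕ → ℤ := fun p => if hp : p < (κ + 1) * w then S ⟨p, hp⟩ (f ⟨p, hp⟩) else 0
    calc ∑ p, S p (f p) = ∑ p : Fin ((κ + 1) * w), F p :=
          Finset.sum_congr rfl fun p _ => by simp only [F, dif_pos p.2]
      _ = _ := by
        rw [← Finset.sum_range, sum_range_mul]
        refine Finset.sum_congr rfl fun i hi => Finset.sum_congr rfl fun b hb => ?_
        have hi := Finset.mem_range.1 hi
        have hb : b < w := Finset.mem_range.1 hb
        have hlt : i * w + b < (κ + 1) * w := by
          have : (i + 1) * w ≤ (κ + 1) * w := Nat.mul_le_mul_right _ hi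
          rw [add_mul, one_mul] at this
          omega
        simp only [F, dif_pos hlt]
        rw [← inst_X (C := C) (hw := hw) (hn := hn) (S := S) (t := t), ← h i (by omega) b hb hlt]
        rfl
  constructor
  · rintro ⟨f, hf⟩
    let d : ℕ → ℕ → ℕ := fun i b => if h : i * w + b < (κ + 1) * w then f ⟨i * w + b, h⟩ else 0
    have hd : ∀ i b, d i b < n := fun i b => by simp only [d]; split_ifs <;> omega
    choose J hJ hJd using fun i => exists_digits hn (d i) (hd i) w
    exact ⟨J, fun i _ => hJ i, by
      rw [← key f J fun i _ b hb h => by rw [hJd i b hb]; simp only [d, dif_pos h], hf]⟩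
  · rintro ⟨J, -, hJ⟩
    refine ⟨fun p => ⟨J (p / w) / n ^ (p % w : ℕ) % n, Nat.mod_lt _ hn⟩, ?_⟩
    rw [key _ J fun i _ b hb h => ?_, hJ]
    simp only
    rw [mul_comm i w, Nat.mul_add_div (by omega), Nat.div_eq_of_lt hb, add_zero, Nat.mul_add_mod,
      Nat.mod_eq_of_lt hb]

/-- At level `κ` the chunks impose no condition. What remains is the change from indices to ranks in
the first `κ` groups; the last group keeps its index. -/
lemma kSum_iff_solAt : KSum S t ↔ (inst κ w C hw hn S t).SolAt κ (fun _ => 0) := by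
  rw [kSum_iff_exists_g (C := C) (hw := hw) (hn := hn)]
  set P := inst κ w C hw hn S t
  constructor
  · rintro ⟨J, hJ, hsum⟩
    have : ∀ i, ∃ r, i ≤ κ → r < P.N ∧ P.z i r = P.g i (J i) := fun i => by
      by_cases hi : i ≤ κ
      · obtain ⟨r, hr, h⟩ := exists_sorted (g := P.g i) (hJ i hi)
        exact ⟨r, fun _ => ⟨hr, P.z_of_key (hJ i hi) h⟩⟩
      · exact ⟨0, fun h => absurd h hi⟩
    choose r hr using this
    refine ⟨r, fun i hi => (hr i (Nat.le_of_lt hi)).1, fun i hi hi' => absurd hi (not_lt.2 hi'),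
      J κ, hJ κ le_rfl, ?_⟩
    rw [show P.t = t from inst_t, ← hsum, Finset.sum_range_succ]
    congr 1
    exact Finset.sum_congr rfl fun i hi => (hr i (Finset.mem_range.1 hi).le).2
  · rintro ⟨r, hr, -, J, hJ, hsum⟩
    have : ∀ i, ∃ j, i < κ → j < P.N ∧ P.z i (r i) = P.g i j := fun i => by
      by_cases hi : i < κ
      · obtain ⟨j, hj, h⟩ := P.exists_z (i := i) (hr i hi)
        exact ⟨j, fun _ => ⟨hj, h⟩⟩
      · exact ⟨0, fun h => absurd h hi⟩
    choose j hj using this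
    refine ⟨fun i => if i < κ then j i else J, fun i hi => ?_, ?_⟩
    · dsimp only
      split_ifs with h
      · exact (hj i h).1
      · exact hJ
    · rw [show P.t = t from inst_t] at hsum
      simp only [← hsum, Finset.sum_range_succ, if_neg (lt_irrefl κ)]
      congr 1
      exact Finset.sum_congr rfl fun i hi => by
        have hi : i < κ := Finset.mem_range.1 hi
        rw [if_pos hi, (hj i hi).2]

end SumProg

/-! ### Word bounds and the resulting algorithm -/

lemma WordRAM.natAbs_getD_le_magnitude (x : List ℤ) (i : ℕ) :
    (x.getD i 0).natAbs ≤ WordRAM.magnitude x := by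
  induction x generalizing i with
  | nil => simp
  | cons a x ih =>
    cases i with
    | zero => simp [magnitude]
    | succ i =>
      refine (ih i).trans ?_
      simp [magnitude]

lemma WordRAM.magnitude_le {x : List ℤ} {B : ℕ} (h : ∀ a ∈ x, a.natAbs ≤ B) :
    WordRAM.magnitude x ≤ B := by
  induction x with
  | nil => simp [magnitude]
  | cons a x ih =>
    have := ih fun a ha => h a (List.mem_cons_of_mem _ ha)
    simp only [magnitude, List.map_cons, List.foldr_cons] at this ⊢
    exact max_le (h a (by simp)) this

namespace SumProg

namespace Inst

variable (P : Inst) {Z : ℕ}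

lemma A_le_pow (hZ : 2 ≤ Z) (hl : P.len ≤ Z) (hX : ∀ p, (P.X p).natAbs ≤ Z) :
    P.A ≤ (Z ^ 4 : ℕ) := by
  have h1 : ∑ p ∈ Finset.range P.len, P.X p * P.X p ≤ ∑ p ∈ Finset.range P.len, ((Z * Z : ℕ) : ℤ) := by
    refine Finset.sum_le_sum fun p _ => ?_
    rw [← Int.natAbs_mul_self]
    exact_mod_cast Nat.mul_le_mul (hX p) (hX p)
  have h2 : 1 + P.len * (Z * Z) ≤ Z ^ 4 := by
    have h3 : P.len * (Z * Z) ≤ Z * (Z * Z) := Nat.mul_le_mul_right _ hl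
    have h4 : 1 ≤ Z * (Z * Z) := Nat.mul_pos (by omega) (Nat.mul_pos (by omega) (by omega))
    calc 1 + P.len * (Z * Z) ≤ 2 * (Z * (Z * Z)) := by omega
      _ ≤ Z * (Z * (Z * Z)) := Nat.mul_le_mul_right _ hZ
      _ = Z ^ 4 := by ring
  rw [Finset.sum_const, Finset.card_range, nsmul_eq_mul] at h1
  rw [A]
  calc _ ≤ 1 + (P.len : ℤ) * ((Z * Z : ℕ) : ℤ) := by linarith
    _ ≤ _ := by exact_mod_cast h2

/-- A constant `c` is absorbed by `Z ^ c` because `2 ≤ Z`. Such crude bounds suffice, as only some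
exponent independent of the input is required. -/
lemma bz_le_pow (hZ : 2 ≤ Z) (hl : P.len ≤ Z) (hX : ∀ p, (P.X p).natAbs ≤ Z) :
    P.bz ≤ (Z ^ (4 + ((P.κ + 1) * P.w + 2)) : ℕ) := by
  rw [bz, pow_add, Nat.cast_mul]
  refine mul_le_mul (P.A_le_pow hZ hl hX) ?_ (by positivity) (by positivity)
  exact_mod_cast (Nat.lt_pow_self (by omega)).le

lemma big_le_pow (hZ : 2 ≤ Z) (hl : P.len ≤ Z) (hX : ∀ p, (P.X p).natAbs ≤ Z) (hn : P.n ≤ Z) :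
    P.big ≤ (Z ^ (4 + ((P.κ + 1) * P.w + 2) + P.w) : ℕ) := by
  rw [big, pow_add, Nat.cast_mul]
  refine mul_le_mul (P.bz_le_pow hZ hl hX) ?_ (by positivity) (by positivity)
  exact_mod_cast Nat.pow_le_pow_left hn _

lemma L_le (hZ : 2 ≤ Z) (hn : P.n ≤ Z) : P.L ≤ (P.κ + 2) * Z := by
  rw [L]
  nlinarith [Nat.mul_le_mul_left (P.κ + 1) hn]

lemma addr_le_pow (hZ : 2 ≤ Z) (hl : P.len ≤ Z) (hn : P.n ≤ Z) :
    P.ms + P.len ≤ Z ^ (P.κ + 2 * P.C + 5 + 1) := by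
  have h1 := P.L_le hZ hn
  have h2 : P.C * (P.n + 1) ≤ P.C * (2 * Z) := Nat.mul_le_mul_left _ (by omega)
  rw [pow_succ]
  calc P.ms + P.len ≤ (P.κ + 2 * P.C + 5) * Z := by rw [ms, base]; nlinarith
    _ ≤ _ := Nat.mul_le_mul_right _ (Nat.lt_pow_self (by omega)).le

lemma sub_le_pow (hZ : 2 ≤ Z) (hl : P.len ≤ Z) (hX : ∀ p, (P.X p).natAbs ≤ Z) (hn : P.n ≤ Z) {B : ℕ}
    (hB : (B : ℤ) ≤ P.bz) : P.L + B + 2 ≤ Z ^ (P.κ + 4 + (4 + ((P.κ + 1) * P.w + 2))) := by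
  have h1 := P.L_le hZ hn
  have h2 : B ≤ Z ^ (4 + ((P.κ + 1) * P.w + 2)) := by
    have := P.bz_le_pow hZ hl hX
    omega
  set c := 4 + ((P.κ + 1) * P.w + 2)
  have h3 : Z ≤ Z ^ c := Nat.le_self_pow (by omega) _
  have h4 : (P.κ + 2) * Z ≤ (P.κ + 2) * Z ^ c := Nat.mul_le_mul_left _ h3
  rw [pow_add Z (P.κ + 4)]
  calc P.L + B + 2 ≤ (P.κ + 4) * Z ^ c := by nlinarith
    _ ≤ _ := Nat.mul_le_mul_right _ (Nat.lt_pow_self (by omega)).le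

end Inst

/-- An exponent for the bound on the words. -/
def expo (κ w C e K : ℕ) : ℕ :=
  K + (4 + ((κ + 1) * w + 2) + w) + (κ + 2 * C + 5 + 1) + (κ + 4 + (4 + ((κ + 1) * w + 2))) * e + 1

/-- A bound on the time. -/
noncomputable def timeBound (κ w C a b c : ℕ) (T : ℕ → ℝ) (n : ℕ) : ℝ :=
  ((2 + (κ + 1) * w * n + 1) * a : ℕ) + (b * (n ^ (w - 1)) ^ κ : ℕ) *
    (((C + 2) * (n ^ w + 1) * (Nat.log 2 n + 1 + 2) * c : ℕ) + 3 * max (T n) 0)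

/-- A bound on the space. -/
def spaceBound (κ C r n : ℕ) : ℕ := r + (2 + (κ + 1) * n + 2 * n + C * (n + 1))

lemma ofReal_timeBound (κ w C a b c : ℕ) (T : ℕ → ℝ) (n : ℕ) :
    ENNReal.ofReal (timeBound κ w C a b c T n) =
      ((2 + (κ + 1) * w * n + 1) * a : ℕ) + (b * (n ^ (w - 1)) ^ κ : ℕ) *
        (((C + 2) * (n ^ w + 1) * (Nat.log 2 n + 1 + 2) * c : ℕ) + 3 * ENNReal.ofReal (T n)) := by
  have hT : ENNReal.ofReal (T n) = ENNReal.ofReal (max (T n) 0) := by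
    rcases le_total 0 (T n) with h0 | h0
    · rw [max_eq_left h0]
    · rw [max_eq_right h0, ENNReal.ofReal_of_nonpos h0, ENNReal.ofReal_zero]
  have h0 : (0 : ℝ) ≤ max (T n) 0 := le_max_right _ _
  rw [hT, timeBound, ENNReal.ofReal_add (by positivity) (by positivity),
    ENNReal.ofReal_mul (by positivity), ENNReal.ofReal_add (by positivity) (by positivity),
    ENNReal.ofReal_mul (by positivity), ENNReal.ofReal_natCast, ENNReal.ofReal_natCast,
    ENNReal.ofReal_natCast, ENNReal.ofReal_ofNat]

/-- The program depends on `κ`, `w`, `C` and `M` only. For each instance it remains to check that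
the word and memory bounds of the job are met, also by the called machine, whose inputs consist of
numbers up to `bz` and are thus polynomially larger than the given ones. -/
theorem exists_isLasVegasKSum {κ w C : ℕ} (hκ : 1 ≤ κ) (hw : 1 ≤ w) {M : WordRAM} {T : ℕ → ℝ}
    {s : ℕ → ℕ} (h : IsLasVegasKSum (κ + 1) M T s) (hC : ∀ n, 1 ≤ n → s n ≤ C * (n + 1)) :
    ∃ (M' : WordRAM) (a b c r : ℕ), IsLasVegasKSum ((κ + 1) * w) M' (timeBound κ w C a b c T)
      (spaceBound κ C r) := by
  obtain ⟨e, h⟩ := h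
  obtain ⟨K, hK⟩ := (main M.R κ w C).exists_ok
  refine ⟨(host M κ K).machine (main M.R κ w C), (setup M.R κ w).len, (2 * κ + 3) * (κ + 1),
    (nest M.R κ w C κ le_rfl).len, Fintype.card (host M κ K).R,
    expo κ w C e K * (K + 2), fun n hn S t => ?_⟩
  set P : Inst := inst κ w C hw hn S t with hP
  set x := kSumInput S t with hx
  set Z := x.length + WordRAM.magnitude x + 2 with hZ
  have hZ2 : 2 ≤ Z := by omega
  have hlx : P.len = x.length := by rw [hx, length_kSumInput]; rfl
  have hl : P.len ≤ Z := by omega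
  have hX : ∀ p, (x.getD p 0).natAbs ≤ Z := fun p =>
    (WordRAM.natAbs_getD_le_magnitude x p).trans (by omega)
  have hnZ : P.n ≤ Z := by
    have := hX 0
    rw [show x.getD 0 0 = P.n from P.hx] at this
    simpa using this
  -- The exponent is a sum of the exponents needed for constants, keys, addresses and the words of
  -- the called machine.
  set Y := Z ^ expo κ w C e K with hY
  have hpow : ∀ a, a ≤ expo κ w C e K → Z ^ a ≤ Y := fun a ha => Nat.pow_le_pow_right (by omega) ha
  have hZY : Z ≤ Y := by simpa using hpow 1 (by rw [expo]; omega)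
  let Γ : Job := ⟨x, KSum S t, P.ms, Y, K + 2, hZ2.trans hZY, fun i => (hX i).trans hZY⟩
  have hfit : Fits P Γ := by
    refine ⟨rfl, rfl, by simp [Γ], (P.big_le_pow hZ2 hl hX hnZ).trans ?_,
      (P.addr_le_pow hZ2 hl hnZ).trans (hpow _ ?_)⟩
    · exact_mod_cast hpow _ (by rw [expo]; simp only [hP, inst]; omega)
    · rw [expo]; simp only [hP, inst]; omega
  have hM : Sub M P Γ (ENNReal.ofReal (T n)) := by
    intro S' hS'
    obtain ⟨h1, h2, ⟨m, hm, hacc⟩, h4⟩ := h n hn S' P.t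
    refine ⟨h1, h2, fun c hc => ⟨fun i hi => (hacc c hc i hi).trans_le ?_, ?_⟩⟩
    · have := hC n hn
      exact le_trans (by omega) this
    · have hmag : WordRAM.magnitude (kSumInput S' P.t) ≤ P.bz.natAbs := by
        have hbz := P.one_le_bz
        have hA : P.A ≤ P.bz := by
          have := P.wA_le_bz
          have := P.one_le_A
          have : (1 : ℤ) ≤ P.w := by exact_mod_cast hw
          nlinarith
        have hnA := abs_le.1 (P.abs_X_le (p := 0) (by rw [Inst.len]; omega))
        have htA := abs_le.1 P.abs_t_le
        rw [show P.X 0 = n from P.hx] at hnA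
        refine WordRAM.magnitude_le fun a ha => ?_
        simp only [kSumInput, List.mem_cons, List.mem_ofFn] at ha
        rcases ha with ha | ha | ⟨p, rfl⟩
        · replace ha : a = n := ha
          omega
        · omega
        · have := abs_le.1 (hS' p.divNat p.modNat)
          omega
      have hle : (kSumInput S' P.t).length + WordRAM.magnitude (kSumInput S' P.t) + 2 ≤
          Z ^ (κ + 4 + (4 + ((κ + 1) * w + 2))) := by
        have := P.sub_le_pow hZ2 hl hX hnZ (B := P.bz.natAbs) (by have := P.one_le_bz; omega)
        refine le_trans ?_ this
        rw [length_kSumInput]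
        change P.L + _ + 2 ≤ _
        omega
      have hle' : ((kSumInput S' P.t).length + WordRAM.magnitude (kSumInput S' P.t) + 2) ^ e ≤ Y := by
        refine (Nat.pow_le_pow_left hle e).trans ?_
        rw [← pow_mul]
        exact hpow _ (by rw [expo]; omega)
      exact ⟨fun r => ((h4 c hc).1 r).trans hle', fun i => ((h4 c hc).2 i).trans hle'⟩
  have hKY : K ≤ Y := (Nat.lt_pow_self (by omega)).le.trans (hpow K (by rw [expo]; omega))
  obtain ⟨hsafe, htime⟩ := Host.machine_good (H := host M κ K) (p := main M.R κ w C) (Γ := Γ)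
    (hK.mono le_rfl (by simp [Γ]) hKY) (run_main hfit hM kSum_iff_solAt hκ _ _)
  -- Variables and memory stay below `Y`, but temporary registers may reach `Y ^ (K + 2)`, which
  -- determines the final exponent.
  have hYY : Y ≤ Z ^ (expo κ w C e K * (K + 2)) := by
    rw [pow_mul]; exact Nat.le_self_pow (by omega) _
  refine ⟨fun c b hc hb => (hsafe c hc).1 b hb, htime.trans ?_, ⟨P.ms, ?_, fun c hc i hi =>
    (hsafe c hc).2.1 i hi⟩, fun c hc => ⟨fun r => ?_, fun i => ((hsafe c hc).2.2.mem i).trans hYY⟩⟩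
  · rw [ofReal_timeBound, mul_assoc (2 * κ + 3)]
    exact le_rfl
  · rw [spaceBound, Inst.ms, Inst.base, Inst.L]
    exact le_rfl
  · rcases r with v | _ | k
    · exact ((hsafe c hc).2.2.var v).trans hYY
    · rw [(hsafe c hc).2.2.zero]; simp
    · refine ((hsafe c hc).2.2.tmp k).trans ?_
      rw [pow_mul]

end SumProg

/-! ### Asymptotics -/

namespace SumProg

lemma one_le_log {n : ℕ} (hn : 3 ≤ n) : 1 ≤ Real.log n := by
  rw [Real.le_log_iff_exp_le (by positivity)]
  have : (3 : ℝ) ≤ n := by exact_mod_cast hn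
  linarith [Real.exp_one_lt_d9]

lemma natLog_add_le {n : ℕ} (hn : 3 ≤ n) : ((Nat.log 2 n + 1 + 2 : ℕ) : ℝ) ≤ 5 * Real.log n := by
  have h1 := one_le_log hn
  have h2 : (Nat.log 2 n : ℝ) ≤ Real.logb 2 n := Real.natLog_le_logb n 2
  have h3 : Real.logb 2 n ≤ 2 * Real.log n := by
    rw [Real.logb, div_le_iff₀ (Real.log_pos one_lt_two)]
    nlinarith [Real.log_two_gt_d9]
  push_cast
  linarith

/-- There are `n ^ (κ (w - 1))` tuples of chunks up to a constant, each with a selection cost of `n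
^ w log n` and a call cost of `T n`. The power `e + 1` of the logarithm dominates both the power `e`
from `T` and the factor from the tree. -/
lemma isSoftO_timeBound {κ w : ℕ} (hw : 1 ≤ w) (C a b c : ℕ) {T : ℕ → ℝ} {α : ℝ}
    (hT : IsSoftO T fun n => (n : ℝ) ^ α) :
    IsSoftO (timeBound κ w C a b c T) fun n =>
      (n : ℝ) ^ (((κ + 1 : ℕ) : ℝ) * w - (κ + 1 : ℕ) + 1) +
        (n : ℝ) ^ (((κ + 1 : ℕ) : ℝ) * w - (κ + 1 : ℕ) + 1 + (α - w)) := by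
  obtain ⟨e, hT⟩ := hT
  obtain ⟨c₁, hc₁, hT⟩ := hT.exists_nonneg
  rw [isBigOWith_iff] at hT
  refine ⟨e + 1, IsBigO.of_bound
    (((3 + (κ + 1) * w) * a + 10 * b * c * (C + 2) : ℕ) + 3 * b * c₁) ?_⟩
  filter_upwards [hT, eventually_ge_atTop 3] with n hTn hn
  have hℓ := one_le_log hn
  have hlog := natLog_add_le hn
  set ℓ := Real.log n
  have hn0 : (0 : ℝ) < n := by positivity
  have hn1 : (1 : ℝ) ≤ n := by exact_mod_cast (by omega : 1 ≤ n)
  -- The real exponent of the claim is rewritten as a natural number, so that the factor `n ^ (κ (w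
  -- - 1))` splits off.
  have hβ : ((κ + 1 : ℕ) : ℝ) * w - (κ + 1 : ℕ) + 1 = (κ * (w - 1) + w : ℕ) := by
    obtain ⟨v, rfl⟩ : ∃ v, w = v + 1 := ⟨w - 1, by omega⟩
    simp only [Nat.add_sub_cancel]
    push_cast
    ring
  have hβ' : ((κ * (w - 1) + w : ℕ) : ℝ) + (α - w) = (κ * (w - 1) : ℕ) + α := by push_cast; ring
  rw [hβ, hβ', Real.rpow_natCast, Real.rpow_add hn0, Real.rpow_natCast]
  set m := (n : ℝ) ^ (κ * (w - 1))
  set g := (n : ℝ) ^ (κ * (w - 1) + w) with hg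
  have hm : 0 ≤ m := by positivity
  have hg' : g = m * (n : ℝ) ^ w := pow_add _ _ _
  have hnα : 0 ≤ (n : ℝ) ^ α := by positivity
  have hng : (n : ℝ) ≤ g := le_self_pow₀ hn1 (by omega)
  have hg0 : 0 ≤ g := by positivity
  have hℓe : 1 ≤ ℓ ^ (e + 1) := one_le_pow₀ hℓ
  have hℓ1 : ℓ ≤ ℓ ^ (e + 1) := le_self_pow₀ hℓ (by omega)
  have hℓ2 : ℓ ^ e ≤ ℓ ^ (e + 1) := pow_le_pow_right₀ hℓ (by omega)
  have hℓ0 : 0 ≤ ℓ ^ (e + 1) := by positivity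
  have hTn' : max (T n) 0 ≤ c₁ * ((n : ℝ) ^ α * ℓ ^ (e + 1)) := by
    refine max_le ((le_abs_self _).trans (hTn.trans ?_)) (by positivity)
    rw [Real.norm_of_nonneg (by positivity)]
    gcongr
  have hT0 : (0 : ℝ) ≤ max (T n) 0 := le_max_right _ _
  have h1 : ((2 + (κ + 1) * w * n + 1 : ℕ) : ℝ) ≤ (3 + (κ + 1) * w : ℕ) * (g * ℓ ^ (e + 1)) := by
    calc ((2 + (κ + 1) * w * n + 1 : ℕ) : ℝ) ≤ (3 + (κ + 1) * w : ℕ) * n := by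
          push_cast
          nlinarith
      _ ≤ (3 + (κ + 1) * w : ℕ) * (n * 1) := by rw [mul_one]
      _ ≤ _ := by gcongr
  have h2 : m * (((n ^ w + 1 : ℕ) : ℝ) * (Nat.log 2 n + 1 + 2 : ℕ)) ≤ 10 * (g * ℓ ^ (e + 1)) := by
    have : ((n ^ w + 1 : ℕ) : ℝ) ≤ 2 * (n : ℝ) ^ w := by
      push_cast
      linarith [one_le_pow₀ hn1 (n := w)]
    calc _ ≤ m * ((2 * (n : ℝ) ^ w) * (5 * ℓ ^ (e + 1))) := by
          gcongr
          exact hlog.trans (by linarith)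
      _ = _ := by rw [hg']; ring
  have hpow : (((n ^ (w - 1)) ^ κ : ℕ) : ℝ) = m := by
    rw [← pow_mul, mul_comm]; push_cast; rfl
  rw [Real.norm_of_nonneg (by rw [timeBound]; positivity), Real.norm_of_nonneg (by positivity),
    timeBound, Nat.cast_mul _ a, Nat.cast_mul b, hpow, Nat.cast_mul _ c, mul_assoc (C + 2),
    Nat.cast_mul (C + 2), Nat.cast_mul (n ^ w + 1)]
  set y := (((n ^ w + 1 : ℕ) : ℝ) * (Nat.log 2 n + 1 + 2 : ℕ))
  calc _ = a * ((2 + (κ + 1) * w * n + 1 : ℕ) : ℝ) + (b * c * (C + 2 : ℕ)) * (m * y) +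
        (3 * b) * (m * max (T n) 0) := by ring
    _ ≤ a * ((3 + (κ + 1) * w : ℕ) * (g * ℓ ^ (e + 1))) +
        (b * c * (C + 2 : ℕ)) * (10 * (g * ℓ ^ (e + 1))) +
        (3 * b) * (m * (c₁ * ((n : ℝ) ^ α * ℓ ^ (e + 1)))) := by gcongr
    _ = (((3 + (κ + 1) * w) * a + 10 * b * c * (C + 2) : ℕ) : ℝ) * (g * ℓ ^ (e + 1)) +
        (3 * b * c₁) * ((m * (n : ℝ) ^ α) * ℓ ^ (e + 1)) := by push_cast; ring
    _ ≤ (((3 + (κ + 1) * w) * a + 10 * b * c * (C + 2) : ℕ) : ℝ) *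
          ((g + m * (n : ℝ) ^ α) * ℓ ^ (e + 1)) +
        (3 * b * c₁) * ((g + m * (n : ℝ) ^ α) * ℓ ^ (e + 1)) := by
        gcongr
        · linarith [mul_nonneg hm hnα]
        · linarith
    _ = _ := by ring

/-- The program clears a memory segment of explicit length, so a natural constant valid for all `n ≥
1` is required. The finitely many exceptions are absorbed by adding their values to the constant. -/
lemma exists_le_mul {s : ℕ → ℕ} (hs : (fun n => (s n : ℝ)) =O[atTop] fun n : ℕ => (n : ℝ)) :
    ∃ C, ∀ n, 1 ≤ n → s n ≤ C * (n + 1) := by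
  obtain ⟨c, hc⟩ := hs.bound
  obtain ⟨n₀, hn₀⟩ := eventually_atTop.1 hc
  refine ⟨⌈c⌉₊ + ∑ i ∈ Finset.range n₀, s i, fun n _ => ?_⟩
  rcases le_or_gt n₀ n with h | h
  · have h1 := hn₀ n h
    simp only [Real.norm_natCast] at h1
    have h2 : (s n : ℝ) ≤ ((⌈c⌉₊ * n : ℕ) : ℝ) := by
      push_cast
      exact h1.trans (by gcongr; exact Nat.le_ceil c)
    have h3 : s n ≤ ⌈c⌉₊ * n := by exact_mod_cast h2
    nlinarith [Nat.zero_le (∑ i ∈ Finset.range n₀, s i)]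
  · have : s n ≤ ∑ i ∈ Finset.range n₀, s i :=
      Finset.single_le_sum (f := s) (fun _ _ => Nat.zero_le _) (Finset.mem_range.2 h)
    nlinarith [Nat.zero_le ⌈c⌉₊]

lemma isBigO_spaceBound (κ C r : ℕ) :
    (fun n => (spaceBound κ C r n : ℝ)) =O[atTop] fun n : ℕ => (n : ℝ) := by
  refine IsBigO.of_bound (r + 2 + (κ + 1) + 2 + 2 * C : ℕ) ?_
  filter_upwards [eventually_ge_atTop 1] with n hn
  rw [Real.norm_natCast, Real.norm_natCast, ← Nat.cast_mul, Nat.cast_le, spaceBound]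
  nlinarith [Nat.mul_le_mul_left r hn, Nat.mul_le_mul_left C hn]

end SumProg

theorem mainTheorem6 (k₁ k₂ : ℕ) (hk₁ : 3 ≤ k₁) (hk₂ : 1 ≤ k₂) (α : ℝ)
    (hA : LinearSpaceLasVegasKSum k₁ fun n => (n : ℝ) ^ α) :
    LinearSpaceLasVegasKSum (k₁ * k₂) fun n =>
      (n : ℝ) ^ ((k₁ : ℝ) * k₂ - k₁ + 1) + (n : ℝ) ^ ((k₁ : ℝ) * k₂ - k₁ + 1 + (α - k₂)) := by
  obtain ⟨κ, rfl⟩ : ∃ κ, k₁ = κ + 1 := ⟨k₁ - 1, by omega⟩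
  obtain ⟨M, T, s, hM, hT, hs⟩ := hA
  obtain ⟨C, hC⟩ := SumProg.exists_le_mul hs
  obtain ⟨M', a, b, c, r, hM'⟩ :=
    SumProg.exists_isLasVegasKSum (κ := κ) (by omega) hk₂ hM hC
  exact ⟨M', _, _, hM', SumProg.isSoftO_timeBound hk₂ C a b c hT,
    SumProg.isBigO_spaceBound κ C r⟩
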